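/- \textbf{Conventions.} Let $m\in\mathbb N$. Put $\overline{\mathbb C}=\mathbb C\cup\{-\infty\}$, where the log-disks $\{w:\operatorname{Re}w<\rho\}$, $\rho\in\mathbb R$, are the basic open neighbourhoods of $-\infty$, and $\operatorname{Re}(-\infty)=-\infty$, $\operatorname{Im}(-\infty)=0$, $e^{\alpha\cdot(-\infty)}=0$ for $\alpha>0$, $0\cdot(-\infty)=0$, $e^{0}=1$. A function $f:D\to\mathbb C$ with $D\subseteq\overline{\mathbb C}^m$ is \emph{log-holomorphic} if it is continuous on $D$ and holomorphic on $D\cap\mathbb C^m$. $\mathbb C[[X^*]]$ is the algebra of generalized power series $F=\sum_{\alpha\in[0,\infty)^m}a_\alpha X^\alpha$, $a_\alpha\in\mathbb C$, whose support is contained in a product of well-ordered subsets of $[0,\infty)$; for $s\in(0,\infty)^m$ put $\|F\|_s=\sum_\alpha|a_\alpha|s^\alpha\in[0,\infty]$, and let $\overline F(w)=\sum_\alpha a_\alpha e^{\alpha\cdot w}$ be the log-sum of $F$, where this series converges absolutely. A set $\Delta\subseteq[0,\infty)^m$ is \emph{natural} if $\Delta\subseteq B_1\times\cdots\times B_m$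 with sets $B_i\subseteq\mathbb R$ such that $B_i\cap(-\infty,a)$ is finite for all $a\in\mathbb R$. Let $\tau=(K,R,r,\theta,\Delta)$ with $K\subseteq[0,\infty)^m$ finite and non-empty, $R\in(0,\infty)^m$, $r>1$, $\theta>\pi/2$, and $\Delta\subseteq[0,\infty)^m$ natural and closed under addition. Let $H=\{w\in\overline{\mathbb C}^m:\operatorname{Re}w_i<\log R_i\text{ for all }i\}$ and, for $k\in K$ and $p\in\mathbb N=\{0,1,2,\dots\}$, $$S^k=\Big\{w\in H:\sum_i k_i|\operatorname{Im}w_i|<\theta\Big\},\qquad H^k_p=\Big\{w\in H:\sum_i k_i\operatorname{Re}w_i<\sum_i k_i\log R_i-\log(1+p)\Big\}\ (k\ne0),\qquad H^0_p=H,$$ $$S^\tau=\bigcap_{k\in K}S^k,\qquad S^\tau_p=\bigcap_{k\in K}(S^k\cup H^k_p),\qquad H^\tau_p=\bigcap_{k\in K}H^k_p,$$ and let $D^\tau_p\subseteq\mathbb C^m$ be the set of all $z$ with $|z_i|<R_i$ for all $i$ and $\prod_i|z_i|^{k_i}<\frac1{1+p}\prod_iR_i^{k_i}$ for all $k\in K\setminus\{0\}$.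 Put $\|F\|_{\tau,p}=\sup\{\|F\|_s:s\in\operatorname{cl}(D^\tau_p)\cap(0,\infty)^m\}$. For $f:S^\tau\to\mathbb C$ write $f=_\tau\sum_pf_p$, with associated series $F_p\in\mathbb C[[X^*]]$, if each $f_p:S^\tau_p\to\mathbb C$ is log-holomorphic, each $F_p$ has support contained in $\Delta$, $f_p=\overline{F_p}$ on $H^\tau_p$, $$\sum_p\|F_p\|_{\tau,p}\,r^p<\infty,\qquad \sum_p\Big(\sup_{S^\tau_p}|f_p|\Big)r^p<\infty,$$ and $f=\sum_pf_p$ on $S^\tau$. Let $\mathcal G_\tau$ be the set of all $f:S^\tau\to\mathbb C$ for which such $f_p$ and $F_p$ exist. \textbf{Proposition (Quasianalyticity).} For every $m$ and every such $\tau$, $\mathcal G_\tau$ is a $\mathbb C$-algebra under pointwise operations (closed under sums, products and scalar multiples). For $f\in\mathcal G_\tau$ with $f=_\tau\sum_pf_p$ and associated series $F_p=\sum_\alpha a_{\alpha,p}X^\alpha$, the series $\sum_pa_{\alpha,p}$ converges absolutely for every $\alpha$, and the generalized power series $$Tf=\sum_\alpha\Big(\sum_pa_{\alpha,p}\Big)X^\alpha\in\mathbb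 C[[X^*]]$$ depends only on $f$, not on the choice of the $f_p$ and $F_p$. The map $T:\mathcal G_\tau\to\mathbb C[[X^*]]$ is an injective homomorphism of $\mathbb C$-algebras; if $0\in\Delta$, then $1\in\mathcal G_\tau$ and $T(1)=1$. -/

import Mathlib

open scoped NNReal ENNReal

/-- The logarithmic chart `ℂ ∪ {-∞}` of the Riemann surface of the logarithm, together with the
additional origin `-∞`. -/
inductive LogPlane : Type
  | negInf : LogPlane
  | ofComplex (z : ℂ) : LogPlane

namespace LogPlane

/-- The real part, with `re (-∞) = -∞`. -/
noncomputable def re : LogPlane → EReal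
  | negInf => ⊥
  | ofComplex z => ((z.re : ℝ) : EReal)

/-- The imaginary part, with `im (-∞) = 0`. -/
noncomputable def im : LogPlane → ℝ
  | negInf => 0
  | ofComplex z => z.im

/-- The function `w ↦ e ^ (α w)`, extended continuously to `-∞`: its value there is `0` if `α > 0`,
and `1` if `α = 0`. -/
noncomputable def expMul (α : ℝ≥0) : LogPlane → ℂ
  | negInf => if α = 0 then 1 else 0
  | ofComplex z => Complex.exp (((α : ℝ) : ℂ) * z)

/-- The standard topology on `ℂ`, with the log-disks `{w | re w < r}` as basic open neighbourhoods
of `-∞`. -/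
instance : TopologicalSpace LogPlane where
  IsOpen U := IsOpen (ofComplex ⁻¹' U) ∧ (negInf ∈ U → ∃ r : ℝ, {w | re w < (r : EReal)} ⊆ U)
  isOpen_univ := ⟨by simp, fun _ => ⟨0, Set.subset_univ _⟩⟩
  isOpen_inter U V hU hV := by
    refine ⟨hU.1.inter hV.1, fun h => ?_⟩
    obtain ⟨r, hr⟩ := hU.2 h.1
    obtain ⟨s, hs⟩ := hV.2 h.2
    refine ⟨min r s, fun w hw => ⟨hr ?_, hs ?_⟩⟩
    · have h' : re w < ((min r s : ℝ) : EReal) := hw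
      have h'' : re w < (r : EReal) := lt_of_lt_of_le h' (EReal.coe_le_coe_iff.2 (min_le_left r s))
      exact h''
    · have h' : re w < ((min r s : ℝ) : EReal) := hw
      have h'' : re w < (s : EReal) := lt_of_lt_of_le h' (EReal.coe_le_coe_iff.2 (min_le_right r s))
      exact h''
  isOpen_sUnion S hS := by
    refine ⟨?_, ?_⟩
    · rw [Set.preimage_sUnion]
      exact isOpen_biUnion fun U hU => (hS U hU).1
    · rintro ⟨U, hU, hmem⟩
      obtain ⟨r, hr⟩ := (hS U hU).2 hmem
      exact ⟨r, fun w hw => ⟨U, hU, hr hw⟩⟩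

end LogPlane

/-- The inclusion of `ℂ^m` into the `m`-th power of the logarithmic chart. -/
def toLog {m : ℕ} (z : Fin m → ℂ) : Fin m → LogPlane := fun i => LogPlane.ofComplex (z i)

/-- `f` is log-holomorphic on `D`: continuous on `D` and holomorphic on `D ∩ ℂ^m`. -/
def LogHolomorphicOn {m : ℕ} (f : (Fin m → LogPlane) → ℂ) (D : Set (Fin m → LogPlane)) : Prop :=
  ContinuousOn f D ∧ DifferentiableOn ℂ (fun z => f (toLog z)) (toLog ⁻¹' D)

/-- The log-disk `H(ρ)` of log-polyradius `ρ`. -/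
def logDisk {m : ℕ} (ρ : Fin m → ℝ) : Set (Fin m → LogPlane) :=
  {w | ∀ i, (w i).re < (ρ i : EReal)}

/-- The log-`k`-polysector `S^k(ρ, θ)`. -/
def logPolysector {m : ℕ} (k : Fin m → ℝ≥0) (ρ : Fin m → ℝ) (θ : ℝ) : Set (Fin m → LogPlane) :=
  {w | w ∈ logDisk ρ ∧ ∑ i, (k i : ℝ) * |(w i).im| < θ}

/-- The log-`k`-polydisk `H^k_p(ρ)`: the points of `H(ρ)` with `k · re w < k · ρ - log (1 + p)`.
In `EReal` one has `0 * (-∞) = 0` and `c * (-∞) = -∞` for `c > 0`, as is meant here. For `k = 0`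
(Gevrey order `0`, convergence) there is no shrinking: `H^0_p(ρ) = H(ρ)`. -/
def logPolydisk {m : ℕ} (k : Fin m → ℝ≥0) (ρ : Fin m → ℝ) (p : ℕ) : Set (Fin m → LogPlane) :=
  {w | w ∈ logDisk ρ ∧
    (k = 0 ∨ ∑ i, ((k i : ℝ) : EReal) * (w i).re
      < ((∑ i, (k i : ℝ) * ρ i - Real.log (1 + p) : ℝ) : EReal))}

/-- The image `D^k_p(R)` of `H^k_p(log R)` under the exponential map: the points of the open polydisk
of polyradius `R` with `|z|^k < R^k / (1 + p)`, and the whole polydisk if `k = 0`. -/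
def polydisk {m : ℕ} (k : Fin m → ℝ≥0) (R : Fin m → ℝ) (p : ℕ) : Set (Fin m → ℂ) :=
  {z | (∀ i, ‖z i‖ < R i) ∧
    (k = 0 ∨ ∏ i, ‖z i‖ ^ (k i : ℝ) < (∏ i, R i ^ (k i : ℝ)) / (1 + p))}

/-- A set of exponents is natural if it is contained in a product of sets of reals each of which has
only finitely many elements below any given real number. -/
def IsNaturalSet {m : ℕ} (A : Set (Fin m → ℝ≥0)) : Prop :=
  ∃ B : Fin m → Set ℝ, (∀ i (a : ℝ), (B i ∩ Set.Iio a).Finite) ∧ ∀ α ∈ A, ∀ i, (α i : ℝ) ∈ B i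

/-- The ring `ℂ⟦X*⟧` of generalized power series in `X = (X_1, …, X_m)` with exponents in
`[0, ∞)^m`. A Hahn series is a family of coefficients whose support is partially well-ordered for
the componentwise order; by `isPWO_iff_subset_prod` below, this means that the support is contained
in a product of well-ordered subsets of `[0, ∞)`. -/
abbrev GenPowerSeries (m : ℕ) : Type := HahnSeries (Fin m → ℝ≥0) ℂ

theorem isPWO_iff_subset_prod {m : ℕ} (A : Set (Fin m → ℝ≥0)) :
    A.IsPWO ↔ ∃ B : Fin m → Set ℝ≥0, (∀ i, (B i).IsWF) ∧ A ⊆ Set.univ.pi B := by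
  constructor
  · intro hA
    exact ⟨fun i => (fun α => α i) '' A,
      fun i => (hA.image_of_monotone (Function.monotone_eval i)).isWF,
      fun α hα i _ => ⟨α, hα, rfl⟩⟩
  · rintro ⟨B, hB, hAB⟩
    exact (Set.IsPWO.pi fun i => Set.isPWO_iff_isWF.2 (hB i)).mono hAB

/-- `‖F‖_s = ∑_α |a_α| s^α`, in `[0, ∞]`. -/
noncomputable def GenPowerSeries.normAt {m : ℕ} (F : GenPowerSeries m) (s : Fin m → ℝ) : ℝ≥0∞ :=
  ∑' α : Fin m → ℝ≥0, ‖F.coeff α‖ₑ * ENNReal.ofReal (∏ i, s i ^ (α i : ℝ))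

/-- `‖F‖_U`: the supremum of `‖F‖_s` over the `s` in `cl(U) ∩ (0, ∞)^m`. -/
noncomputable def GenPowerSeries.normOn {m : ℕ} (F : GenPowerSeries m) (U : Set (Fin m → ℂ)) :
    ℝ≥0∞ :=
  ⨆ (s : Fin m → ℝ) (_ : ∀ i, 0 < s i) (_ : (fun i => (s i : ℂ)) ∈ closure U), F.normAt s

/-- The log-sum of `F` at `w` converges (absolutely) with sum `c`: `∑_α a_α e^(α · w) = c`. -/
def GenPowerSeries.HasLogSum {m : ℕ} (F : GenPowerSeries m) (w : Fin m → LogPlane) (c : ℂ) : Prop :=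
  HasSum (fun α : Fin m → ℝ≥0 => F.coeff α * ∏ i, (w i).expMul (α i)) c

/-- The parameters `τ = (K, R, r, θ, Δ)`. -/
structure SummParam (m : ℕ) where
  K : Finset (Fin m → ℝ≥0)
  K_nonempty : K.Nonempty
  R : Fin m → ℝ
  R_pos : ∀ i, 0 < R i
  r : ℝ
  one_lt_r : 1 < r
  θ : ℝ
  pi_div_two_lt_θ : Real.pi / 2 < θ
  Δ : Set (Fin m → ℝ≥0)
  Δ_natural : IsNaturalSet Δ
  Δ_add : ∀ α ∈ Δ, ∀ β ∈ Δ, α + β ∈ Δ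

namespace SummParam

variable {m : ℕ} (τ : SummParam m)

/-- `log R`, componentwise. -/
noncomputable def logR : Fin m → ℝ := fun i => Real.log (τ.R i)

/-- `S^τ`, the intersection of the log-polysectors `S^k(log R, θ)` for `k ∈ K`. -/
def S : Set (Fin m → LogPlane) := ⋂ k ∈ τ.K, logPolysector k τ.logR τ.θ

/-- `S^τ_p`, the intersection of the sets `S^k(log R, θ) ∪ H^k_p(log R)` for `k ∈ K`. -/
def Sp (p : ℕ) : Set (Fin m → LogPlane) :=
  ⋂ k ∈ τ.K, (logPolysector k τ.logR τ.θ ∪ logPolydisk k τ.logR p)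

/-- The intersection of the log-`k`-polydisks `H^k_p(log R)` for `k ∈ K`. -/
def Hp (p : ℕ) : Set (Fin m → LogPlane) := ⋂ k ∈ τ.K, logPolydisk k τ.logR p

/-- The intersection of the sets `D^k_p(R)` for `k ∈ K`. -/
def Dp (p : ℕ) : Set (Fin m → ℂ) := ⋂ k ∈ τ.K, polydisk k τ.R p

/-- `f =_τ ∑_p f_p`, where `F p` is the series `T(f_p)`. Boundedness of each `f_p` on `S^τ_p`, and
convergence of each `F p` on `D_p`, are part of the two summability conditions. -/
structure IsSumOf (f : τ.S → ℂ) (fp : ℕ → (Fin m → LogPlane) → ℂ) (F : ℕ → GenPowerSeries m) :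
    Prop where
  logHolomorphic : ∀ p, LogHolomorphicOn (fp p) (τ.Sp p)
  support_subset : ∀ p, (F p).support ⊆ τ.Δ
  hasLogSum : ∀ p, ∀ w ∈ τ.Hp p, (F p).HasLogSum w (fp p w)
  summable_series : ∑' p, (F p).normOn (τ.Dp p) * ENNReal.ofReal τ.r ^ p < ⊤
  summable_sup : ∑' p, (⨆ w ∈ τ.Sp p, ‖fp p w‖ₑ) * ENNReal.ofReal τ.r ^ p < ⊤
  hasSum : ∀ w : τ.S, HasSum (fun p => fp p w) (f w)

/-- The set `𝒢_τ` of generalized multisummable functions on `S^τ`. -/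
def G : Set (τ.S → ℂ) := {f | ∃ fp F, τ.IsSumOf f fp F}

end SummParam

/-! Two claims carry the theorem: the coefficient sums of a representation of 0 vanish, so that `T`
is well defined, and vanishing coefficient sums force f = 0, so that `T` is injective. Both are
studied on the diagonal lines ζ ↦ x - ζ. There the parameter k enters only through its level |k| = ∑
k_i, and a monomial of exponent α has modulus e^{α·x - |α| Re ζ}.

For the first claim (`tsum_coeff_eq_zero`), let N be the least total degree of a nonzero coefficient
sum. Naturality of Δ provides N' > N below which no further degree occurs. Truncating every F_p at
degree N costs O(e^{-N't}) on a real ray even after summation over p, because the loss (2 +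
p)^{N'/κ}, κ the smallest level, is beaten by r^{-p}. So the part of degree N vanishes at all real
points, and its monomials are linearly independent characters.

The second claim is Watson's lemma for several levels. At a point of a strip κ|Im ζ| ≤ η, where π/2
< η < θ, in general only finitely many f_p are defined, so flatness has to be a statement on partial
sums: a sum of n terms is O(exp(-δ e^{κ Re ζ}) + e^{-δn}). At the smallest level this follows from
truncation at a degree proportional to e^{κ Re ζ} (`isFlat`). It climbs to the next level κ₂ by a
Cauchy integral (`norm_sum_le_of_isFlat`, `isFlat_step`): each f_p is integrated over its own
rectangle, whose left edge depends on p so as to stay in the domain, while all rectangles share the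
right edge. The kernel makes the other edges as small as flatness of level κ₂ demands, and flatness
of level κ makes the sum over the right edge vanish in the limit. At the largest level k the whole
series is defined on the strip and is O(exp(-δ e^{k Re ζ})). As η > π/2, opening the strip to a
half-plane gives superexponential decay, and Phragmén–Lindelöf yields 0.

Vanishing at real points spreads to finite points by the identity theorem, and to points with
coordinates -∞ by continuity. Products are represented by grouping the f_p g_q by max(p, q). -/

/-! ### Cauchy integrals over rectangles -/

open Complex Set in
/-- The integral of `f` along the boundary of the rectangle `[a, x] × [-b, b]`. -/
noncomputable def rectIntegral (f : ℂ → ℂ) (a x b : ℝ) : ℂ :=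
  (∫ t : ℝ in a..x, f (t + (-b : ℝ) * I)) - (∫ t : ℝ in a..x, f (t + b * I)) +
    I * (∫ y : ℝ in (-b)..b, f (x + y * I)) - I * (∫ y : ℝ in (-b)..b, f (a + y * I))

/-- The boundary of the rectangle `[a, x] × [-b, b]`. -/
def rectBoundary (a x b : ℝ) : Set ℂ :=
  {z | (z.re ∈ Set.Icc a x ∧ z.im ∈ Set.Icc (-b) b) ∧
    (z.re = a ∨ z.re = x ∨ z.im = -b ∨ z.im = b)}

section Rectangle

open Complex Set MeasureTheory

variable {f g : ℂ → ℂ} {a x b : ℝ}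

theorem bottom_mem_rectBoundary (hb : 0 ≤ b) {t : ℝ} (ht : t ∈ Icc a x) :
    ((t : ℂ) + (-b : ℝ) * I) ∈ rectBoundary a x b := by
  simp [rectBoundary, ht.1, ht.2, hb]

theorem top_mem_rectBoundary (hb : 0 ≤ b) {t : ℝ} (ht : t ∈ Icc a x) :
    ((t : ℂ) + b * I) ∈ rectBoundary a x b := by
  simp [rectBoundary, ht.1, ht.2, hb]

theorem right_mem_rectBoundary (hax : a ≤ x) {y : ℝ} (hy : y ∈ Icc (-b) b) :
    ((x : ℂ) + y * I) ∈ rectBoundary a x b := by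
  simp [rectBoundary, hy.1, hy.2, hax]

theorem left_mem_rectBoundary (hax : a ≤ x) {y : ℝ} (hy : y ∈ Icc (-b) b) :
    ((a : ℂ) + y * I) ∈ rectBoundary a x b := by
  simp [rectBoundary, hy.1, hy.2, hax]

theorem rectIntegral_congr (hax : a ≤ x) (hb : 0 ≤ b) (h : EqOn f g (rectBoundary a x b)) :
    rectIntegral f a x b = rectIntegral g a x b := by
  have hbb : -b ≤ b := by linarith
  unfold rectIntegral
  congr 1
  · congr 1
    · congr 1
      · refine intervalIntegral.integral_congr fun t ht => h (bottom_mem_rectBoundary hb ?_)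
        rwa [uIcc_of_le hax] at ht
      · refine intervalIntegral.integral_congr fun t ht => h (top_mem_rectBoundary hb ?_)
        rwa [uIcc_of_le hax] at ht
    · congr 1
      refine intervalIntegral.integral_congr fun t ht => h (right_mem_rectBoundary hax ?_)
      rwa [uIcc_of_le hbb] at ht
  · congr 1
    refine intervalIntegral.integral_congr fun t ht => h (left_mem_rectBoundary hax ?_)
    rwa [uIcc_of_le hbb] at ht

theorem intervalIntegrable_bottom (hax : a ≤ x) (hb : 0 ≤ b)
    (hf : ContinuousOn f (rectBoundary a x b)) :
    IntervalIntegrable (fun t : ℝ => f (t + (-b : ℝ) * I)) volume a x := by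
  refine ContinuousOn.intervalIntegrable (hf.comp (by fun_prop) fun t ht => ?_)
  rw [uIcc_of_le hax] at ht
  exact bottom_mem_rectBoundary hb ht

theorem intervalIntegrable_top (hax : a ≤ x) (hb : 0 ≤ b)
    (hf : ContinuousOn f (rectBoundary a x b)) :
    IntervalIntegrable (fun t : ℝ => f (t + b * I)) volume a x := by
  refine ContinuousOn.intervalIntegrable (hf.comp (by fun_prop) fun t ht => ?_)
  rw [uIcc_of_le hax] at ht
  exact top_mem_rectBoundary hb ht

theorem intervalIntegrable_right (hax : a ≤ x) (hb : 0 ≤ b)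
    (hf : ContinuousOn f (rectBoundary a x b)) :
    IntervalIntegrable (fun y : ℝ => f (x + y * I)) volume (-b) b := by
  refine ContinuousOn.intervalIntegrable (hf.comp (by fun_prop) fun t ht => ?_)
  rw [uIcc_of_le (by linarith)] at ht
  exact right_mem_rectBoundary hax ht

theorem intervalIntegrable_left (hax : a ≤ x) (hb : 0 ≤ b)
    (hf : ContinuousOn f (rectBoundary a x b)) :
    IntervalIntegrable (fun y : ℝ => f (a + y * I)) volume (-b) b := by
  refine ContinuousOn.intervalIntegrable (hf.comp (by fun_prop) fun t ht => ?_)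
  rw [uIcc_of_le (by linarith)] at ht
  exact left_mem_rectBoundary hax ht

theorem rectIntegral_sub (hax : a ≤ x) (hb : 0 ≤ b) (hf : ContinuousOn f (rectBoundary a x b))
    (hg : ContinuousOn g (rectBoundary a x b)) :
    rectIntegral (fun z => f z - g z) a x b = rectIntegral f a x b - rectIntegral g a x b := by
  unfold rectIntegral
  rw [intervalIntegral.integral_sub (intervalIntegrable_bottom hax hb hf)
      (intervalIntegrable_bottom hax hb hg),
    intervalIntegral.integral_sub (intervalIntegrable_top hax hb hf)
      (intervalIntegrable_top hax hb hg),
    intervalIntegral.integral_sub (intervalIntegrable_right hax hb hf)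
      (intervalIntegrable_right hax hb hg),
    intervalIntegral.integral_sub (intervalIntegrable_left hax hb hf)
      (intervalIntegrable_left hax hb hg)]
  ring

theorem rectIntegral_const_mul (c : ℂ) :
    rectIntegral (fun z => c * f z) a x b = c * rectIntegral f a x b := by
  unfold rectIntegral
  simp only [intervalIntegral.integral_const_mul]
  ring

theorem rectIntegral_eq_zero (hax : a ≤ x) (hb : 0 ≤ b)
    (hf : DifferentiableOn ℂ f {z | z.re ∈ Icc a x ∧ z.im ∈ Icc (-b) b}) :
    rectIntegral f a x b = 0 := by
  have h := integral_boundary_rect_eq_zero_of_differentiableOn f ⟨a, -b⟩ ⟨x, b⟩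
    (hf.mono fun z hz => by
      have h1 := hz.1
      have h2 := hz.2
      simp only [mem_preimage, uIcc_of_le hax, uIcc_of_le (show -b ≤ b by linarith)] at h1 h2
      exact ⟨h1, h2⟩)
  simpa only [rectIntegral, smul_eq_mul] using h

/-- The difference quotient `dslope` is holomorphic across ζ, so its boundary integral vanishes. The
integral of 1/(z - ζ) is left unevaluated, since a lower bound for its modulus is enough later. -/
theorem rectIntegral_div_sub {ζ : ℂ} (ha : a < ζ.re) (hx : ζ.re < x) (hb : |ζ.im| < b)
    (hf : DifferentiableOn ℂ f {z | z.re ∈ Icc a x ∧ z.im ∈ Icc (-b) b}) :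
    rectIntegral (fun z => f z / (z - ζ)) a x b
      = f ζ * rectIntegral (fun z => 1 / (z - ζ)) a x b := by
  have hax : a ≤ x := by linarith
  have hb0 : 0 ≤ b := (abs_nonneg _).trans hb.le
  obtain ⟨hb1, hb2⟩ := abs_lt.1 hb
  have hne : ∀ z ∈ rectBoundary a x b, z - ζ ≠ 0 := by
    rintro z ⟨-, h⟩ h0
    rw [sub_eq_zero] at h0
    subst h0
    rcases h with h | h | h | h <;> linarith
  have hnhds : {z : ℂ | z.re ∈ Icc a x ∧ z.im ∈ Icc (-b) b} ∈ nhds ζ := by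
    have h1 : ∀ᶠ z : ℂ in nhds ζ, z.re ∈ Icc a x :=
      continuous_re.continuousAt.preimage_mem_nhds (Icc_mem_nhds ha hx)
    have h2 : ∀ᶠ z : ℂ in nhds ζ, z.im ∈ Icc (-b) b :=
      continuous_im.continuousAt.preimage_mem_nhds (Icc_mem_nhds hb1 hb2)
    exact h1.and h2
  have h0 := rectIntegral_eq_zero hax hb0 ((differentiableOn_dslope hnhds).2 hf)
  have hsub : rectBoundary a x b ⊆ {z : ℂ | z.re ∈ Icc a x ∧ z.im ∈ Icc (-b) b} := fun z hz => hz.1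
  have hc1 : ContinuousOn (fun z => f z / (z - ζ)) (rectBoundary a x b) :=
    (hf.continuousOn.mono hsub).div (by fun_prop) hne
  have hc2 : ContinuousOn (fun z => f ζ * (1 / (z - ζ))) (rectBoundary a x b) :=
    continuousOn_const.mul (continuousOn_const.div (by fun_prop) hne)
  rw [rectIntegral_congr hax hb0 (g := fun z => f z / (z - ζ) - f ζ * (1 / (z - ζ))),
    rectIntegral_sub hax hb0 hc1 hc2, rectIntegral_const_mul] at h0
  · exact sub_eq_zero.1 h0
  · intro z hz
    have hzz := hne z hz
    rw [dslope_of_ne _ (sub_ne_zero.1 hzz), slope_def_field]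
    field_simp

theorem inv_add_mul_I_im (u v : ℝ) : (1 / ((u : ℂ) + v * I)).im = -v / (u ^ 2 + v ^ 2) := by
  simp [Complex.inv_im, Complex.normSq_apply, sq]

theorem inv_add_mul_I_re (u v : ℝ) : (1 / ((u : ℂ) + v * I)).re = u / (u ^ 2 + v ^ 2) := by
  simp [Complex.inv_re, Complex.normSq_apply, sq]

theorem intervalIntegral_im {h : ℝ → ℂ} {c d : ℝ} (hh : IntervalIntegrable h volume c d) :
    (∫ t in c..d, h t).im = ∫ t in c..d, (h t).im := by
  have := (imCLM.intervalIntegral_comp_comm hh)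
  simpa using this.symm

theorem intervalIntegral_re {h : ℝ → ℂ} {c d : ℝ} (hh : IntervalIntegrable h volume c d) :
    (∫ t in c..d, h t).re = ∫ t in c..d, (h t).re := by
  have := (reCLM.intervalIntegral_comp_comm hh)
  simpa using this.symm

/-- All four edges contribute with the same sign to the imaginary part, so three may be dropped. On
the left edge the vertical distance to ζ is at most 2b. -/
theorem le_norm_rectIntegral_inv {ζ : ℂ} (ha : a < ζ.re) (hx : ζ.re < x) (hb : |ζ.im| < b) :
    2 * b * ((ζ.re - a) / ((ζ.re - a) ^ 2 + (2 * b) ^ 2))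
      ≤ ‖rectIntegral (fun z => 1 / (z - ζ)) a x b‖ := by
  have hax : a ≤ x := by linarith
  have hb0 : 0 ≤ b := (abs_nonneg _).trans hb.le
  have hbb : -b ≤ b := by linarith
  obtain ⟨hb1, hb2⟩ := abs_lt.1 hb
  have hne : ∀ z ∈ rectBoundary a x b, z - ζ ≠ 0 := by
    rintro z ⟨-, h⟩ h0
    rw [sub_eq_zero] at h0
    subst h0
    rcases h with h | h | h | h <;> linarith
  have hc : ContinuousOn (fun z => 1 / (z - ζ)) (rectBoundary a x b) :=
    continuousOn_const.div (by fun_prop) hne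
  have e1 : ∀ s t : ℝ, (s : ℂ) + t * I - ζ = ((s - ζ.re : ℝ) : ℂ) + ((t - ζ.im : ℝ) : ℂ) * I := by
    intro s t
    apply Complex.ext <;> simp
  refine le_trans ?_ ((le_abs_self _).trans (abs_im_le_norm _))
  have him : (rectIntegral (fun z => 1 / (z - ζ)) a x b).im =
      (∫ t : ℝ in a..x, (1 / ((t : ℂ) + (-b : ℝ) * I - ζ)).im)
      - (∫ t : ℝ in a..x, (1 / ((t : ℂ) + b * I - ζ)).im)
      + (∫ y : ℝ in (-b)..b, (1 / ((x : ℂ) + y * I - ζ)).re)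
      - (∫ y : ℝ in (-b)..b, (1 / ((a : ℂ) + y * I - ζ)).re) := by
    rw [← intervalIntegral_im (intervalIntegrable_bottom hax hb0 hc),
      ← intervalIntegral_im (intervalIntegrable_top hax hb0 hc),
      ← intervalIntegral_re (intervalIntegrable_right hax hb0 hc),
      ← intervalIntegral_re (intervalIntegrable_left hax hb0 hc)]
    simp [rectIntegral]
  rw [him]
  have h1 : 0 ≤ ∫ t : ℝ in a..x, (1 / ((t : ℂ) + (-b : ℝ) * I - ζ)).im := by
    refine intervalIntegral.integral_nonneg hax fun t _ => ?_
    rw [e1, inv_add_mul_I_im]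
    exact div_nonneg (by linarith) (by positivity)
  have h2 : ∫ t : ℝ in a..x, (1 / ((t : ℂ) + b * I - ζ)).im ≤ 0 := by
    rw [← neg_nonneg, ← intervalIntegral.integral_neg]
    refine intervalIntegral.integral_nonneg hax fun t _ => ?_
    rw [e1, inv_add_mul_I_im, ← neg_div]
    exact div_nonneg (by linarith) (by positivity)
  have h3 : 0 ≤ ∫ y : ℝ in (-b)..b, (1 / ((x : ℂ) + y * I - ζ)).re := by
    refine intervalIntegral.integral_nonneg hbb fun t _ => ?_
    rw [e1, inv_add_mul_I_re]
    exact div_nonneg (by linarith) (by positivity)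
  have h4 : 2 * b * ((ζ.re - a) / ((ζ.re - a) ^ 2 + (2 * b) ^ 2)) ≤
      ∫ y : ℝ in (-b)..b, -(1 / ((a : ℂ) + y * I - ζ)).re := by
    have h5 := intervalIntegral.integral_mono_on (μ := volume)
      (f := fun _ => (ζ.re - a) / ((ζ.re - a) ^ 2 + (2 * b) ^ 2))
      (g := fun y : ℝ => -(1 / ((a : ℂ) + y * I - ζ)).re) hbb
      (by simp) ?_ ?_
    · rw [intervalIntegral.integral_const] at h5
      refine le_trans (le_of_eq ?_) h5
      rw [smul_eq_mul]; ring
    · refine ContinuousOn.intervalIntegrable ?_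
      refine (continuous_re.comp_continuousOn (hc.comp (f := fun y : ℝ => (a : ℂ) + y * I)
        (by fun_prop) fun t ht => ?_)).neg
      rw [uIcc_of_le hbb] at ht
      exact left_mem_rectBoundary hax ht
    · intro y hy
      rw [e1, inv_add_mul_I_re, ← neg_div, neg_sub]
      refine div_le_div_of_nonneg_left (by linarith) ?_ ?_
      · have : 0 < (a - ζ.re) ^ 2 := by
          have : a - ζ.re ≠ 0 := by linarith
          positivity
        positivity
      · have h6 : (a - ζ.re) ^ 2 = (ζ.re - a) ^ 2 := by ring
        have h7 : (y - ζ.im) ^ 2 ≤ (2 * b) ^ 2 := by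
          apply sq_le_sq'
          · linarith [hy.1]
          · linarith [hy.2]
        linarith
  rw [intervalIntegral.integral_neg] at h4
  linarith

/-- All the edges except the right one, with an exponential weight on the horizontal edges. -/
theorem norm_rectIntegral_sub_right_le {t₀ B E : ℝ} (hax : a ≤ x) (hb : 0 ≤ b)
    (hleft : ∀ y ∈ Icc (-b) b, ‖f (a + y * I)‖ ≤ B)
    (hE : 0 ≤ E)
    (hbot : ∀ t ∈ Icc a x, ‖f (t + (-b : ℝ) * I)‖ ≤ E * Real.exp (-(t - t₀)))
    (htop : ∀ t ∈ Icc a x, ‖f (t + b * I)‖ ≤ E * Real.exp (-(t - t₀))) :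
    ‖rectIntegral f a x b - I * ∫ y : ℝ in (-b)..b, f (x + y * I)‖
      ≤ 2 * (E * Real.exp (-(a - t₀))) + 2 * b * B := by
  have hbb : -b ≤ b := by linarith
  -- The weight has an explicit primitive, which makes the bound independent of x; the right edge
  -- will be moved to infinity.
  have hint : ∫ t in a..x, E * Real.exp (-(t - t₀)) ≤ E * Real.exp (-(a - t₀)) := by
    have hd : ∀ t ∈ uIcc a x, HasDerivAt (fun t => -(E * Real.exp (-(t - t₀))))
        (E * Real.exp (-(t - t₀))) t := by
      intro t _
      have h1 : HasDerivAt (fun t : ℝ => -(t - t₀)) (-1) t :=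
        ((hasDerivAt_id t).sub_const t₀).neg
      exact (h1.exp.const_mul E).neg.congr_deriv (by ring)
    rw [intervalIntegral.integral_eq_sub_of_hasDerivAt hd
      (Continuous.intervalIntegrable (by fun_prop) _ _)]
    have : 0 ≤ E * Real.exp (-(x - t₀)) := by positivity
    linarith
  have h1 : ‖∫ t : ℝ in a..x, f (t + (-b : ℝ) * I)‖ ≤ E * Real.exp (-(a - t₀)) := by
    refine le_trans (intervalIntegral.norm_integral_le_of_norm_le hax
      (Filter.Eventually.of_forall fun t ht => hbot t ⟨ht.1.le, ht.2⟩)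
      (Continuous.intervalIntegrable (by fun_prop) _ _)) hint
  have h2 : ‖∫ t : ℝ in a..x, f (t + b * I)‖ ≤ E * Real.exp (-(a - t₀)) := by
    refine le_trans (intervalIntegral.norm_integral_le_of_norm_le hax
      (Filter.Eventually.of_forall fun t ht => htop t ⟨ht.1.le, ht.2⟩)
      (Continuous.intervalIntegrable (by fun_prop) _ _)) hint
  have h3 : ‖∫ y : ℝ in (-b)..b, f (a + y * I)‖ ≤ 2 * b * B := by
    refine le_trans (intervalIntegral.norm_integral_le_of_norm_le_const (C := B) fun y hy => ?_) ?_
    · rw [uIoc_of_le hbb] at hy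
      exact hleft y ⟨hy.1.le, hy.2⟩
    · rw [abs_of_nonneg (by linarith)]
      apply le_of_eq; ring
  have : rectIntegral f a x b - I * ∫ y : ℝ in (-b)..b, f (x + y * I) =
      (∫ t : ℝ in a..x, f (t + (-b : ℝ) * I)) - (∫ t : ℝ in a..x, f (t + b * I))
      - I * (∫ y : ℝ in (-b)..b, f (a + y * I)) := by
    unfold rectIntegral; ring
  rw [this]
  refine (norm_sub_le _ _).trans ?_
  have h4 := norm_sub_le (∫ t : ℝ in a..x, f (t + (-b : ℝ) * I)) (∫ t : ℝ in a..x, f (t + b * I))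
  rw [norm_mul, norm_I, one_mul]
  linarith

end Rectangle

/-! ### Families of several levels -/

/-- The domain of the `p`-th function of a family of the levels in `L`. -/
def summDomain (L : Finset ℝ) (θ : ℝ) (p : ℕ) : Set ℂ :=
  {ζ | 0 < ζ.re ∧ ∀ k ∈ L, k * |ζ.im| < θ ∨ Real.log (1 + p) < k * ζ.re}

/-- A family of holomorphic functions on the domains `summDomain L θ p` that decays
geometrically. -/
structure IsSummFamily (L : Finset ℝ) (θ ℓ C : ℝ) (φ : ℕ → ℂ → ℂ) : Prop where
  level_pos : ∀ k ∈ L, 0 < k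
  rate_pos : 0 < ℓ
  const_nonneg : 0 ≤ C
  differentiableOn : ∀ p, DifferentiableOn ℂ (φ p) (summDomain L θ p)
  norm_le : ∀ p, ∀ ζ ∈ summDomain L θ p, ‖φ p ζ‖ ≤ C * Real.exp (-ℓ * p)

/-- On the strip `κ |Im ζ| ≤ η`, the partial sums are flat of level `κ`. -/
def IsFlat (L : Finset ℝ) (θ : ℝ) (φ : ℕ → ℂ → ℂ) (η κ : ℝ) : Prop :=
  ∃ C δ : ℝ, 0 ≤ C ∧ 0 < δ ∧ ∀ ζ : ℂ, 0 < ζ.re → κ * |ζ.im| ≤ η → ∀ n : ℕ,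
    (∀ p < n, ζ ∈ summDomain L θ p) →
      ‖∑ p ∈ Finset.range n, φ p ζ‖ ≤ C * (Real.exp (-δ * Real.exp (κ * ζ.re)) + Real.exp (-δ * n))

section Exponential

open Real Filter Topology

/-- The larger rate wins, whatever the constants. This kills the right edge of the Cauchy integral,
and later gives the superexponential decay in Watson's lemma. -/
theorem tendsto_exp_mul_sub_exp_mul {a b c d : ℝ} (hb : 0 < b) (hab : b < a) (hd : 0 < d) :
    Tendsto (fun s : ℝ => exp (c * exp (b * s) - d * exp (a * s))) atTop (𝓝 0) := by
  refine tendsto_exp_atBot.comp ?_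
  have h1 : Tendsto (fun s : ℝ => exp (b * s)) atTop atTop :=
    tendsto_exp_atTop.comp (tendsto_id.const_mul_atTop hb)
  have h2 : Tendsto (fun s : ℝ => c - d * exp ((a - b) * s)) atTop atBot := by
    have := (tendsto_exp_atTop.comp (tendsto_id.const_mul_atTop (sub_pos.2 hab))).const_mul_atTop hd
    simpa [sub_eq_add_neg] using tendsto_atBot_add_const_left _ c (tendsto_neg_atTop_atBot.comp this)
  refine (h1.atTop_mul_atBot₀ h2).congr fun s => ?_
  have : exp (a * s) = exp (b * s) * exp ((a - b) * s) := by rw [← exp_add]; congr 1; ring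
  rw [this]; ring

theorem summable_exp_neg_mul_nat {c : ℝ} (hc : 0 < c) : Summable fun p : ℕ => exp (-c * p) := by
  have h := summable_geometric_of_lt_one (exp_pos (-c)).le (by simpa using hc)
  refine h.congr fun p => ?_
  rw [← exp_nat_mul]; congr 1; ring

theorem sum_exp_neg_mul_nat_le {c : ℝ} (hc : 0 < c) (s : Finset ℕ) :
    ∑ p ∈ s, exp (-c * p) ≤ ∑' p : ℕ, exp (-c * p) :=
  (summable_exp_neg_mul_nat hc).sum_le_tsum s fun _ _ => (exp_pos _).le

/-- A tail of the geometric series. -/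
theorem sum_Ico_exp_neg_mul_nat_le {c : ℝ} (hc : 0 < c) (m n : ℕ) :
    ∑ p ∈ Finset.Ico m n, exp (-c * p) ≤ (∑' p : ℕ, exp (-c * p)) * exp (-c * m) := by
  rw [Finset.sum_Ico_eq_sum_range]
  have : ∀ p ∈ Finset.range (n - m), exp (-c * ((m + p : ℕ) : ℝ)) = exp (-c * p) * exp (-c * m) := by
    intro p _
    rw [← exp_add]; congr 1; push_cast; ring
  rw [Finset.sum_congr rfl this, ← Finset.sum_mul]
  exact mul_le_mul_of_nonneg_right (sum_exp_neg_mul_nat_le hc _) (exp_pos _).le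

end Exponential

/-- No level lies strictly between κ and κ₂: those up to κ are controlled by the imaginary part,
those from κ₂ on by the real part. -/
theorem mem_summDomain {L : Finset ℝ} {θ η κ κ₂ : ℝ} {p : ℕ} {z : ℂ} (hη : η < θ)
    (hgap : ∀ k ∈ L, k ≤ κ ∨ κ₂ ≤ k) (hre : 0 < z.re) (him : κ * |z.im| ≤ η)
    (hp : Real.log (1 + p) < κ₂ * z.re) : z ∈ summDomain L θ p := by
  refine ⟨hre, fun k hk => ?_⟩
  rcases hgap k hk with h | h
  · left
    exact lt_of_le_of_lt (mul_le_mul_of_nonneg_right h (abs_nonneg _)) (lt_of_le_of_lt him hη)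
  · right
    exact lt_of_lt_of_le hp (mul_le_mul_of_nonneg_right h hre.le)

namespace IsSummFamily

variable {L : Finset ℝ} {θ ℓ C : ℝ} {φ : ℕ → ℂ → ℂ}

theorem norm_sum_Ico_le (h : IsSummFamily L θ ℓ C φ) {m n : ℕ} {ζ : ℂ}
    (hζ : ∀ p < n, ζ ∈ summDomain L θ p) :
    ‖∑ p ∈ Finset.Ico m n, φ p ζ‖ ≤
      C * (∑' p : ℕ, Real.exp (-ℓ * p)) * Real.exp (-ℓ * m) := by
  have h1 : ∀ p ∈ Finset.Ico m n, ‖φ p ζ‖ ≤ C * Real.exp (-ℓ * p) := fun p hp =>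
    h.norm_le p ζ (hζ p (Finset.mem_Ico.1 hp).2)
  refine (norm_sum_le_of_le _ h1).trans ?_
  rw [← Finset.mul_sum, mul_assoc]
  exact mul_le_mul_of_nonneg_left (sum_Ico_exp_neg_mul_nat_le h.rate_pos m n) h.const_nonneg

/-- Allows a partial sum of any length to be compared with one of the length suited to ζ. -/
theorem norm_sum_range_sub_le (h : IsSummFamily L θ ℓ C φ) {m n : ℕ} {ζ : ℂ}
    (hm : ∀ p < m, ζ ∈ summDomain L θ p) (hn : ∀ p < n, ζ ∈ summDomain L θ p) :
    ‖∑ p ∈ Finset.range n, φ p ζ - ∑ p ∈ Finset.range m, φ p ζ‖ ≤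
      C * (∑' p : ℕ, Real.exp (-ℓ * p)) * (Real.exp (-ℓ * m) + Real.exp (-ℓ * n)) := by
  have hS : 0 ≤ C * (∑' p : ℕ, Real.exp (-ℓ * p)) :=
    mul_nonneg h.const_nonneg (tsum_nonneg fun p => (Real.exp_pos _).le)
  rw [mul_add]
  rcases le_total m n with hmn | hmn
  · rw [← Finset.sum_Ico_eq_sub _ hmn]
    refine (h.norm_sum_Ico_le hn).trans ?_
    have := mul_nonneg hS (Real.exp_pos (-ℓ * n)).le
    linarith
  · rw [norm_sub_rev, ← Finset.sum_Ico_eq_sub _ hmn]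
    refine (h.norm_sum_Ico_le hm).trans ?_
    have := mul_nonneg hS (Real.exp_pos (-ℓ * m)).le
    linarith

end IsSummFamily

/-! ### The Cauchy kernel and the edges of one rectangle -/

/-- The exponential factor of the Cauchy kernel. -/
noncomputable def expKernel (κ M : ℝ) (ζ z : ℂ) : ℂ :=
  Complex.exp (M * (Complex.exp (κ * z) - Complex.exp (κ * ζ)) - (z - ζ))

theorem expKernel_self (κ M : ℝ) (ζ : ℂ) : expKernel κ M ζ ζ = 1 := by simp [expKernel]

theorem differentiable_expKernel (κ M : ℝ) (ζ : ℂ) : Differentiable ℂ (expKernel κ M ζ) := by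
  unfold expKernel; fun_prop

theorem norm_expKernel (κ M : ℝ) (ζ z : ℂ) :
    ‖expKernel κ M ζ z‖ = Real.exp (M * (Real.exp (κ * z.re) * Real.cos (κ * z.im) -
      Real.exp (κ * ζ.re) * Real.cos (κ * ζ.im)) - (z.re - ζ.re)) := by
  have h : ∀ z : ℂ, (Complex.exp (κ * z)).re = Real.exp (κ * z.re) * Real.cos (κ * z.im) := by
    intro z; rw [Complex.exp_re]; simp
  rw [expKernel, Complex.norm_exp, Complex.sub_re, Complex.re_ofReal_mul, Complex.sub_re, h, h,
    Complex.sub_re]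

open Real Set in
/-- The contribution to the Cauchy integral of one function of the family: apart from the right
edge, it is superexponentially small. -/
theorem norm_rectIntegral_kernel_sub_right_le {g : ℂ → ℂ} {ζ : ℂ} {κ M a x b d G B V F : ℝ}
    (hax : a ≤ x) (hb : κ * b = π / 2) (hd : 0 < d) (hζ : |ζ.im| + d ≤ b)
    (hM : 0 ≤ M) (hG : 0 ≤ G)
    (hV : V ≤ exp (κ * ζ.re) * cos (κ * ζ.im))
    (hg : ∀ z : ℂ, z.re ∈ Icc a x → z.im ∈ Icc (-b) b → ‖g z‖ ≤ G)
    (hleft : ∀ y ∈ Icc (-b) b, B ≤ ‖(a : ℂ) + y * Complex.I - ζ‖) (hB : 0 < B)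
    (hF : M * (exp (κ * a) - V) - (a - ζ.re) ≤ F) :
    ‖rectIntegral (fun z => g z * expKernel κ M ζ z / (z - ζ)) a x b -
      Complex.I * ∫ y : ℝ in (-b)..b, g (x + y * Complex.I) * expKernel κ M ζ (x + y * Complex.I) /
        (x + y * Complex.I - ζ)‖ ≤
      2 * (G * exp (-(M * V)) / d * exp (-(a - ζ.re))) + 2 * b * (G * exp F / B) := by
  have hb0 : 0 < b := by
    have := abs_nonneg ζ.im
    linarith
  have hhor : ∀ t ∈ Icc a x, ∀ c : ℝ, (c = b ∨ c = -b) →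
      ‖g (t + c * Complex.I) * expKernel κ M ζ (t + c * Complex.I) / (t + c * Complex.I - ζ)‖ ≤
        G * exp (-(M * V)) / d * exp (-(t - ζ.re)) := by
    intro t ht c hc
    -- As κb = π/2, the number e^{κz} is purely imaginary on the horizontal edges, so of the double
    -- exponential only the decaying factor from ζ remains.
    have hcos : cos (κ * c) = 0 := by
      rcases hc with rfl | rfl
      · rw [hb, cos_pi_div_two]
      · rw [mul_neg, cos_neg, hb, cos_pi_div_two]
    have hcm : c ∈ Icc (-b) b := by
      rcases hc with rfl | rfl
      · exact ⟨by linarith, le_rfl⟩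
      · exact ⟨le_rfl, by linarith⟩
    have h1 : ‖expKernel κ M ζ (t + c * Complex.I)‖ ≤ exp (-(M * V)) * exp (-(t - ζ.re)) := by
      rw [norm_expKernel, ← exp_add]
      apply exp_le_exp.2
      simp only [Complex.add_re, Complex.ofReal_re, Complex.mul_re, Complex.I_re, mul_zero,
        Complex.ofReal_im, Complex.I_im, mul_one, sub_self, add_zero, Complex.add_im,
        Complex.mul_im, zero_add, hcos]
      have := mul_le_mul_of_nonneg_left hV hM
      linarith
    have h2 : ‖g (t + c * Complex.I)‖ ≤ G := hg _ (by simpa using ht) (by simpa using hcm)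
    have h3 : d ≤ ‖(t : ℂ) + c * Complex.I - ζ‖ := by
      refine le_trans ?_ (Complex.abs_im_le_norm _)
      simp only [Complex.sub_im, Complex.add_im, Complex.ofReal_im, Complex.mul_im,
        Complex.ofReal_re, Complex.I_im, mul_one, Complex.I_re, mul_zero, add_zero, zero_add]
      rcases hc with rfl | rfl
      · exact le_trans (by linarith [le_abs_self ζ.im]) (le_abs_self _)
      · exact le_trans (by linarith [neg_abs_le ζ.im]) (neg_le_abs _)
    rw [norm_div, norm_mul]
    calc ‖g (t + c * Complex.I)‖ * ‖expKernel κ M ζ (t + c * Complex.I)‖ /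
          ‖(t : ℂ) + c * Complex.I - ζ‖
        ≤ G * (exp (-(M * V)) * exp (-(t - ζ.re))) / d := by gcongr
      _ = G * exp (-(M * V)) / d * exp (-(t - ζ.re)) := by ring
  refine norm_rectIntegral_sub_right_le hax hb0.le ?_ (by positivity) ?_ ?_
  · intro y hy
    have h1 : ‖expKernel κ M ζ (a + y * Complex.I)‖ ≤ exp F := by
      rw [norm_expKernel]
      apply exp_le_exp.2
      refine le_trans ?_ hF
      simp only [Complex.add_re, Complex.ofReal_re, Complex.mul_re, Complex.I_re, mul_zero,
        Complex.ofReal_im, Complex.I_im, mul_one, sub_self, add_zero, Complex.add_im,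
        Complex.mul_im, zero_add]
      have h2 : exp (κ * a) * cos (κ * y) ≤ exp (κ * a) :=
        mul_le_of_le_one_right (exp_pos _).le (cos_le_one _)
      have := mul_le_mul_of_nonneg_left (sub_le_sub h2 hV) hM
      linarith
    have h2 : ‖g (a + y * Complex.I)‖ ≤ G :=
      hg _ (by simpa using hax) (by simpa using hy)
    rw [norm_div, norm_mul]
    have h3 := hleft y hy
    gcongr
  · intro t ht
    exact hhor t ht (-b) (Or.inr rfl)
  · intro t ht
    exact hhor t ht b (Or.inl rfl)

namespace IsSummFamily

open Real Set

variable {L : Finset ℝ} {θ ℓ C : ℝ} {φ : ℕ → ℂ → ℂ}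

/-- The contribution of one function to the Cauchy integral, apart from the right edge. The left
edge lies at distance `A` to the left of `ζ`, and `c` bounds the cosine from below. -/
theorem rectIntegral_bound (h : IsSummFamily L θ ℓ C φ) {η κ κ' κ₂ b d A c μ t₀ : ℝ} {ζ : ℂ}
    (hηθ : η < θ) (hgap : ∀ k ∈ L, k ≤ κ ∨ κ₂ ≤ k)
    (hκ' : 0 < κ') (hκκ : κ' < κ) (hκ₂ : κ < κ₂) (hb : κ' * b = π / 2) (hbη : κ * b = η)
    (hd : 0 < d) (hζd : |ζ.im| + d ≤ b) (hc : 0 < c) (hcos : c ≤ cos (κ' * ζ.im))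
    (hA : 0 < A) (hcA : exp (-(κ' * A)) ≤ c / 2) (hμ : 0 < μ)
    (hμA : μ * exp ((κ₂ - κ') * A + κ' * (A + 1)) ≤ ℓ / 2)
    (ht₀ : ζ.re = t₀) (hAt : A < t₀) (p : ℕ) {a x : ℝ} (hax : a ≤ x)
    (ha : (log (1 + p) < κ₂ * (t₀ - A) ∧ a = t₀ - A) ∨
      (κ₂ * (t₀ - A) ≤ log (1 + p) ∧ a = log (1 + p) / κ₂ + (A + 1))) :
    ‖rectIntegral (fun z => φ p z * expKernel κ' (μ * exp ((κ₂ - κ') * t₀)) ζ z / (z - ζ)) a x b -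
      Complex.I * ∫ y : ℝ in (-b)..b, φ p (x + y * Complex.I) *
        expKernel κ' (μ * exp ((κ₂ - κ') * t₀)) ζ (x + y * Complex.I) /
        (x + y * Complex.I - ζ)‖ ≤
      (2 * (C / d * exp A) + 2 * b * (C * exp A / A + C * exp ℓ)) * exp (-(ℓ / 4) * p) *
        exp (-(min (μ * c / 2) (ℓ / 4 * exp (-(κ₂ * A)))) * exp (κ₂ * t₀)) := by
  have hℓ := h.rate_pos
  have hC := h.const_nonneg
  set M := μ * exp ((κ₂ - κ') * t₀) with hMdef
  set δ := min (μ * c / 2) (ℓ / 4 * exp (-(κ₂ * A))) with hδ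
  set Y := exp (κ₂ * t₀) with hY
  have hYpos : 0 < Y := exp_pos _
  have hMpos : 0 < M := by positivity
  have hκ₂pos : 0 < κ₂ := by linarith
  have hbpos : 0 < b := by
    have := abs_nonneg ζ.im
    linarith
  have hlog0 : 0 ≤ log (1 + (p : ℝ)) := log_nonneg (by linarith [p.cast_nonneg (α := ℝ)])
  have hV : c * exp (κ' * t₀) ≤ exp (κ' * ζ.re) * cos (κ' * ζ.im) := by
    rw [ht₀, mul_comm]
    exact mul_le_mul_of_nonneg_left hcos (exp_pos _).le
  -- M is scaled so that M e^{κ't₀} = μ e^{κ₂t₀}: this turns the rate κ' of the kernel into the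
  -- wanted rate κ₂.
  have hMV : M * (c * exp (κ' * t₀)) = μ * c * Y := by
    rw [hMdef, hY]
    have : exp (κ₂ * t₀) = exp ((κ₂ - κ') * t₀) * exp (κ' * t₀) := by
      rw [← exp_add]; congr 1; ring
    rw [this]; ring
  have hapos : 0 < a := by
    rcases ha with ⟨-, rfl⟩ | ⟨-, rfl⟩
    · linarith
    · have := div_nonneg hlog0 hκ₂pos.le
      linarith
  have ha1 : log (1 + p) < κ₂ * a := by
    rcases ha with ⟨h1, rfl⟩ | ⟨h1, rfl⟩
    · exact h1
    · rw [mul_add, mul_div_cancel₀ _ hκ₂pos.ne']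
      have : 0 < κ₂ * (A + 1) := by positivity
      linarith
  have haT : t₀ - A ≤ a := by
    rcases ha with ⟨h1, rfl⟩ | ⟨h1, rfl⟩
    · exact le_rfl
    · have : t₀ - A ≤ log (1 + p) / κ₂ := by rw [le_div_iff₀ hκ₂pos]; linarith
      linarith
  have hg : ∀ z : ℂ, z.re ∈ Icc a x → z.im ∈ Icc (-b) b → ‖φ p z‖ ≤ C * exp (-ℓ * p) := by
    intro z hz1 hz2
    refine h.norm_le p z (mem_summDomain hηθ hgap (hapos.trans_le hz1.1) ?_ ?_)
    · rw [← hbη]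
      exact mul_le_mul_of_nonneg_left (abs_le.2 hz2) (by linarith)
    · exact ha1.trans_le (mul_le_mul_of_nonneg_left hz1.1 hκ₂pos.le)
  have hp4 : exp (-ℓ * p) ≤ exp (-(ℓ / 4) * p) := by
    apply exp_le_exp.2
    have : 0 ≤ ℓ * p := by positivity
    linarith
  have hhor : 2 * (C * exp (-ℓ * p) * exp (-(M * (c * exp (κ' * t₀)))) / d * exp (-(a - ζ.re))) ≤
      2 * (C / d * exp A) * exp (-(ℓ / 4) * p) * exp (-δ * Y) := by
    have h1 : exp (-(M * (c * exp (κ' * t₀)))) ≤ exp (-δ * Y) := by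
      apply exp_le_exp.2
      rw [hMV, neg_mul]
      apply neg_le_neg
      refine mul_le_mul_of_nonneg_right (le_trans (min_le_left _ _) ?_) hYpos.le
      have : 0 < μ * c := by positivity
      linarith
    have h2 : exp (-(a - ζ.re)) ≤ exp A := exp_le_exp.2 (by linarith)
    calc 2 * (C * exp (-ℓ * p) * exp (-(M * (c * exp (κ' * t₀)))) / d * exp (-(a - ζ.re)))
        ≤ 2 * (C * exp (-(ℓ / 4) * p) * exp (-δ * Y) / d * exp A) := by gcongr
      _ = _ := by ring
  -- If the left edge is at t₀ - A, then e^{κ'a} is at most c/2 times e^{κ't₀} and the kernel itself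
  -- is small there. Otherwise the edge lies to the right of ζ, the kernel may be as large as
  -- e^{ℓ(1+p)/2}, and the decay of `φ p` has to pay for it.
  rcases ha with ⟨h1, h2⟩ | ⟨h1, h2⟩
  · refine (norm_rectIntegral_kernel_sub_right_le (G := C * exp (-ℓ * p)) (B := A)
      (V := c * exp (κ' * t₀)) (F := -δ * Y + A) hax hb hd hζd hMpos.le (by positivity) hV hg
      ?_ hA ?_).trans ?_
    · intro y _
      refine le_trans ?_ (Complex.abs_re_le_norm _)
      refine le_trans ?_ (neg_le_abs _)
      simp [ht₀, h2]
    · have h3 : M * exp (κ' * a) ≤ μ * c / 2 * Y := by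
        have : exp (κ' * a) = exp (κ' * t₀) * exp (-(κ' * A)) := by
          rw [← exp_add]; congr 1; rw [h2]; ring
        rw [this]
        calc M * (exp (κ' * t₀) * exp (-(κ' * A))) ≤ M * (exp (κ' * t₀) * (c / 2)) := by gcongr
          _ = M * (c * exp (κ' * t₀)) / 2 := by ring
          _ = μ * c / 2 * Y := by rw [hMV]; ring
      have h4 : δ * Y ≤ μ * c / 2 * Y := mul_le_mul_of_nonneg_right (min_le_left _ _) hYpos.le
      rw [mul_sub, hMV, ht₀, h2]
      rw [h2] at h3
      linarith
    · have h3 : C * exp (-ℓ * p) * exp (-δ * Y + A) / A ≤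
          (C * exp A / A + C * exp ℓ) * exp (-(ℓ / 4) * p) * exp (-δ * Y) := by
        calc C * exp (-ℓ * p) * exp (-δ * Y + A) / A
            ≤ C * exp (-(ℓ / 4) * p) * exp (-δ * Y + A) / A := by gcongr
          _ = C * exp A / A * exp (-(ℓ / 4) * p) * exp (-δ * Y) := by rw [exp_add]; ring
          _ ≤ _ := by
            gcongr
            have : 0 ≤ C * exp ℓ := by positivity
            linarith
      have h4 := mul_le_mul_of_nonneg_left h3 (by positivity : 0 ≤ 2 * b)
      linarith
  · have hat : t₀ + 1 ≤ a := by
      have : t₀ - A ≤ log (1 + p) / κ₂ := by rw [le_div_iff₀ hκ₂pos]; linarith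
      linarith
    refine (norm_rectIntegral_kernel_sub_right_le (G := C * exp (-ℓ * p)) (B := 1)
      (V := c * exp (κ' * t₀)) (F := ℓ / 2 * (1 + p)) hax hb hd hζd hMpos.le (by positivity)
      hV hg ?_ one_pos ?_).trans ?_
    · intro y _
      refine le_trans ?_ (Complex.abs_re_le_norm _)
      refine le_trans ?_ (le_abs_self _)
      simp only [Complex.sub_re, Complex.add_re, Complex.ofReal_re, Complex.mul_re, Complex.I_re,
        mul_zero, Complex.ofReal_im, Complex.I_im, mul_one, sub_self, add_zero, ht₀]
      linarith
    · have h3 : M * exp (κ' * a) ≤ ℓ / 2 * (1 + p) := by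
        have h4 : (κ₂ - κ') * t₀ + κ' * a ≤
            ((κ₂ - κ') * A + κ' * (A + 1)) + log (1 + p) := by
          have h5 : (κ₂ - κ') * (t₀ - A) ≤ (κ₂ - κ') * (log (1 + p) / κ₂) := by
            refine mul_le_mul_of_nonneg_left ?_ (by linarith)
            rw [le_div_iff₀ hκ₂pos]; linarith
          have h6 : κ₂ * (log (1 + p) / κ₂) = log (1 + p) := mul_div_cancel₀ _ hκ₂pos.ne'
          rw [h2]
          linarith
        calc M * exp (κ' * a) = μ * exp ((κ₂ - κ') * t₀ + κ' * a) := by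
              rw [hMdef, exp_add]; ring
          _ ≤ μ * exp (((κ₂ - κ') * A + κ' * (A + 1)) + log (1 + p)) := by gcongr
          _ = μ * exp ((κ₂ - κ') * A + κ' * (A + 1)) * (1 + p) := by
              rw [exp_add _ (log _), exp_log (by positivity)]; ring
          _ ≤ ℓ / 2 * (1 + p) := by gcongr
      rw [mul_sub, hMV, ht₀]
      have : 0 ≤ μ * c * Y := by positivity
      linarith
    · have hpY : exp (-(κ₂ * A)) * Y ≤ 1 + p := by
        rw [hY, ← exp_add, ← exp_log (by positivity : (0 : ℝ) < 1 + p)]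
        apply exp_le_exp.2
        linarith
      -- Of the remaining decay e^{-ℓp/2}, one half is kept for the summation over p. The other half
      -- becomes e^{-δY}, because 1 + p dominates a multiple of Y.
      have h3 : exp (-ℓ * p) * exp (ℓ / 2 * (1 + p)) ≤
          exp ℓ * exp (-(ℓ / 4) * p) * exp (-δ * Y) := by
        rw [← exp_add, ← exp_add, ← exp_add]
        apply exp_le_exp.2
        have h4 : δ * Y ≤ ℓ / 4 * exp (-(κ₂ * A)) * Y :=
          mul_le_mul_of_nonneg_right (min_le_right _ _) hYpos.le
        have h5 : ℓ / 4 * (exp (-(κ₂ * A)) * Y) ≤ ℓ / 4 * (1 + p) := by gcongr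
        linarith
      have h6 : C * exp (-ℓ * p) * exp (ℓ / 2 * (1 + p)) / 1 ≤
          (C * exp A / A + C * exp ℓ) * exp (-(ℓ / 4) * p) * exp (-δ * Y) := by
        calc C * exp (-ℓ * p) * exp (ℓ / 2 * (1 + p)) / 1
            = C * (exp (-ℓ * p) * exp (ℓ / 2 * (1 + p))) := by ring
          _ ≤ C * (exp ℓ * exp (-(ℓ / 4) * p) * exp (-δ * Y)) := by gcongr
          _ = C * exp ℓ * exp (-(ℓ / 4) * p) * exp (-δ * Y) := by ring
          _ ≤ _ := by
            gcongr
            have : 0 ≤ C * exp A / A := by positivity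
            linarith
      have h7 := mul_le_mul_of_nonneg_left h6 (by positivity : 0 ≤ 2 * b)
      linarith

end IsSummFamily

/-! ### From one level to the next -/

namespace IsSummFamily

open Real Set Filter Topology

variable {L : Finset ℝ} {θ ℓ C : ℝ} {φ : ℕ → ℂ → ℂ}

/-- Cauchy's formula for the first Q + 1 functions at once, with Q → ∞. Only the terms with log(1 +
p) < κ₂(t₀ - A) have ζ inside their rectangle, so exactly their values are recovered. All edges but
the common right one are summable over p with the factor exp(-δ e^{κ₂t₀}). -/
theorem norm_sum_le_of_isFlat (h : IsSummFamily L θ ℓ C φ) {η κ κ' κ₂ b d A c μ t₀ Cf δf : ℝ}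
    {ζ : ℂ} (hηθ : η < θ) (hgap : ∀ k ∈ L, k ≤ κ ∨ κ₂ ≤ k)
    (hκ' : 0 < κ') (hκκ : κ' < κ) (hκ₂ : κ < κ₂) (hb : κ' * b = π / 2) (hbη : κ * b = η)
    (hd : 0 < d) (hζd : |ζ.im| + d ≤ b) (hc : 0 < c) (hcos : c ≤ cos (κ' * ζ.im))
    (hA : 0 < A) (hcA : exp (-(κ' * A)) ≤ c / 2) (hμ : 0 < μ)
    (hμA : μ * exp ((κ₂ - κ') * A + κ' * (A + 1)) ≤ ℓ / 2)
    (ht₀ : ζ.re = t₀) (hAt : A < t₀)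
    (hCf : 0 ≤ Cf) (hδf : 0 < δf)
    (hflat : ∀ ζ : ℂ, 0 < ζ.re → κ * |ζ.im| ≤ η → ∀ n : ℕ, (∀ p < n, ζ ∈ summDomain L θ p) →
      ‖∑ p ∈ Finset.range n, φ p ζ‖ ≤ Cf * (exp (-δf * exp (κ * ζ.re)) + exp (-δf * n))) :
    2 * b * (A / (A ^ 2 + (2 * b) ^ 2)) *
        ‖∑ p ∈ Finset.range ⌈exp (κ₂ * (t₀ - A)) - 1⌉₊, φ p ζ‖ ≤
      (2 * (C / d * exp A) + 2 * b * (C * exp A / A + C * exp ℓ)) *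
        (∑' p : ℕ, exp (-(ℓ / 4) * p)) *
        exp (-(min (μ * c / 2) (ℓ / 4 * exp (-(κ₂ * A)))) * exp (κ₂ * t₀)) := by
  set M := μ * exp ((κ₂ - κ') * t₀) with hMdef
  set N := ⌈exp (κ₂ * (t₀ - A)) - 1⌉₊ with hN
  have hℓ := h.rate_pos
  have hC := h.const_nonneg
  have hκ₂pos : 0 < κ₂ := by linarith
  have hbpos : 0 < b := by
    have := abs_nonneg ζ.im
    linarith
  have hMpos : 0 < M := by positivity
  have hpN : ∀ p : ℕ, p < N ↔ log (1 + p) < κ₂ * (t₀ - A) := by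
    intro p
    rw [hN, Nat.lt_ceil, lt_sub_iff_add_lt, add_comm, log_lt_iff_lt_exp (by positivity)]
  -- The right edge is the left edge that belongs to p = Q, so that all functions with p ≤ Q are
  -- defined on it.
  let xs : ℝ → ℝ := fun s => s + (A + 1)
  let s : ℕ → ℝ := fun Q => log (1 + Q) / κ₂
  have hs : Tendsto s atTop atTop := by
    refine Tendsto.atTop_div_const hκ₂pos (tendsto_log_atTop.comp ?_)
    exact tendsto_atTop_add_const_left _ _ tendsto_natCast_atTop_atTop
  -- the bound of the right edge
  let ρ : ℝ → ℝ := fun s => 2 * b * (Cf * (exp (M * exp (κ' * xs s) - δf * exp (κ * xs s)) +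
    exp ((M * exp (κ' * (A + 1))) * exp (κ' * s) - δf * exp (κ₂ * s))))
  -- The kernel grows like exp(M e^{κ'x}). The two terms of the flatness bound decay with the rates
  -- κ and κ₂, both larger than κ'.
  have hρ : Tendsto ρ atTop (𝓝 0) := by
    have h1 : Tendsto (fun s => exp (M * exp (κ' * xs s) - δf * exp (κ * xs s))) atTop (𝓝 0) :=
      (tendsto_exp_mul_sub_exp_mul hκ' hκκ hδf).comp (tendsto_atTop_add_const_right _ _ tendsto_id)
    have h2 := tendsto_exp_mul_sub_exp_mul (c := M * exp (κ' * (A + 1))) hκ' (hκκ.trans hκ₂) hδf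
    have := ((h1.add h2).const_mul Cf).const_mul (2 * b)
    simpa [ρ] using this
  refine ge_of_tendsto (x := atTop) (f := fun Q : ℕ => ρ (s Q) + (2 * (C / d * exp A) +
    2 * b * (C * exp A / A + C * exp ℓ)) * (∑' p : ℕ, exp (-(ℓ / 4) * p)) *
        exp (-(min (μ * c / 2) (ℓ / 4 * exp (-(κ₂ * A)))) * exp (κ₂ * t₀))) ?_ ?_
  · simpa using (hρ.comp hs).add_const _
  have hev1 : ∀ᶠ Q : ℕ in atTop, t₀ - A ≤ s Q := hs.eventually_ge_atTop _
  filter_upwards [hev1, eventually_ge_atTop N] with Q hQ hQN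
  set x := xs (s Q) with hx
  have hxdef : x = log (1 + Q) / κ₂ + (A + 1) := rfl
  have hxt : t₀ + 1 ≤ x := by
    have : x = s Q + (A + 1) := rfl
    linarith
  have hlogmono : ∀ p ∈ Finset.range (Q + 1), log (1 + (p : ℝ)) ≤ log (1 + Q) := by
    intro p hp
    have : (p : ℝ) ≤ Q := by exact_mod_cast Nat.lt_succ_iff.1 (Finset.mem_range.1 hp)
    exact log_le_log (by positivity) (by linarith)
  -- For p < N the domain reaches to the left of ζ. For the others the rectangle is moved to the
  -- right of ζ, where the function is again defined.
  let a : ℕ → ℝ := fun p => if p < N then t₀ - A else log (1 + p) / κ₂ + (A + 1)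
  have ha : ∀ p : ℕ, (log (1 + p) < κ₂ * (t₀ - A) ∧ a p = t₀ - A) ∨
      (κ₂ * (t₀ - A) ≤ log (1 + p) ∧ a p = log (1 + p) / κ₂ + (A + 1)) := by
    intro p
    by_cases hp : p < N
    · exact Or.inl ⟨(hpN p).1 hp, if_pos hp⟩
    · exact Or.inr ⟨not_lt.1 fun h' => hp ((hpN p).2 h'), if_neg hp⟩
  have hax : ∀ p ∈ Finset.range (Q + 1), a p ≤ x := by
    intro p hp
    rcases ha p with ⟨-, h2⟩ | ⟨-, h2⟩
    · rw [h2]; linarith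
    · rw [h2, hxdef]
      have := div_le_div_of_nonneg_right (hlogmono p hp) hκ₂pos.le
      linarith
  have hapos : ∀ p, 0 < a p := by
    intro p
    rcases ha p with ⟨-, h2⟩ | ⟨-, h2⟩
    · rw [h2]; linarith
    · rw [h2]
      have : 0 ≤ log (1 + (p : ℝ)) := log_nonneg (by linarith [p.cast_nonneg (α := ℝ)])
      positivity
  have ha1 : ∀ p : ℕ, log (1 + p) < κ₂ * a p := by
    intro p
    rcases ha p with ⟨h1, h2⟩ | ⟨h1, h2⟩
    · rw [h2]; exact h1
    · rw [h2, mul_add, mul_div_cancel₀ _ hκ₂pos.ne']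
      have : 0 < κ₂ * (A + 1) := by positivity
      linarith
  have hdom : ∀ p, ∀ z : ℂ, a p ≤ z.re → z.im ∈ Icc (-b) b → z ∈ summDomain L θ p := by
    intro p z hz1 hz2
    refine mem_summDomain hηθ hgap ((hapos p).trans_le hz1) ?_ ?_
    · rw [← hbη]
      exact mul_le_mul_of_nonneg_left (abs_le.2 hz2) (by linarith)
    · exact (ha1 p).trans_le (mul_le_mul_of_nonneg_left hz1 hκ₂pos.le)
  set W := rectIntegral (fun z => 1 / (z - ζ)) (t₀ - A) x b with hW
  let J : ℕ → ℂ := fun p => rectIntegral (fun z => φ p z * expKernel κ' M ζ z / (z - ζ)) (a p) x b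
  let r : ℕ → ℝ → ℂ := fun p y => φ p (x + y * Complex.I) *
        expKernel κ' M ζ (x + y * Complex.I) / (x + y * Complex.I - ζ)
  let R : ℕ → ℂ := fun p => Complex.I * ∫ y : ℝ in (-b)..b, r p y
  have hJR : ∀ p ∈ Finset.range (Q + 1), ‖J p - R p‖ ≤
      (2 * (C / d * exp A) + 2 * b * (C * exp A / A + C * exp ℓ)) * exp (-(ℓ / 4) * p) *
        exp (-(min (μ * c / 2) (ℓ / 4 * exp (-(κ₂ * A)))) * exp (κ₂ * t₀)) := fun p hp =>
    h.rectIntegral_bound hηθ hgap hκ' hκκ hκ₂ hb hbη hd hζd hc hcos hA hcA hμ hμA ht₀ hAt p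
      (hax p hp) (ha p)
  -- The point ζ lies inside the rectangle exactly when p < N; otherwise the integrand is
  -- holomorphic there.
  have hJ : ∀ p ∈ Finset.range (Q + 1), J p = if p < N then φ p ζ * W else 0 := by
    intro p hp
    have hdiff : DifferentiableOn ℂ (fun z => φ p z * expKernel κ' M ζ z)
        {z | z.re ∈ Icc (a p) x ∧ z.im ∈ Icc (-b) b} :=
      ((h.differentiableOn p).mono fun z hz => hdom p z hz.1.1 hz.2).mul
        (differentiable_expKernel _ _ _).differentiableOn
    split_ifs with hpn
    · have hap : a p = t₀ - A := if_pos hpn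
      have h1 := rectIntegral_div_sub (a := a p) (x := x) (b := b) (ζ := ζ)
        (by rw [hap]; linarith) (by linarith) (by linarith) hdiff
      rw [expKernel_self, mul_one] at h1
      rw [hW, ← hap]
      exact h1
    · have hap : a p = log (1 + p) / κ₂ + (A + 1) := if_neg hpn
      have h2 : t₀ < a p := by
        have h3 : κ₂ * (t₀ - A) ≤ log (1 + p) := not_lt.1 fun h' => hpn ((hpN p).2 h')
        have : t₀ - A ≤ log (1 + p) / κ₂ := by rw [le_div_iff₀ hκ₂pos]; linarith
        linarith
      refine rectIntegral_eq_zero (hax p hp) hbpos.le (hdiff.div (by fun_prop) fun z hz h0 => ?_)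
      rw [sub_eq_zero] at h0
      rw [h0] at hz
      have := hz.1.1
      linarith
  have hsumJ : ∑ p ∈ Finset.range (Q + 1), J p = (∑ p ∈ Finset.range N, φ p ζ) * W := by
    rw [Finset.sum_congr rfl hJ, ← Finset.sum_filter, Finset.sum_mul]
    refine Finset.sum_congr ?_ fun _ _ => rfl
    ext p
    simp only [Finset.mem_filter, Finset.mem_range]
    constructor
    · exact fun h => h.2
    · exact fun h => ⟨by omega, h⟩
  have hdomx : ∀ p ∈ Finset.range (Q + 1), ∀ y ∈ Icc (-b) b,
      ((x : ℂ) + y * Complex.I) ∈ summDomain L θ p := by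
    intro p hp y hy
    exact hdom p _ (by simpa using hax p hp) (by simpa using hy)
  have hxne : ∀ y : ℝ, 1 ≤ ‖(x : ℂ) + y * Complex.I - ζ‖ := by
    intro y
    refine le_trans ?_ (Complex.abs_re_le_norm _)
    refine le_trans ?_ (le_abs_self _)
    simp only [Complex.sub_re, Complex.add_re, Complex.ofReal_re, Complex.mul_re, Complex.I_re,
      mul_zero, Complex.ofReal_im, Complex.I_im, mul_one, sub_self, add_zero, ht₀]
    linarith
  have hsumR : ‖∑ p ∈ Finset.range (Q + 1), R p‖ ≤ ρ (s Q) := by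
    have hint : ∀ p ∈ Finset.range (Q + 1),
        IntervalIntegrable (r p) MeasureTheory.volume (-b) b := by
      intro p hp
      refine ContinuousOn.intervalIntegrable ?_
      rw [uIcc_of_le (by linarith)]
      refine ContinuousOn.div (ContinuousOn.mul ?_ ?_) (by fun_prop) ?_
      · exact (h.differentiableOn p).continuousOn.comp (by fun_prop) fun y hy => hdomx p hp y hy
      · exact ((differentiable_expKernel κ' M ζ).continuous.comp (by fun_prop)).continuousOn
      · intro y _ h0
        have := hxne y
        rw [h0, norm_zero] at this
        linarith
    have h1 : ∑ p ∈ Finset.range (Q + 1), R p =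
        Complex.I * ∫ y : ℝ in (-b)..b, ∑ p ∈ Finset.range (Q + 1), r p y := by
      rw [intervalIntegral.integral_finsetSum hint, Finset.mul_sum]
    rw [h1, norm_mul, Complex.norm_I, one_mul]
    refine (intervalIntegral.norm_integral_le_of_norm_le_const
      (C := Cf * (exp (M * exp (κ' * xs (s Q)) - δf * exp (κ * xs (s Q))) +
        exp ((M * exp (κ' * (A + 1))) * exp (κ' * s Q) - δf * exp (κ₂ * s Q))))
      fun y hy => ?_).trans ?_
    · rw [uIoc_of_le (by linarith)] at hy
      have hy' : y ∈ Icc (-b) b := ⟨hy.1.le, hy.2⟩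
      have h2 : ∑ p ∈ Finset.range (Q + 1), r p y =
          (∑ p ∈ Finset.range (Q + 1), φ p (x + y * Complex.I)) *
            expKernel κ' M ζ (x + y * Complex.I) / (x + y * Complex.I - ζ) := by
        rw [Finset.sum_mul, Finset.sum_div]
      have h3 := hflat (x + y * Complex.I) (by simp; linarith)
        (by
          rw [← hbη]
          refine mul_le_mul_of_nonneg_left ?_ (by linarith)
          simpa using abs_le.2 hy') (Q + 1)
        (fun p hp => hdomx p (Finset.mem_range.2 hp) y hy')
      have h4 : ‖expKernel κ' M ζ (x + y * Complex.I)‖ ≤ exp (M * exp (κ' * x)) := by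
        rw [norm_expKernel]
        apply exp_le_exp.2
        simp only [Complex.add_re, Complex.ofReal_re, Complex.mul_re, Complex.I_re, mul_zero,
          Complex.ofReal_im, Complex.I_im, mul_one, sub_self, add_zero, Complex.add_im,
          Complex.mul_im, zero_add]
        have h5 : exp (κ' * x) * cos (κ' * y) ≤ exp (κ' * x) :=
          mul_le_of_le_one_right (exp_pos _).le (cos_le_one _)
        have h6 : 0 ≤ exp (κ' * ζ.re) * cos (κ' * ζ.im) :=
          mul_nonneg (exp_pos _).le (hc.le.trans hcos)
        have := mul_le_mul_of_nonneg_left (sub_le_sub h5 h6) hMpos.le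
        linarith
      simp only [Complex.add_re, Complex.ofReal_re, Complex.mul_re, Complex.I_re, mul_zero,
        Complex.ofReal_im, Complex.I_im, mul_one, sub_self, add_zero] at h3
      -- The partial sum has Q + 1 terms, and Q + 1 is exactly e^{κ₂s}.
      have h7 : exp (-δf * ((Q + 1 : ℕ) : ℝ)) = exp (-δf * exp (κ₂ * s Q)) := by
        congr 2
        simp only [s]
        rw [mul_div_cancel₀ _ hκ₂pos.ne', exp_log (by positivity)]
        push_cast; ring
      rw [h2, norm_div, norm_mul]
      calc ‖∑ p ∈ Finset.range (Q + 1), φ p (x + y * Complex.I)‖ *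
            ‖expKernel κ' M ζ (x + y * Complex.I)‖ / ‖(x : ℂ) + y * Complex.I - ζ‖
          ≤ ‖∑ p ∈ Finset.range (Q + 1), φ p (x + y * Complex.I)‖ *
            ‖expKernel κ' M ζ (x + y * Complex.I)‖ :=
            div_le_self (by positivity) (hxne y)
        _ ≤ (Cf * (exp (-δf * exp (κ * x)) + exp (-δf * ((Q + 1 : ℕ) : ℝ)))) *
            exp (M * exp (κ' * x)) := by gcongr
        _ = _ := by
          rw [h7, mul_assoc, add_mul, ← exp_add, ← exp_add]
          have h8 : M * exp (κ' * (A + 1)) * exp (κ' * s Q) = M * exp (κ' * x) := by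
            rw [mul_assoc, ← exp_add]; congr 2
            rw [hx]; simp only [xs]; ring
          rw [h8]
          congr 2
          · congr 1; ring
          · congr 1; ring
    · rw [abs_of_nonneg (by linarith)]
      apply le_of_eq
      simp only [ρ]; ring
  have hWle : 2 * b * (A / (A ^ 2 + (2 * b) ^ 2)) ≤ ‖W‖ := by
    have := le_norm_rectIntegral_inv (a := t₀ - A) (x := x) (b := b) (ζ := ζ) (by linarith)
      (by linarith) (by linarith)
    rwa [ht₀, sub_sub_cancel] at this
  calc 2 * b * (A / (A ^ 2 + (2 * b) ^ 2)) * ‖∑ p ∈ Finset.range N, φ p ζ‖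
      ≤ ‖W‖ * ‖∑ p ∈ Finset.range N, φ p ζ‖ := by gcongr
    _ = ‖∑ p ∈ Finset.range (Q + 1), R p + ∑ p ∈ Finset.range (Q + 1), (J p - R p)‖ := by
        rw [← Finset.sum_add_distrib, mul_comm, ← norm_mul, ← hsumJ]
        congr 1
        exact Finset.sum_congr rfl fun p _ => by ring
    _ ≤ ρ (s Q) + ∑ p ∈ Finset.range (Q + 1), ‖J p - R p‖ :=
        (norm_add_le _ _).trans (add_le_add hsumR (norm_sum_le _ _))
    _ ≤ _ := by
        refine add_le_add le_rfl ((Finset.sum_le_sum hJR).trans ?_)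
        rw [← Finset.sum_mul, ← Finset.mul_sum]
        refine mul_le_mul_of_nonneg_right (mul_le_mul_of_nonneg_left
          (sum_exp_neg_mul_nat_le (by positivity) _) (by positivity)) (exp_pos _).le

end IsSummFamily

namespace IsSummFamily

open Real Set Filter Topology

variable {L : Finset ℝ} {θ ℓ C : ℝ} {φ : ℕ → ℂ → ℂ}

/-- Flatness passes from a level to the next one. -/
theorem isFlat_step (h : IsSummFamily L θ ℓ C φ) {η κ κ₂ : ℝ} (hη : π / 2 < η) (hηθ : η < θ)
    (hκ : 0 < κ) (hκ₂ : κ < κ₂) (hgap : ∀ k ∈ L, k ≤ κ ∨ κ₂ ≤ k) (hf : IsFlat L θ φ η κ) :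
    IsFlat L θ φ η κ₂ := by
  obtain ⟨Cf, δf, hCf, hδf, hflat⟩ := hf
  have hℓ := h.rate_pos
  have hC := h.const_nonneg
  have hη0 : 0 < η := lt_trans (by positivity) hη
  have hκ₂pos : 0 < κ₂ := hκ.trans hκ₂
  -- Since η > π/2, there is room for a rate κ' < κ whose cosine vanishes only on the boundary |Im
  -- z| = b = η/κ of the strip of level κ.
  set κ' := κ * (π / 2) / η with hκ'
  have hκ'pos : 0 < κ' := by positivity
  have hκκ : κ' < κ := by
    rw [hκ', div_lt_iff₀ hη0]
    exact mul_lt_mul_of_pos_left hη hκ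
  set b := η / κ with hb
  have hbpos : 0 < b := by positivity
  have hκ'b : κ' * b = π / 2 := by rw [hκ', hb]; field_simp
  have hbη : κ * b = η := by rw [hb]; field_simp
  set d := η / κ - η / κ₂ with hd
  have hdpos : 0 < d := sub_pos.2 (div_lt_div_of_pos_left hη0 hκ hκ₂)
  -- On the narrower strip of level κ₂ one has κ'|Im ζ| ≤ (π/2)(κ/κ₂), so c bounds the cosine at ζ
  -- from below; likewise d is the room left to the horizontal edges.
  set c := cos (π / 2 * (κ / κ₂)) with hc
  have hcpos : 0 < c := by
    have h1 : κ / κ₂ < 1 := by rwa [div_lt_one hκ₂pos]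
    have h2 : 0 < κ / κ₂ := by positivity
    apply cos_pos_of_mem_Ioo
    constructor <;> nlinarith [pi_pos]
  -- Chosen so that e^{-κ'A} = c/2: a left edge at distance A loses half of the gain at ζ.
  set A := -log (c / 2) / κ' with hA
  have hApos : 0 < A := by
    refine div_pos (neg_pos.2 (log_neg (by positivity) ?_)) hκ'pos
    have := cos_le_one (π / 2 * (κ / κ₂))
    linarith
  have hcA : exp (-(κ' * A)) ≤ c / 2 := by
    rw [hA, mul_div_cancel₀ _ hκ'pos.ne', neg_neg, exp_log (by positivity)]
  -- Chosen so that on the left edges to the right of ζ the kernel is at most e^{ℓ(1+p)/2}.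
  set μ := ℓ / 2 * exp (-((κ₂ - κ') * A + κ' * (A + 1))) with hμ
  have hμpos : 0 < μ := by positivity
  have hμA : μ * exp ((κ₂ - κ') * A + κ' * (A + 1)) ≤ ℓ / 2 := by
    rw [hμ, mul_assoc, ← exp_add, neg_add_cancel, exp_zero, mul_one]
  set δ₁ := min (μ * c / 2) (ℓ / 4 * exp (-(κ₂ * A))) with hδ₁
  have hδ₁pos : 0 < δ₁ := lt_min (by positivity) (by positivity)
  set w := 2 * b * (A / (A ^ 2 + (2 * b) ^ 2)) with hw
  have hwpos : 0 < w := by positivity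
  set D := (2 * (C / d * exp A) + 2 * b * (C * exp A / A + C * exp ℓ)) *
        (∑' p : ℕ, exp (-(ℓ / 4) * p)) with hD
  have hDpos : 0 ≤ D := mul_nonneg (by positivity) (tsum_nonneg fun p => (exp_pos _).le)
  set S := C * ∑' p : ℕ, exp (-ℓ * p) with hS
  have hSpos : 0 ≤ S := mul_nonneg hC (tsum_nonneg fun p => (exp_pos _).le)
  set δ := min δ₁ ℓ with hδ
  have hδpos : 0 < δ := lt_min hδ₁pos hℓ
  refine ⟨D / w + S * exp ℓ + S * exp (δ * exp (κ₂ * A)) + S, δ, by positivity, hδpos, ?_⟩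
  intro ζ hre him n hn
  set Y := exp (κ₂ * ζ.re) with hY
  have hYpos : 0 < Y := exp_pos _
  -- For bounded Re ζ the decay factor is bounded below, and the trivial bound by the geometric
  -- series suffices.
  rcases le_or_gt ζ.re A with htA | htA
  · have h1 := h.norm_sum_Ico_le (m := 0) hn
    simp only [Nat.cast_zero, mul_zero, exp_zero, mul_one] at h1
    rw [← Finset.range_eq_Ico] at h1
    have h2 : 1 ≤ exp (δ * exp (κ₂ * A)) * exp (-δ * Y) := by
      rw [← exp_add]
      apply one_le_exp
      have : Y ≤ exp (κ₂ * A) := exp_le_exp.2 (mul_le_mul_of_nonneg_left htA hκ₂pos.le)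
      have := mul_le_mul_of_nonneg_left this hδpos.le
      linarith
    calc ‖∑ p ∈ Finset.range n, φ p ζ‖ ≤ S * 1 := by rw [mul_one]; exact h1
      _ ≤ S * (exp (δ * exp (κ₂ * A)) * exp (-δ * Y)) := by gcongr
      _ = S * exp (δ * exp (κ₂ * A)) * (exp (-δ * Y) + 0) := by ring
      _ ≤ _ := by
        gcongr
        · have : 0 ≤ D / w + S * exp ℓ := by positivity
          linarith
        · positivity
  · set N := ⌈exp (κ₂ * (ζ.re - A)) - 1⌉₊ with hN
    have himd : |ζ.im| ≤ η / κ₂ := by rw [le_div_iff₀ hκ₂pos, mul_comm]; exact him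
    have hcos : c ≤ cos (κ' * ζ.im) := by
      rw [← cos_abs (κ' * ζ.im), abs_mul, abs_of_pos hκ'pos, hc]
      have h1 : κ' * |ζ.im| ≤ π / 2 * (κ / κ₂) := by
        calc κ' * |ζ.im| ≤ κ' * (η / κ₂) := by gcongr
          _ = _ := by rw [hκ']; field_simp
      refine cos_le_cos_of_nonneg_of_le_pi (by positivity) ?_ h1
      have h2 : κ / κ₂ ≤ 1 := by rw [div_le_one hκ₂pos]; exact hκ₂.le
      have h3 := mul_le_mul_of_nonneg_left h2 (by positivity : 0 ≤ π / 2)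
      linarith [pi_pos]
    have key := h.norm_sum_le_of_isFlat hηθ hgap hκ'pos hκκ hκ₂ hκ'b hbη hdpos
      (by rw [hd]; linarith) hcpos hcos hApos hcA hμpos hμA rfl htA hCf hδf hflat
    rw [← hD, ← hδ₁, ← hY, ← hN, ← hw, mul_comm w, ← le_div_iff₀ hwpos] at key
    have hζN : ∀ p < N, ζ ∈ summDomain L θ p := by
      intro p hp
      refine mem_summDomain hηθ (fun k hk => ?_) hre him
        (lt_trans (b := κ₂ * (ζ.re - A)) ?_ ?_) (κ₂ := κ₂)
      · exact (hgap k hk).imp (fun h => h.trans hκ₂.le) id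
      · rw [hN, Nat.lt_ceil, lt_sub_iff_add_lt, add_comm] at hp
        exact (log_lt_iff_lt_exp (by positivity)).2 hp
      · exact mul_lt_mul_of_pos_left (by linarith) hκ₂pos
    -- The Cauchy integral treats only the length N. Another length costs e^{-ℓN} + e^{-ℓn}, and N
    -- is comparable to e^{κ₂ Re ζ}.
    have hdiff := h.norm_sum_range_sub_le hζN hn
    rw [← hS] at hdiff
    have hNle : exp (-ℓ * N) ≤ exp ℓ * exp (-δ * Y) := by
      rw [← exp_add]
      apply exp_le_exp.2
      have h1 : exp (κ₂ * (ζ.re - A)) - 1 ≤ N := Nat.le_ceil _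
      have h2 : exp (κ₂ * (ζ.re - A)) = exp (-(κ₂ * A)) * Y := by
        rw [hY, ← exp_add]; congr 1; ring
      have h3 : δ ≤ ℓ * exp (-(κ₂ * A)) := by
        refine (min_le_left _ _).trans ((min_le_right _ _).trans ?_)
        have : 0 < ℓ * exp (-(κ₂ * A)) := by positivity
        linarith
      have h4 := mul_le_mul_of_nonneg_right h3 hYpos.le
      have h5 := mul_le_mul_of_nonneg_left h1 hℓ.le
      rw [h2] at h5
      linarith
    have hnle : exp (-ℓ * n) ≤ exp (-δ * n) := by
      apply exp_le_exp.2
      have := mul_le_mul_of_nonneg_right (min_le_right δ₁ ℓ) (n.cast_nonneg (α := ℝ))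
      linarith
    have hδY : exp (-δ₁ * Y) ≤ exp (-δ * Y) := by
      apply exp_le_exp.2
      have := mul_le_mul_of_nonneg_right (min_le_left δ₁ ℓ) hYpos.le
      linarith
    calc ‖∑ p ∈ Finset.range n, φ p ζ‖
        ≤ ‖∑ p ∈ Finset.range N, φ p ζ‖ +
          ‖∑ p ∈ Finset.range n, φ p ζ - ∑ p ∈ Finset.range N, φ p ζ‖ := by
          refine (le_of_eq ?_).trans (norm_add_le _ _)
          congr 1; ring
      _ ≤ D * exp (-δ₁ * Y) / w + S * (exp (-ℓ * N) + exp (-ℓ * n)) := add_le_add key hdiff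
      _ ≤ D * exp (-δ * Y) / w + S * (exp ℓ * exp (-δ * Y) + exp (-δ * n)) := by gcongr
      _ ≤ _ := by
        have e1 : 0 ≤ D / w * exp (-δ * n) := by positivity
        have e2 : 0 ≤ S * exp ℓ * exp (-δ * n) := by positivity
        have e3 : 0 ≤ S * exp (δ * exp (κ₂ * A)) * (exp (-δ * Y) + exp (-δ * n)) := by positivity
        have e4 : 0 ≤ S * exp (-δ * Y) := by positivity
        have e5 : D * exp (-δ * Y) / w = D / w * exp (-δ * Y) := by ring
        rw [e5]
        linarith

/-- Flatness at a level below all others implies flatness at all levels. -/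
theorem isFlat_of_isFlat_of_le (h : IsSummFamily L θ ℓ C φ) {η κ : ℝ} (hη : π / 2 < η)
    (hηθ : η < θ) (hκ : 0 < κ) (hκL : ∀ k ∈ L, κ ≤ k) (hf : IsFlat L θ φ η κ) :
    ∀ k ∈ L, IsFlat L θ φ η k := by
  intro k
  -- Induction on the number of levels below k. The starting level κ need not belong to L, so the
  -- lowest level is reached from κ itself.
  induction hcard : (L.filter (· < k)).card using Nat.strong_induction_on generalizing k with
  | _ n ih =>
    intro hk
    rcases (L.filter (· < k)).eq_empty_or_nonempty with h0 | h0
    · rcases (hκL k hk).eq_or_lt with h1 | h1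
      · rwa [← h1]
      · refine h.isFlat_step hη hηθ hκ h1 (fun j hj => Or.inr ?_) hf
        by_contra hjk
        exact Finset.notMem_empty j (h0 ▸ Finset.mem_filter.2 ⟨hj, not_le.1 hjk⟩)
    · obtain ⟨j, hj, hmax⟩ := Finset.exists_max_image _ id h0
      obtain ⟨hjL, hjk⟩ := Finset.mem_filter.1 hj
      refine h.isFlat_step hη hηθ (h.level_pos j hjL) hjk (fun i hi => ?_)
        (ih _ ?_ j rfl hjL)
      · rcases lt_or_ge i k with hik | hik
        · exact Or.inl (hmax i (Finset.mem_filter.2 ⟨hi, hik⟩))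
        · exact Or.inr hik
      · rw [← hcard]
        refine Finset.card_lt_card (Finset.ssubset_iff_of_subset ?_ |>.2 ⟨j, hj, by simp⟩)
        intro i hi
        rw [Finset.mem_filter] at hi ⊢
        exact ⟨hi.1, hi.2.trans hjk⟩

/-! ### Watson's lemma -/

/-- Watson's lemma for families of several levels. -/
theorem tsum_eq_zero (h : IsSummFamily L θ ℓ C φ) (hL : L.Nonempty) {η κ : ℝ} (hη : π / 2 < η)
    (hηθ : η < θ) (hκ : 0 < κ) (hκL : ∀ k ∈ L, κ ≤ k) (hf : IsFlat L θ φ η κ) {t : ℝ}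
    (ht : 0 < t) : ∑' p, φ p t = 0 := by
  have hη0 : 0 < η := lt_trans (by positivity) hη
  set k := L.max' hL with hkdef
  have hkL : k ∈ L := L.max'_mem hL
  have hkpos := h.level_pos k hkL
  obtain ⟨Cf, δ, hCf, hδ, hflat⟩ := h.isFlat_of_isFlat_of_le hη hηθ hκ hκL hf k hkL
  set U : Set ℂ := {ζ | 0 < ζ.re ∧ k * |ζ.im| < θ} with hU
  have hUo : IsOpen U := (isOpen_lt continuous_const Complex.continuous_re).inter
    (isOpen_lt (continuous_const.mul Complex.continuous_im.abs) continuous_const)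
  have hUdom : ∀ p, U ⊆ summDomain L θ p := by
    intro p ζ hζ
    refine ⟨hζ.1, fun j hj => Or.inl (lt_of_le_of_lt ?_ hζ.2)⟩
    exact mul_le_mul_of_nonneg_right (L.le_max' j hj) (abs_nonneg _)
  have hsumm : Summable fun p : ℕ => C * exp (-ℓ * p) :=
    (summable_exp_neg_mul_nat h.rate_pos).mul_left C
  have hdiff : DifferentiableOn ℂ (fun ζ => ∑' p, φ p ζ) U :=
    Complex.differentiableOn_tsum_of_summable_norm hsumm
      (fun p => (h.differentiableOn p).mono (hUdom p)) hUo
      fun p ζ hζ => h.norm_le p ζ (hUdom p hζ)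
  have hbound : ∀ ζ : ℂ, 0 < ζ.re → k * |ζ.im| ≤ η →
      ‖∑' p, φ p ζ‖ ≤ Cf * exp (-δ * exp (k * ζ.re)) := by
    intro ζ h1 h2
    have hζ : ζ ∈ U := ⟨h1, h2.trans_lt hηθ⟩
    have hs : Summable fun p => φ p ζ :=
      Summable.of_norm_bounded hsumm fun p => h.norm_le p ζ (hUdom p hζ)
    have hlim := hs.hasSum.tendsto_sum_nat.norm
    have hlim2 : Tendsto (fun n : ℕ => Cf * (exp (-δ * exp (k * ζ.re)) + exp (-δ * n))) atTop
        (𝓝 (Cf * (exp (-δ * exp (k * ζ.re)) + 0))) := by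
      refine Tendsto.const_mul _ (Tendsto.const_add _ ?_)
      exact (summable_exp_neg_mul_nat hδ).tendsto_atTop_zero
    rw [add_zero] at hlim2
    exact le_of_tendsto_of_tendsto' hlim hlim2 fun n => hflat ζ h1 h2 n fun p _ => hUdom p hζ
  -- The map z ↦ log(z + a)/κ' sends the right half-plane into the strip k|Im ζ| ≤ η, and e^{k Re ζ}
  -- becomes |z + a|^{k/κ'} with k/κ' = 2η/π > 1.
  set κ' := k * (π / 2) / η with hκ'
  have hκ'pos : 0 < κ' := by positivity
  have hκκ : κ' < k := by
    rw [hκ', div_lt_iff₀ hη0]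
    exact mul_lt_mul_of_pos_left hη hkpos
  set v := exp (κ' * t) with hv
  have hv1 : 1 < v := one_lt_exp_iff.2 (by positivity)
  -- Any a with 1 < a ≤ v would do: a > 1 keeps the image in Re ζ > 0, and a ≤ v puts the preimage v
  -- - a of t in the closed half-plane.
  set a := (1 + v) / 2 with ha
  have ha1 : 1 < a := by linarith
  let G : ℂ → ℂ := fun z => Complex.log (z + a) / κ'
  have hGre : ∀ z : ℂ, (G z).re = log ‖z + a‖ / κ' := by
    intro z; simp only [G, Complex.div_ofReal_re, Complex.log_re]
  have hG : ∀ z : ℂ, 0 ≤ z.re → 0 < (G z).re ∧ k * |(G z).im| ≤ η := by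
    intro z hz
    have h1 : a ≤ ‖z + a‖ := by
      refine le_trans ?_ (Complex.re_le_norm _)
      simpa using hz
    refine ⟨?_, ?_⟩
    · rw [hGre]
      exact div_pos (log_pos (by linarith)) hκ'pos
    · have h2 : |(Complex.log (z + a)).im| ≤ π / 2 := by
        rw [Complex.log_im, Complex.abs_arg_le_pi_div_two_iff]
        simp; linarith
      have h3 : (G z).im = (Complex.log (z + a)).im / κ' := by
        simp only [G, Complex.div_ofReal_im]
      rw [h3, abs_div, abs_of_pos hκ'pos]
      calc k * (|(Complex.log (z + a)).im| / κ') ≤ k * (π / 2 / κ') := by gcongr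
        _ = η := by rw [hκ']; field_simp
  have hGU : ∀ z : ℂ, 0 ≤ z.re → G z ∈ U := fun z hz => ⟨(hG z hz).1, (hG z hz).2.trans_lt hηθ⟩
  let F : ℂ → ℂ := fun z => ∑' p, φ p (G z)
  have hFb : ∀ z : ℂ, 0 ≤ z.re → ‖F z‖ ≤ Cf * exp (-δ * exp (k * (G z).re)) := fun z hz =>
    hbound _ (hG z hz).1 (hG z hz).2
  have hFb' : ∀ z : ℂ, 0 ≤ z.re → ‖F z‖ ≤ Cf := by
    intro z hz
    refine (hFb z hz).trans (mul_le_of_le_one_right hCf (exp_le_one_iff.2 ?_))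
    have := mul_pos hδ (exp_pos (k * (G z).re))
    linarith
  have hd : DiffContOnCl ℂ F {z | 0 < z.re} := by
    refine DifferentiableOn.diffContOnCl ?_
    rw [Complex.closure_setOfPred_lt_re]
    refine hdiff.comp ?_ fun z hz => hGU z hz
    refine DifferentiableOn.div_const (DifferentiableOn.clog (by fun_prop) fun z hz => ?_) _
    left
    have : 0 ≤ z.re := hz
    simp; linarith
  have hre : Asymptotics.SuperpolynomialDecay atTop exp fun x : ℝ => ‖F x‖ := by
    intro n
    have h1 : Tendsto (fun x : ℝ => Cf * exp (n * exp (1 * log (x + a)) -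
        δ * exp (k / κ' * log (x + a)))) atTop (𝓝 0) := by
      have h2 := (tendsto_exp_mul_sub_exp_mul (c := n) one_pos
        ((one_lt_div hκ'pos).2 hκκ) hδ).comp
        (tendsto_log_atTop.comp (tendsto_atTop_add_const_right atTop a tendsto_id))
      simpa using h2.const_mul Cf
    refine squeeze_zero' (Eventually.of_forall fun x => by positivity) ?_ h1
    filter_upwards [eventually_ge_atTop 0] with x hx
    have h3 := hFb x (by simpa using hx)
    have hxa : 0 < x + a := by linarith
    have h4 : (G x).re = log (x + a) / κ' := by
      rw [hGre, ← Complex.ofReal_add, Complex.norm_real, norm_of_nonneg hxa.le]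
    rw [h4] at h3
    calc exp x ^ n * ‖F x‖
        ≤ exp (n * (x + a)) * (Cf * exp (-δ * exp (k * (log (x + a) / κ')))) := by
          refine mul_le_mul ?_ h3 (norm_nonneg _) (exp_pos _).le
          rw [← exp_nat_mul]
          apply exp_le_exp.2
          exact mul_le_mul_of_nonneg_left (by linarith) (n.cast_nonneg)
      _ = _ := by
          rw [one_mul, exp_log hxa, sub_eq_add_neg, exp_add]
          have : k * (log (x + a) / κ') = k / κ' * log (x + a) := by ring
          rw [this, ← neg_mul]; ring
  have hzero := PhragmenLindelof.eq_zero_on_right_half_plane_of_superexponential_decay hd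
    ⟨1, by norm_num, 0, Asymptotics.IsBigO.of_bound Cf ?_⟩ hre
    ⟨Cf, fun x => hFb' _ (by simp)⟩
  · have h1 : F ((v - a : ℝ) : ℂ) = 0 := hzero (by
      change 0 ≤ ((v - a : ℝ) : ℂ).re
      rw [Complex.ofReal_re]; linarith)
    have h2 : G ((v - a : ℝ) : ℂ) = t := by
      simp only [G]
      rw [← Complex.ofReal_add, sub_add_cancel, ← Complex.ofReal_log (exp_pos _).le, log_exp,
        ← Complex.ofReal_div, mul_div_cancel_left₀ _ hκ'pos.ne']
    simpa only [F, h2] using h1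
  · rw [eventually_inf_principal]
    refine Eventually.of_forall fun z hz => ?_
    simpa using hFb' z (le_of_lt hz)

end IsSummFamily

/-! ### Grouping the terms of a product of two series -/

section Sums

open Finset

/-- Reduces a fibre to its finitely many relevant elements; serves both for pairs of indices with
given maximum and for pairs of exponents with given sum. -/
theorem tsum_fiber_eq_sum {α β γ : Type*} [AddCommMonoid α] [TopologicalSpace α] [T2Space α]
    {f : β → α} {g : β → γ} {c : γ} {s : Finset β} (hs : ∀ x ∈ s, g x = c)
    (h0 : ∀ x, g x = c → x ∉ s → f x = 0) : ∑' x : g ⁻¹' {c}, f x = ∑ x ∈ s, f x := by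
  rw [_root_.tsum_subtype, tsum_eq_sum (s := s)]
  · exact Finset.sum_congr rfl fun x hx => Set.indicator_of_mem (show x ∈ g ⁻¹' {c} from hs x hx) _
  · intro x hx
    by_cases hg : g x = c
    · rw [Set.indicator_of_mem (show x ∈ g ⁻¹' {c} from hg), h0 x hg hx]
    · exact Set.indicator_of_notMem (show x ∉ g ⁻¹' {c} from hg) _

/-- Summability in ℂ is absolute, so the double family is summable and may be grouped along any map.
-/
theorem hasSum_tsum_fiber_mul {ι κ γ : Type*} {a : ι → ℂ} {b : κ → ℂ} {A B : ℂ} (ha : HasSum a A)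
    (hb : HasSum b B) (g : ι × κ → γ) :
    HasSum (fun c => ∑' x : g ⁻¹' {c}, a x.1.1 * b x.1.2) (A * B) :=
  (ha.mul hb (summable_mul_of_summable_norm ha.summable.norm hb.summable.norm)).tsum_fiberwise g

/-- The pairs of natural numbers with maximum `n`. -/
def maxPairs (n : ℕ) : Finset (ℕ × ℕ) :=
  (range (n + 1) ×ˢ range (n + 1)).filter fun x => max x.1 x.2 = n

theorem mem_maxPairs {n : ℕ} {x : ℕ × ℕ} : x ∈ maxPairs n ↔ max x.1 x.2 = n := by
  simp only [maxPairs, mem_filter, mem_product, mem_range]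
  omega

theorem fst_le_of_mem_maxPairs {n : ℕ} {x : ℕ × ℕ} (h : x ∈ maxPairs n) : x.1 ≤ n := by
  rw [mem_maxPairs] at h; omega

theorem snd_le_of_mem_maxPairs {n : ℕ} {x : ℕ × ℕ} (h : x ∈ maxPairs n) : x.2 ≤ n := by
  rw [mem_maxPairs] at h; omega

theorem ENNReal.tsum_sum_maxPairs (a b : ℕ → ℝ≥0∞) :
    ∑' n, ∑ x ∈ maxPairs n, a x.1 * b x.2 = (∑' p, a p) * ∑' q, b q := by
  rw [← ENNReal.tsum_mul_right]
  simp_rw [← ENNReal.tsum_mul_left]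
  rw [← ENNReal.tsum_prod, ← ENNReal.tsum_fiberwise _ fun x : ℕ × ℕ => max x.1 x.2]
  refine tsum_congr fun n => ?_
  exact (tsum_fiber_eq_sum (fun x hx => mem_maxPairs.1 hx)
    fun x hx hx' => absurd (mem_maxPairs.2 hx) hx').symm

theorem hasSum_sum_maxPairs {a b : ℕ → ℂ} {A B : ℂ} (ha : HasSum a A) (hb : HasSum b B) :
    HasSum (fun n => ∑ x ∈ maxPairs n, a x.1 * b x.2) (A * B) := by
  have h := hasSum_tsum_fiber_mul ha hb fun x : ℕ × ℕ => max x.1 x.2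
  refine h.congr_fun fun n => ?_
  exact (tsum_fiber_eq_sum (fun x hx => mem_maxPairs.1 hx)
    fun x hx hx' => absurd (mem_maxPairs.2 hx) hx').symm

end Sums

/-! ### Log-sums and norms of generalized power series -/

theorem LogPlane.expMul_zero (w : LogPlane) : w.expMul 0 = 1 := by
  cases w <;> simp [LogPlane.expMul]

theorem LogPlane.expMul_add (α β : ℝ≥0) (w : LogPlane) :
    w.expMul (α + β) = w.expMul α * w.expMul β := by
  cases w with
  | negInf =>
    simp only [LogPlane.expMul, add_eq_zero]
    by_cases h1 : α = 0 <;> by_cases h2 : β = 0 <;> simp [h1, h2]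
  | ofComplex z =>
    simp only [LogPlane.expMul]
    rw [← Complex.exp_add]
    congr 1
    push_cast; ring

namespace GenPowerSeries

variable {m : ℕ} {F G : GenPowerSeries m}

/-- With one antidiagonal in s for all series, the finite sum can be exchanged with a sum over p;
the antidiagonals of the supports vary with p. -/
theorem coeff_mul_of_support_subset {s : Set (Fin m → ℝ≥0)} (hs : s.IsPWO)
    (hF : F.support ⊆ s) (hG : G.support ⊆ s) (α : Fin m → ℝ≥0) :
    (F * G).coeff α =
      ∑ x ∈ Finset.antidiagonal hs hs α, F.coeff x.1 * G.coeff x.2 := by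
  rw [HahnSeries.coeff_mul]
  refine Finset.sum_subset (fun x hx => ?_) fun x hx hx' => ?_
  · rw [Finset.mem_antidiagonal] at hx ⊢
    exact ⟨hF hx.1, hG hx.2.1, hx.2.2⟩
  · rw [Finset.mem_antidiagonal] at hx hx'
    by_contra h
    exact hx' ⟨left_ne_zero_of_mul h, right_ne_zero_of_mul h, hx.2.2⟩

end GenPowerSeries

namespace GenPowerSeries

variable {m : ℕ} {F G : GenPowerSeries m}

/-- Stated for general h because it is applied to complex terms for log-sums and to terms in [0, ∞]
for norms. -/
theorem tsum_antidiagonal {R : Type*} [AddCommMonoid R] [TopologicalSpace R] [T2Space R]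
    {h : (Fin m → ℝ≥0) × (Fin m → ℝ≥0) → R}
    (h0 : ∀ x, (F.coeff x.1 = 0 ∨ G.coeff x.2 = 0) → h x = 0) (α : Fin m → ℝ≥0) :
    ∑' x : (fun x : (Fin m → ℝ≥0) × (Fin m → ℝ≥0) => x.1 + x.2) ⁻¹' {α}, h x =
      ∑ x ∈ Finset.antidiagonal F.isPWO_support G.isPWO_support α, h x := by
  refine tsum_fiber_eq_sum (fun x hx => (Finset.mem_antidiagonal.1 hx).2.2) fun x hx hx' => ?_
  refine h0 x ?_
  by_contra hne
  rw [not_or] at hne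
  exact hx' (Finset.mem_antidiagonal.2 ⟨hne.1, hne.2, hx⟩)

theorem HasLogSum.add {w : Fin m → LogPlane} {c d : ℂ} (hF : F.HasLogSum w c)
    (hG : G.HasLogSum w d) : (F + G).HasLogSum w (c + d) := by
  refine (HasSum.add hF hG).congr_fun fun α => ?_
  rw [HahnSeries.coeff_add, add_mul]

theorem HasLogSum.smul {w : Fin m → LogPlane} {c : ℂ} (hF : F.HasLogSum w c) (a : ℂ) :
    (a • F).HasLogSum w (a * c) := by
  refine (HasSum.mul_left a hF).congr_fun fun α => ?_
  rw [HahnSeries.coeff_smul, smul_eq_mul, mul_assoc]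

theorem hasLogSum_zero (w : Fin m → LogPlane) : (0 : GenPowerSeries m).HasLogSum w 0 := by
  simp [HasLogSum, hasSum_zero]

theorem HasLogSum.sum {ι : Type*} {s : Finset ι} {F : ι → GenPowerSeries m} {w : Fin m → LogPlane}
    {c : ι → ℂ} (h : ∀ i ∈ s, (F i).HasLogSum w (c i)) :
    (∑ i ∈ s, F i).HasLogSum w (∑ i ∈ s, c i) := by
  classical
  induction s using Finset.induction_on with
  | empty => simpa using hasLogSum_zero w
  | insert i s hi ih =>
    rw [Finset.sum_insert hi, Finset.sum_insert hi]
    exact (h i (Finset.mem_insert_self i s)).add (ih fun j hj => h j (Finset.mem_insert_of_mem hj))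

theorem hasLogSum_one (w : Fin m → LogPlane) : (1 : GenPowerSeries m).HasLogSum w 1 := by
  unfold HasLogSum
  convert hasSum_ite_eq (0 : Fin m → ℝ≥0) (1 : ℂ) using 2 with α
  rw [HahnSeries.coeff_one]
  split_ifs with h
  · simp [h, LogPlane.expMul_zero]
  · simp

theorem HasLogSum.mul {w : Fin m → LogPlane} {c d : ℂ} (hF : F.HasLogSum w c)
    (hG : G.HasLogSum w d) : (F * G).HasLogSum w (c * d) := by
  refine (hasSum_tsum_fiber_mul hF hG
    fun x : (Fin m → ℝ≥0) × (Fin m → ℝ≥0) => x.1 + x.2).congr_fun fun α => ?_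
  rw [tsum_antidiagonal (F := F) (G := G) (h := fun x => (F.coeff x.1 *
    ∏ i, (w i).expMul (x.1 i)) * (G.coeff x.2 * ∏ i, (w i).expMul (x.2 i))),
    HahnSeries.coeff_mul, Finset.sum_mul]
  · refine Finset.sum_congr rfl fun x hx => ?_
    rw [← (Finset.mem_antidiagonal.1 hx).2.2]
    simp only [Pi.add_apply, LogPlane.expMul_add, Finset.prod_mul_distrib]
    ring
  · rintro x (hx | hx) <;> simp [hx]

theorem normAt_add_le (F G : GenPowerSeries m) (s : Fin m → ℝ) :
    (F + G).normAt s ≤ F.normAt s + G.normAt s := by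
  unfold normAt
  rw [← ENNReal.tsum_add]
  refine ENNReal.tsum_le_tsum fun α => ?_
  rw [← add_mul, HahnSeries.coeff_add]
  gcongr
  exact enorm_add_le _ _

theorem normAt_smul (a : ℂ) (F : GenPowerSeries m) (s : Fin m → ℝ) :
    (a • F).normAt s = ‖a‖ₑ * F.normAt s := by
  unfold normAt
  rw [← ENNReal.tsum_mul_left]
  refine tsum_congr fun α => ?_
  rw [HahnSeries.coeff_smul, smul_eq_mul, enorm_mul, mul_assoc]

theorem normAt_one (s : Fin m → ℝ) : (1 : GenPowerSeries m).normAt s ≤ 1 := by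
  unfold normAt
  rw [tsum_eq_single 0]
  · simp [HahnSeries.coeff_one]
  · intro α hα
    simp [HahnSeries.coeff_one, hα]

theorem normAt_mul_le (F G : GenPowerSeries m) {s : Fin m → ℝ} (hs : ∀ i, 0 < s i) :
    (F * G).normAt s ≤ F.normAt s * G.normAt s := by
  unfold normAt
  rw [← ENNReal.tsum_mul_right]
  simp_rw [← ENNReal.tsum_mul_left]
  rw [← ENNReal.tsum_prod, ← ENNReal.tsum_fiberwise _
    fun x : (Fin m → ℝ≥0) × (Fin m → ℝ≥0) => x.1 + x.2]
  refine ENNReal.tsum_le_tsum fun α => ?_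
  rw [tsum_antidiagonal (F := F) (G := G) (h := fun x =>
    ‖F.coeff x.1‖ₑ * ENNReal.ofReal (∏ i, s i ^ (x.1 i : ℝ)) *
      (‖G.coeff x.2‖ₑ * ENNReal.ofReal (∏ i, s i ^ (x.2 i : ℝ)))), HahnSeries.coeff_mul]
  · refine (mul_le_mul_left (enorm_sum_le _ _) _).trans ?_
    rw [Finset.sum_mul]
    refine Finset.sum_le_sum fun x hx => le_of_eq ?_
    have hprod : ∏ i, s i ^ (α i : ℝ) = (∏ i, s i ^ (x.1 i : ℝ)) * ∏ i, s i ^ (x.2 i : ℝ) := by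
      rw [← Finset.prod_mul_distrib, ← (Finset.mem_antidiagonal.1 hx).2.2]
      refine Finset.prod_congr rfl fun i _ => ?_
      rw [← Real.rpow_add (hs i)]
      simp
    rw [hprod, enorm_mul, ENNReal.ofReal_mul
      (Finset.prod_nonneg fun i _ => Real.rpow_nonneg (hs i).le _)]
    ring
  · rintro x (hx | hx) <;> simp [hx]

theorem normAt_le_normOn (F : GenPowerSeries m) {U : Set (Fin m → ℂ)} {s : Fin m → ℝ}
    (hs : ∀ i, 0 < s i) (hU : (fun i => (s i : ℂ)) ∈ closure U) : F.normAt s ≤ F.normOn U :=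
  le_iSup_of_le s (le_iSup_of_le hs (le_iSup_of_le hU le_rfl))

theorem normOn_le {F : GenPowerSeries m} {U : Set (Fin m → ℂ)} {C : ℝ≥0∞}
    (h : ∀ s : Fin m → ℝ, (∀ i, 0 < s i) → (fun i => (s i : ℂ)) ∈ closure U → F.normAt s ≤ C) :
    F.normOn U ≤ C :=
  iSup_le fun s => iSup_le fun hs => iSup_le fun hU => h s hs hU

theorem normOn_mono (F : GenPowerSeries m) {U V : Set (Fin m → ℂ)} (h : U ⊆ V) :
    F.normOn U ≤ F.normOn V :=
  normOn_le fun _ hs hU => F.normAt_le_normOn hs (closure_mono h hU)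

theorem normOn_add_le (F G : GenPowerSeries m) (U : Set (Fin m → ℂ)) :
    (F + G).normOn U ≤ F.normOn U + G.normOn U :=
  normOn_le fun _ hs hU => (normAt_add_le F G _).trans
    (add_le_add (F.normAt_le_normOn hs hU) (G.normAt_le_normOn hs hU))

theorem normOn_smul_le (a : ℂ) (F : GenPowerSeries m) (U : Set (Fin m → ℂ)) :
    (a • F).normOn U ≤ ‖a‖ₑ * F.normOn U :=
  normOn_le fun s hs hU => by
    rw [normAt_smul]
    gcongr
    exact F.normAt_le_normOn hs hU

theorem normOn_mul_le (F G : GenPowerSeries m) (U : Set (Fin m → ℂ)) :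
    (F * G).normOn U ≤ F.normOn U * G.normOn U :=
  normOn_le fun _ hs hU => (normAt_mul_le F G hs).trans
    (mul_le_mul' (F.normAt_le_normOn hs hU) (G.normAt_le_normOn hs hU))

theorem normOn_zero (U : Set (Fin m → ℂ)) : (0 : GenPowerSeries m).normOn U = 0 := by
  refine le_antisymm (normOn_le fun s _ _ => ?_) bot_le
  simp [normAt]

theorem normOn_one_le (U : Set (Fin m → ℂ)) : (1 : GenPowerSeries m).normOn U ≤ 1 :=
  normOn_le fun s _ _ => normAt_one s

theorem normOn_sum_le {ι : Type*} (s : Finset ι) (F : ι → GenPowerSeries m)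
    (U : Set (Fin m → ℂ)) : (∑ i ∈ s, F i).normOn U ≤ ∑ i ∈ s, (F i).normOn U := by
  classical
  induction s using Finset.induction_on with
  | empty => simp [normOn_zero]
  | insert i s hi ih =>
    rw [Finset.sum_insert hi, Finset.sum_insert hi]
    exact (normOn_add_le _ _ _).trans (by gcongr)

end GenPowerSeries

/-! ### Closure of `τ.G` under the algebra operations -/

namespace LogHolomorphicOn

variable {m : ℕ} {f g : (Fin m → LogPlane) → ℂ} {D E : Set (Fin m → LogPlane)}

theorem mono (hf : LogHolomorphicOn f D) (h : E ⊆ D) : LogHolomorphicOn f E :=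
  ⟨hf.1.mono h, hf.2.mono (Set.preimage_mono h)⟩

theorem add (hf : LogHolomorphicOn f D) (hg : LogHolomorphicOn g D) :
    LogHolomorphicOn (fun w => f w + g w) D :=
  ⟨hf.1.add hg.1, hf.2.add hg.2⟩

theorem mul (hf : LogHolomorphicOn f D) (hg : LogHolomorphicOn g D) :
    LogHolomorphicOn (fun w => f w * g w) D :=
  ⟨hf.1.mul hg.1, hf.2.mul hg.2⟩

theorem const_mul (hf : LogHolomorphicOn f D) (c : ℂ) : LogHolomorphicOn (fun w => c * f w) D :=
  ⟨continuousOn_const.mul hf.1, (differentiableOn_const c).mul hf.2⟩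

theorem const (c : ℂ) : LogHolomorphicOn (fun _ => c) D :=
  ⟨continuousOn_const, differentiableOn_const c⟩

theorem sum {ι : Type*} {s : Finset ι} {f : ι → (Fin m → LogPlane) → ℂ}
    (h : ∀ i ∈ s, LogHolomorphicOn (f i) D) : LogHolomorphicOn (fun w => ∑ i ∈ s, f i w) D :=
  ⟨continuousOn_finsetSum s fun i hi => (h i hi).1, DifferentiableOn.fun_sum fun i hi => (h i hi).2⟩

end LogHolomorphicOn

namespace SummParam

variable {m : ℕ} {τ : SummParam m}

/-- A strictly descending sequence of exponents would give infinitely many elements of some B_i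
below a fixed bound. -/
theorem isPWO_of_isNaturalSet {A : Set (Fin m → ℝ≥0)} (hA : IsNaturalSet A) : A.IsPWO := by
  obtain ⟨B, hB, hAB⟩ := hA
  refine (isPWO_iff_subset_prod A).2 ⟨fun i => {x | (x : ℝ) ∈ B i}, fun i => ?_,
    fun α hα i _ => hAB α hα i⟩
  rw [Set.isWF_iff_no_descending_seq]
  intro f hf hmem
  have hinj : Function.Injective fun n => (f n : ℝ) := NNReal.coe_injective.comp hf.injective
  refine Set.infinite_range_of_injective hinj ((hB i (f 0 + 1)).subset ?_)
  rintro _ ⟨n, rfl⟩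
  have h1 : (f n : ℝ) ≤ f 0 := NNReal.coe_le_coe.2 (hf.antitone n.zero_le)
  exact ⟨hmem n, show (f n : ℝ) < f 0 + 1 by linarith⟩

/-- Only finitely many elements of a natural set have bounded total degree. -/
theorem finite_sum_le_of_isNaturalSet {A : Set (Fin m → ℝ≥0)} (hA : IsNaturalSet A) (N : ℝ) :
    {α ∈ A | ∑ i, (α i : ℝ) ≤ N}.Finite := by
  obtain ⟨B, hB, hAB⟩ := hA
  have h : (Set.univ.pi fun i => (fun a : ℝ≥0 => (a : ℝ)) ⁻¹' (B i ∩ Set.Iio (N + 1))).Finite :=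
    Set.Finite.pi fun i => (hB i (N + 1)).preimage NNReal.coe_injective.injOn
  refine h.subset ?_
  rintro α ⟨h1, h2⟩ i -
  refine ⟨hAB α h1 i, ?_⟩
  have h3 : (α i : ℝ) ≤ ∑ i, (α i : ℝ) :=
    Finset.single_le_sum (f := fun i => (α i : ℝ)) (fun j _ => (α j).2) (Finset.mem_univ i)
  exact show (α i : ℝ) < N + 1 by linarith

theorem polydisk_anti {k : Fin m → ℝ≥0} {R : Fin m → ℝ} (hR : ∀ i, 0 < R i) {p q : ℕ}
    (h : p ≤ q) : polydisk k R q ⊆ polydisk k R p := by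
  rintro z ⟨h1, h2⟩
  refine ⟨h1, h2.imp_right fun h3 => h3.trans_le ?_⟩
  have h4 : (p : ℝ) ≤ q := by exact_mod_cast h
  exact div_le_div_of_nonneg_left (Finset.prod_nonneg fun i _ => Real.rpow_nonneg (hR i).le _)
    (by positivity) (by linarith)

theorem logPolydisk_anti {k : Fin m → ℝ≥0} {ρ : Fin m → ℝ} {p q : ℕ} (h : p ≤ q) :
    logPolydisk k ρ q ⊆ logPolydisk k ρ p := by
  rintro w ⟨h1, h2⟩
  refine ⟨h1, h2.imp_right fun h3 => h3.trans_le ?_⟩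
  have h4 : (p : ℝ) ≤ q := by exact_mod_cast h
  have h5 : Real.log (1 + p) ≤ Real.log (1 + q) := Real.log_le_log (by positivity) (by linarith)
  exact EReal.coe_le_coe_iff.2 (by linarith)

theorem Dp_anti {p q : ℕ} (h : p ≤ q) : τ.Dp q ⊆ τ.Dp p :=
  Set.iInter₂_mono fun _ _ => polydisk_anti τ.R_pos h

theorem Hp_anti {p q : ℕ} (h : p ≤ q) : τ.Hp q ⊆ τ.Hp p :=
  Set.iInter₂_mono fun _ _ => logPolydisk_anti h

theorem Sp_anti {p q : ℕ} (h : p ≤ q) : τ.Sp q ⊆ τ.Sp p :=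
  Set.iInter₂_mono fun _ _ => Set.union_subset_union_right _ (logPolydisk_anti h)

theorem S_subset_Sp (p : ℕ) : τ.S ⊆ τ.Sp p :=
  Set.iInter₂_mono fun _ _ => Set.subset_union_left

namespace IsSumOf

variable {f g : τ.S → ℂ} {fp gp : ℕ → (Fin m → LogPlane) → ℂ} {F G : ℕ → GenPowerSeries m}

theorem add (hf : τ.IsSumOf f fp F) (hg : τ.IsSumOf g gp G) :
    τ.IsSumOf (f + g) (fun p w => fp p w + gp p w) (fun p => F p + G p) where
  logHolomorphic p := (hf.logHolomorphic p).add (hg.logHolomorphic p)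
  support_subset p := (HahnSeries.support_add_subset _ _).trans
    (Set.union_subset (hf.support_subset p) (hg.support_subset p))
  hasLogSum p w hw := (hf.hasLogSum p w hw).add (hg.hasLogSum p w hw)
  summable_series := by
    refine lt_of_le_of_lt ?_ (ENNReal.add_lt_top.2 ⟨hf.summable_series, hg.summable_series⟩)
    rw [← ENNReal.tsum_add]
    refine ENNReal.tsum_le_tsum fun p => ?_
    rw [← add_mul]
    gcongr
    exact GenPowerSeries.normOn_add_le _ _ _
  summable_sup := by
    refine lt_of_le_of_lt ?_ (ENNReal.add_lt_top.2 ⟨hf.summable_sup, hg.summable_sup⟩)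
    rw [← ENNReal.tsum_add]
    refine ENNReal.tsum_le_tsum fun p => ?_
    rw [← add_mul]
    gcongr
    refine iSup₂_le fun w hw => (enorm_add_le _ _).trans (add_le_add ?_ ?_)
    · exact le_iSup₂_of_le w hw le_rfl
    · exact le_iSup₂_of_le w hw le_rfl
  hasSum w := (hf.hasSum w).add (hg.hasSum w)

theorem smul (hf : τ.IsSumOf f fp F) (c : ℂ) :
    τ.IsSumOf (c • f) (fun p w => c * fp p w) (fun p => c • F p) where
  logHolomorphic p := (hf.logHolomorphic p).const_mul c
  support_subset p := (Function.support_const_smul_subset c _).trans (hf.support_subset p)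
  hasLogSum p w hw := (hf.hasLogSum p w hw).smul c
  summable_series := by
    refine lt_of_le_of_lt ?_ (ENNReal.mul_lt_top (enorm_lt_top (x := c)) hf.summable_series)
    rw [← ENNReal.tsum_mul_left]
    refine ENNReal.tsum_le_tsum fun p => ?_
    rw [← mul_assoc]
    gcongr
    exact GenPowerSeries.normOn_smul_le _ _ _
  summable_sup := by
    refine lt_of_le_of_lt ?_ (ENNReal.mul_lt_top (enorm_lt_top (x := c)) hf.summable_sup)
    rw [← ENNReal.tsum_mul_left]
    refine ENNReal.tsum_le_tsum fun p => ?_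
    rw [← mul_assoc]
    gcongr
    refine iSup₂_le fun w hw => ?_
    rw [enorm_mul]
    gcongr
    exact le_iSup₂_of_le w hw le_rfl
  hasSum w := (hf.hasSum w).mul_left c

theorem sub (hf : τ.IsSumOf f fp F) (hg : τ.IsSumOf g gp G) :
    τ.IsSumOf (f - g) (fun p w => fp p w + -1 * gp p w) (fun p => F p + (-1 : ℂ) • G p) := by
  have h := hf.add (hg.smul (-1))
  rwa [neg_one_smul, ← sub_eq_add_neg] at h

/-- As r ≥ 1, the weight r^{max(p,q)} is at most r^p r^q, and the sum is dominated by the product of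
the two sums. -/
theorem tsum_maxPairs_lt_top {c : ℕ → ℝ≥0∞} {a b : ℕ → ℝ≥0∞} {r : ℝ≥0∞} (hr : 1 ≤ r)
    (ha : ∑' p, a p * r ^ p < ⊤) (hb : ∑' p, b p * r ^ p < ⊤)
    (hc : ∀ n, c n ≤ ∑ x ∈ maxPairs n, a x.1 * b x.2) : ∑' n, c n * r ^ n < ⊤ := by
  refine lt_of_le_of_lt ?_ (ENNReal.mul_lt_top ha hb)
  rw [← ENNReal.tsum_sum_maxPairs]
  refine ENNReal.tsum_le_tsum fun n => (mul_le_mul_left (hc n) _).trans ?_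
  rw [Finset.sum_mul]
  refine Finset.sum_le_sum fun x hx => ?_
  have h1 : r ^ n ≤ r ^ x.1 * r ^ x.2 := by
    rw [← pow_add]
    refine pow_le_pow_right₀ hr ?_
    rw [mem_maxPairs] at hx
    omega
  calc a x.1 * b x.2 * r ^ n ≤ a x.1 * b x.2 * (r ^ x.1 * r ^ x.2) := by gcongr
    _ = _ := by ring

/-- The domains shrink as the index grows, so f_p g_q lives on the domain of index max(p, q), which
is why the products are grouped by the maximum. -/
theorem mul (hf : τ.IsSumOf f fp F) (hg : τ.IsSumOf g gp G) :
    τ.IsSumOf (f * g) (fun n w => ∑ x ∈ maxPairs n, fp x.1 w * gp x.2 w)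
      (fun n => ∑ x ∈ maxPairs n, F x.1 * G x.2) where
  logHolomorphic n := LogHolomorphicOn.sum fun x hx =>
    ((hf.logHolomorphic _).mono (Sp_anti (fst_le_of_mem_maxPairs hx))).mul
      ((hg.logHolomorphic _).mono (Sp_anti (snd_le_of_mem_maxPairs hx)))
  support_subset n := by
    intro α hα
    by_contra h
    refine hα ?_
    rw [HahnSeries.coeff_sum]
    refine Finset.sum_eq_zero fun x _ => ?_
    by_contra h0
    obtain ⟨β, hβ, γ, hγ, rfl⟩ := HahnSeries.support_mul_subset h0
    exact h (τ.Δ_add _ (hf.support_subset _ hβ) _ (hg.support_subset _ hγ))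
  hasLogSum n w hw := GenPowerSeries.HasLogSum.sum fun x hx =>
    (hf.hasLogSum _ w (Hp_anti (fst_le_of_mem_maxPairs hx) hw)).mul
      (hg.hasLogSum _ w (Hp_anti (snd_le_of_mem_maxPairs hx) hw))
  summable_series := by
    refine tsum_maxPairs_lt_top (by simpa using τ.one_lt_r.le) hf.summable_series
      hg.summable_series fun n => (GenPowerSeries.normOn_sum_le _ _ _).trans
        (Finset.sum_le_sum fun x hx => (GenPowerSeries.normOn_mul_le _ _ _).trans ?_)
    exact mul_le_mul' (GenPowerSeries.normOn_mono _ (Dp_anti (fst_le_of_mem_maxPairs hx)))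
      (GenPowerSeries.normOn_mono _ (Dp_anti (snd_le_of_mem_maxPairs hx)))
  summable_sup := by
    refine tsum_maxPairs_lt_top (by simpa using τ.one_lt_r.le) hf.summable_sup hg.summable_sup
      fun n => iSup₂_le fun w hw => (enorm_sum_le _ _).trans (Finset.sum_le_sum fun x hx => ?_)
    rw [enorm_mul]
    exact mul_le_mul' (le_iSup₂_of_le w (Sp_anti (fst_le_of_mem_maxPairs hx) hw) le_rfl)
      (le_iSup₂_of_le w (Sp_anti (snd_le_of_mem_maxPairs hx) hw) le_rfl)
  hasSum w := by
    have h := hasSum_sum_maxPairs (hf.hasSum w) (hg.hasSum w)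
    exact h

theorem zero : τ.IsSumOf 0 (fun _ _ => 0) (fun _ => 0) where
  logHolomorphic p := LogHolomorphicOn.const 0
  support_subset p := by simp
  hasLogSum p w _ := GenPowerSeries.hasLogSum_zero w
  summable_series := by simp [GenPowerSeries.normOn_zero]
  summable_sup := by simp
  hasSum w := hasSum_zero

theorem one (h : 0 ∈ τ.Δ) : τ.IsSumOf 1 (fun p _ => if p = 0 then 1 else 0)
    (fun p => if p = 0 then 1 else 0) where
  logHolomorphic p := LogHolomorphicOn.const _
  support_subset p := by
    split_ifs
    · rw [HahnSeries.support_one]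
      simpa using h
    · simp
  hasLogSum p w _ := by
    split_ifs
    · exact GenPowerSeries.hasLogSum_one w
    · exact GenPowerSeries.hasLogSum_zero w
  summable_series := by
    rw [tsum_eq_single 0]
    · simpa using (GenPowerSeries.normOn_one_le (τ.Dp 0)).trans_lt ENNReal.one_lt_top
    · intro p hp
      simp [hp, GenPowerSeries.normOn_zero]
  summable_sup := by
    rw [tsum_eq_single 0]
    · refine lt_of_le_of_lt (b := 1) ?_ ENNReal.one_lt_top
      simp
    · intro p hp
      simp [hp]
  hasSum w := hasSum_ite_eq 0 1

end IsSumOf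

end SummParam

/-! ### Restriction to diagonal rays -/

theorem EReal.coe_finset_sum {ι : Type*} (s : Finset ι) (f : ι → ℝ) :
    ((∑ i ∈ s, f i : ℝ) : EReal) = ∑ i ∈ s, (f i : EReal) := by
  classical
  induction s using Finset.induction_on with
  | empty => simp
  | insert i s hi ih => rw [Finset.sum_insert hi, Finset.sum_insert hi, EReal.coe_add, ih]

theorem summable_and_tsum_le_of_tsum_ofReal_le {ι : Type*} {f : ι → ℝ} {c : ℝ} (hf : ∀ i, 0 ≤ f i)
    (hc : 0 ≤ c) (h : ∑' i, ENNReal.ofReal (f i) ≤ ENNReal.ofReal c) :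
    Summable f ∧ ∑' i, f i ≤ c := by
  have h1 : ∀ u : Finset ι, ∑ i ∈ u, f i ≤ c := by
    intro u
    rw [← ENNReal.ofReal_le_ofReal_iff hc, ENNReal.ofReal_sum_of_nonneg fun i _ => hf i]
    exact (ENNReal.sum_le_tsum u).trans h
  exact ⟨summable_of_sum_le hf h1, Real.tsum_le_of_sum_le hf h1⟩

/-- Geometric decay beats polynomial growth. -/
theorem exists_exp_mul_exp_log_le {ℓ ν : ℝ} (hℓ : 0 < ℓ) (hν : 0 ≤ ν) :
    ∃ C : ℝ, 0 ≤ C ∧ ∀ p : ℕ, Real.exp (-ℓ * p) * Real.exp (ν * Real.log (2 + p)) ≤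
      C * Real.exp (-(ℓ / 2) * p) := by
  -- The tangent of the logarithm at B has slope 1/B, and ν/B ≤ ℓ/2; the summand 1 keeps B positive
  -- when ν = 0.
  set B := 2 * (ν + 1) / ℓ with hB
  have hBpos : 0 < B := by positivity
  refine ⟨Real.exp (ℓ + ν * |Real.log B|), (Real.exp_pos _).le, fun p => ?_⟩
  rw [← Real.exp_add, ← Real.exp_add]
  apply Real.exp_le_exp.2
  have h1 : Real.log (2 + p) = Real.log ((2 + p) / B) + Real.log B := by
    rw [Real.log_div (by positivity) hBpos.ne', sub_add_cancel]
  have h2 : Real.log ((2 + p) / B) ≤ (2 + p) / B - 1 := Real.log_le_sub_one_of_pos (by positivity)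
  have h3 : ν * ((2 + p) / B) ≤ ℓ / 2 * (2 + p) := by
    have : ν / B ≤ ℓ / 2 := by
      rw [div_le_iff₀ hBpos, hB]
      field_simp
      linarith
    calc ν * ((2 + p) / B) = ν / B * (2 + p) := by ring
      _ ≤ _ := by gcongr
  have h4 : ν * Real.log (2 + p) ≤ ν * ((2 + p) / B - 1 + |Real.log B|) := by
    rw [h1]
    refine mul_le_mul_of_nonneg_left ?_ hν
    linarith [le_abs_self (Real.log B)]
  linarith

namespace SummParam

open Real

variable {m : ℕ} (τ : SummParam m)

/-- The levels of `τ` along the diagonal direction, together with `1`. -/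
noncomputable def levels : Finset ℝ := by
  classical
  -- The level 1 keeps the set nonempty when K = {0}. It is harmless, as a further level only
  -- shrinks `summDomain`.
  exact insert 1 ((τ.K.filter (· ≠ 0)).image fun k => ∑ i, (k i : ℝ))

theorem levels_nonempty : τ.levels.Nonempty := ⟨1, Finset.mem_insert_self _ _⟩

variable {τ}

theorem mem_levels {k : Fin m → ℝ≥0} (hk : k ∈ τ.K) (h0 : k ≠ 0) : ∑ i, (k i : ℝ) ∈ τ.levels := by
  classical
  exact Finset.mem_insert_of_mem (Finset.mem_image.2 ⟨k, Finset.mem_filter.2 ⟨hk, h0⟩, rfl⟩)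

theorem sum_pos_of_ne_zero {k : Fin m → ℝ≥0} (h0 : k ≠ 0) : 0 < ∑ i, (k i : ℝ) := by
  obtain ⟨i, hi⟩ := Function.ne_iff.1 h0
  refine Finset.sum_pos' (fun i _ => (k i).2) ⟨i, Finset.mem_univ i, ?_⟩
  exact NNReal.coe_pos.2 (pos_iff_ne_zero.2 hi)

theorem levels_pos {κ : ℝ} (h : κ ∈ τ.levels) : 0 < κ := by
  classical
  rcases Finset.mem_insert.1 h with rfl | h
  · exact one_pos
  · obtain ⟨k, hk, rfl⟩ := Finset.mem_image.1 h
    exact sum_pos_of_ne_zero (Finset.mem_filter.1 hk).2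

variable (τ) in
/-- The smallest level. -/
noncomputable def minLevel : ℝ := τ.levels.min' τ.levels_nonempty

theorem minLevel_pos : 0 < τ.minLevel := levels_pos (τ.levels.min'_mem _)

theorem minLevel_le {κ : ℝ} (h : κ ∈ τ.levels) : τ.minLevel ≤ κ := τ.levels.min'_le _ h

/-- The diagonal complex line through `x`. -/
noncomputable def ray (x : Fin m → ℝ) (ζ : ℂ) : Fin m → ℂ := fun i => x i - ζ

theorem ray_mem_logDisk {x : Fin m → ℝ} (hx : ∀ i, x i < τ.logR i) {ζ : ℂ} (hζ : 0 ≤ ζ.re) :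
    toLog (ray x ζ) ∈ logDisk τ.logR := by
  intro i
  simp only [toLog, ray, LogPlane.re, Complex.sub_re, Complex.ofReal_re]
  exact EReal.coe_lt_coe_iff.2 (by linarith [hx i])

theorem ray_mem_logPolydisk {x : Fin m → ℝ} (hx : ∀ i, x i < τ.logR i) {ζ : ℂ} (hζ : 0 ≤ ζ.re)
    {k : Fin m → ℝ≥0} {p : ℕ} (h : k = 0 ∨ log (1 + p) < (∑ i, (k i : ℝ)) * ζ.re) :
    toLog (ray x ζ) ∈ logPolydisk k τ.logR p := by
  refine ⟨ray_mem_logDisk hx hζ, h.imp_right fun h => ?_⟩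
  simp only [toLog, ray, LogPlane.re, Complex.sub_re, Complex.ofReal_re]
  simp_rw [← EReal.coe_mul]
  rw [← EReal.coe_finset_sum, EReal.coe_lt_coe_iff]
  have h1 : ∑ i, (k i : ℝ) * (x i - ζ.re) = ∑ i, (k i : ℝ) * x i - (∑ i, (k i : ℝ)) * ζ.re := by
    rw [Finset.sum_mul, ← Finset.sum_sub_distrib]
    exact Finset.sum_congr rfl fun i _ => by ring
  have h2 : ∑ i, (k i : ℝ) * x i ≤ ∑ i, (k i : ℝ) * τ.logR i :=
    Finset.sum_le_sum fun i _ => mul_le_mul_of_nonneg_left (hx i).le (k i).2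
  rw [h1]
  linarith

theorem ray_mem_Sp {x : Fin m → ℝ} (hx : ∀ i, x i < τ.logR i) {ζ : ℂ} {p : ℕ}
    (hζ : ζ ∈ summDomain τ.levels τ.θ p) : toLog (ray x ζ) ∈ τ.Sp p := by
  refine Set.mem_iInter₂.2 fun k hk => ?_
  by_cases h0 : k = 0
  · exact Or.inr (ray_mem_logPolydisk hx hζ.1.le (Or.inl h0))
  · rcases hζ.2 _ (mem_levels hk h0) with h | h
    · left
      refine ⟨ray_mem_logDisk hx hζ.1.le, ?_⟩
      simpa [toLog, ray, LogPlane.im, ← Finset.sum_mul] using h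
    · exact Or.inr (ray_mem_logPolydisk hx hζ.1.le (Or.inr h))

theorem ray_mem_Hp {x : Fin m → ℝ} (hx : ∀ i, x i < τ.logR i) {ζ : ℂ} {p : ℕ} (hζ : 0 ≤ ζ.re)
    (h : log (1 + p) < τ.minLevel * ζ.re) : toLog (ray x ζ) ∈ τ.Hp p := by
  refine Set.mem_iInter₂.2 fun k hk => ray_mem_logPolydisk hx hζ ?_
  by_cases h0 : k = 0
  · exact Or.inl h0
  · exact Or.inr (h.trans_le (mul_le_mul_of_nonneg_right (minLevel_le (mem_levels hk h0)) hζ))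

variable (τ) in
/-- The abscissa beyond which the diagonal rays lie in `H_p`. -/
noncomputable def shift (p : ℕ) : ℝ := log (2 + p) / τ.minLevel

theorem shift_pos (p : ℕ) : 0 < τ.shift p :=
  div_pos (log_pos (by linarith [p.cast_nonneg (α := ℝ)])) minLevel_pos

/-- The shift is built with 2 + p in place of 1 + p to make this strict; this also keeps it positive
at p = 0. -/
theorem log_lt_minLevel_mul_shift (p : ℕ) : log (1 + p) < τ.minLevel * τ.shift p := by
  rw [shift, mul_div_cancel₀ _ minLevel_pos.ne']
  exact log_lt_log (by positivity) (by linarith)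

/-- Provides the polyradius at which ‖F_p‖ is evaluated to bound the coefficients. -/
theorem exp_mem_Dp {x : Fin m → ℝ} (hx : ∀ i, x i < τ.logR i) (p : ℕ) :
    (fun i => ((exp (x i - τ.shift p) : ℝ) : ℂ)) ∈ τ.Dp p := by
  have hsh := τ.shift_pos p
  have hR : ∀ i, τ.R i = exp (τ.logR i) := fun i => (exp_log (τ.R_pos i)).symm
  refine Set.mem_iInter₂.2 fun k hk => ⟨fun i => ?_, ?_⟩
  · rw [Complex.norm_real, norm_of_nonneg (exp_pos _).le, hR]
    exact exp_lt_exp.2 (by linarith [hx i])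
  · by_cases h0 : k = 0
    · exact Or.inl h0
    · right
      have h1 : ∀ i, ‖((exp (x i - τ.shift p) : ℝ) : ℂ)‖ ^ (k i : ℝ) =
          exp ((k i : ℝ) * (x i - τ.shift p)) := by
        intro i
        rw [Complex.norm_real, norm_of_nonneg (exp_pos _).le, ← exp_mul, mul_comm]
      have h2 : ∀ i, τ.R i ^ (k i : ℝ) = exp ((k i : ℝ) * τ.logR i) := by
        intro i
        rw [hR, ← exp_mul, mul_comm]
      simp_rw [h1, h2]
      rw [← exp_sum, ← exp_sum, lt_div_iff₀ (by positivity)]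
      nth_rewrite 1 [← exp_log (by positivity : (0 : ℝ) < 1 + p)]
      rw [← exp_add]
      apply exp_lt_exp.2
      have h3 : ∑ i, (k i : ℝ) * (x i - τ.shift p) =
          ∑ i, (k i : ℝ) * x i - (∑ i, (k i : ℝ)) * τ.shift p := by
        rw [Finset.sum_mul, ← Finset.sum_sub_distrib]
        exact Finset.sum_congr rfl fun i _ => by ring
      have h4 : ∑ i, (k i : ℝ) * x i ≤ ∑ i, (k i : ℝ) * τ.logR i :=
        Finset.sum_le_sum fun i _ => mul_le_mul_of_nonneg_left (hx i).le (k i).2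
      have h5 := log_lt_minLevel_mul_shift (τ := τ) p
      have h6 := mul_le_mul_of_nonneg_right (minLevel_le (mem_levels hk h0)) hsh.le
      rw [h3]
      linarith

/-- The modulus of the monomial of exponent `α` on the diagonal ray through `x`. -/
noncomputable def rayMonomial (x : Fin m → ℝ) (α : Fin m → ℝ≥0) (t : ℝ) : ℝ :=
  exp (∑ i, (α i : ℝ) * x i - (∑ i, (α i : ℝ)) * t)

theorem rayMonomial_pos (x : Fin m → ℝ) (α : Fin m → ℝ≥0) (t : ℝ) : 0 < rayMonomial x α t :=
  exp_pos _

theorem rayMonomial_eq_mul (x : Fin m → ℝ) (α : Fin m → ℝ≥0) (s t : ℝ) :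
    rayMonomial x α t = rayMonomial x α s * exp ((s - t) * ∑ i, (α i : ℝ)) := by
  rw [rayMonomial, rayMonomial, ← exp_add]
  congr 1; ring

theorem prod_expMul_ray (x : Fin m → ℝ) (α : Fin m → ℝ≥0) (ζ : ℂ) :
    ∏ i, (toLog (ray x ζ) i).expMul (α i) =
      Complex.exp (∑ i, (α i : ℝ) * x i - (∑ i, (α i : ℝ)) * ζ) := by
  simp only [toLog, ray, LogPlane.expMul]
  rw [← Complex.exp_sum]
  congr 1
  push_cast
  rw [Finset.sum_mul, ← Finset.sum_sub_distrib]
  exact Finset.sum_congr rfl fun i _ => by ring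

theorem norm_prod_expMul_ray (x : Fin m → ℝ) (α : Fin m → ℝ≥0) (ζ : ℂ) :
    ‖∏ i, (toLog (ray x ζ) i).expMul (α i)‖ = rayMonomial x α ζ.re := by
  rw [prod_expMul_ray, Complex.norm_exp, rayMonomial]
  congr 1
  rw [Complex.sub_re, Complex.re_ofReal_mul, Complex.ofReal_re]

variable (τ) in
/-- The exponential rate of decay of the summands. -/
noncomputable def rate : ℝ := log τ.r

theorem rate_pos : 0 < τ.rate := log_pos τ.one_lt_r

/-- A single term is at most the total, and r^{-p} is e^{-ℓp} with ℓ = log r. Only this geometric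
decay is used from here on. -/
theorem le_ofReal_of_tsum_lt_top {u : ℕ → ℝ≥0∞} (h : ∑' p, u p * ENNReal.ofReal τ.r ^ p < ⊤) :
    ∃ C : ℝ, 0 ≤ C ∧ ∀ p, u p ≤ ENNReal.ofReal (C * exp (-τ.rate * p)) := by
  refine ⟨(∑' p, u p * ENNReal.ofReal τ.r ^ p).toReal, ENNReal.toReal_nonneg, fun p => ?_⟩
  have hr : 0 < τ.r := zero_lt_one.trans τ.one_lt_r
  have h1 : u p * ENNReal.ofReal τ.r ^ p ≤ ∑' p, u p * ENNReal.ofReal τ.r ^ p := ENNReal.le_tsum p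
  have h2 : exp (-τ.rate * p) = (τ.r ^ p)⁻¹ := by
    rw [neg_mul, exp_neg, mul_comm, exp_nat_mul, rate, exp_log hr]
  rw [ENNReal.ofReal_mul ENNReal.toReal_nonneg, ENNReal.ofReal_toReal h.ne, h2,
    ENNReal.ofReal_inv_of_pos (by positivity), ENNReal.ofReal_pow hr.le, ← div_eq_mul_inv]
  refine (ENNReal.le_div_iff_mul_le (Or.inl ?_) (Or.inl ?_)).2 h1
  · exact pow_ne_zero _ (by simpa using hr)
  · exact ENNReal.pow_ne_top ENNReal.ofReal_ne_top

/-! ### Coefficient bounds and truncation errors -/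

namespace IsSumOf

variable {f : τ.S → ℂ} {fp : ℕ → (Fin m → LogPlane) → ℂ} {F : ℕ → GenPowerSeries m}

theorem exists_bound (hf : τ.IsSumOf f fp F) : ∃ C : ℝ, 0 ≤ C ∧
    (∀ p, ∀ w ∈ τ.Sp p, ‖fp p w‖ ≤ C * exp (-τ.rate * p)) ∧
    ∀ p, (F p).normOn (τ.Dp p) ≤ ENNReal.ofReal (C * exp (-τ.rate * p)) := by
  obtain ⟨C₁, h₁, hC₁⟩ := le_ofReal_of_tsum_lt_top hf.summable_sup
  obtain ⟨C₂, h₂, hC₂⟩ := le_ofReal_of_tsum_lt_top hf.summable_series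
  refine ⟨max C₁ C₂, h₁.trans (le_max_left _ _), fun p w hw => ?_, fun p => ?_⟩
  · have h := (le_iSup₂_of_le (f := fun w _ => ‖fp p w‖ₑ) w hw le_rfl).trans (hC₁ p)
    rw [← ofReal_norm, ENNReal.ofReal_le_ofReal_iff (by positivity)] at h
    exact h.trans (mul_le_mul_of_nonneg_right (le_max_left _ _) (exp_pos _).le)
  · refine (hC₂ p).trans (ENNReal.ofReal_le_ofReal ?_)
    exact mul_le_mul_of_nonneg_right (le_max_right _ _) (exp_pos _).le

variable {C : ℝ}

/-- The sum is the norm of F at the polyradius with components e^{x_i - shift p}, which lies in D_p.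
-/
theorem summable_norm_coeff_mul {F : GenPowerSeries m} {p : ℕ} {x : Fin m → ℝ}
    (hx : ∀ i, x i < τ.logR i) (hC : 0 ≤ C)
    (h : F.normOn (τ.Dp p) ≤ ENNReal.ofReal (C * exp (-τ.rate * p))) :
    (Summable fun α => ‖F.coeff α‖ * rayMonomial x α (τ.shift p)) ∧
      ∑' α, ‖F.coeff α‖ * rayMonomial x α (τ.shift p) ≤ C * exp (-τ.rate * p) := by
  refine summable_and_tsum_le_of_tsum_ofReal_le
    (fun α => mul_nonneg (norm_nonneg _) (rayMonomial_pos _ _ _).le) (by positivity) ?_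
  refine le_trans (le_of_eq ?_) ((F.normAt_le_normOn (s := fun i => exp (x i - τ.shift p))
    (fun i => exp_pos _) (subset_closure (exp_mem_Dp hx p))).trans h)
  unfold GenPowerSeries.normAt
  refine tsum_congr fun α => ?_
  rw [ENNReal.ofReal_mul (norm_nonneg _), ofReal_norm]
  congr 2
  simp_rw [← exp_mul]
  rw [← exp_sum, rayMonomial, Finset.sum_mul, ← Finset.sum_sub_distrib]
  congr 1
  exact Finset.sum_congr rfl fun i _ => by ring

theorem norm_coeff_mul_le {F : GenPowerSeries m} {p : ℕ} {x : Fin m → ℝ}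
    (hx : ∀ i, x i < τ.logR i) (hC : 0 ≤ C)
    (h : F.normOn (τ.Dp p) ≤ ENNReal.ofReal (C * exp (-τ.rate * p))) (s : Finset (Fin m → ℝ≥0)) :
    ∑ α ∈ s, ‖F.coeff α‖ * rayMonomial x α (τ.shift p) ≤ C * exp (-τ.rate * p) := by
  obtain ⟨h1, h2⟩ := summable_norm_coeff_mul hx hC h
  exact (h1.sum_le_tsum s fun α _ =>
    mul_nonneg (norm_nonneg _) (rayMonomial_pos _ _ _).le).trans h2

theorem exists_lt_logR (τ : SummParam m) : ∃ x : Fin m → ℝ, ∀ i, x i < τ.logR i :=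
  ⟨fun i => τ.logR i - 1, fun i => by linarith⟩

/-- The coefficients of a given exponent are absolutely summable. -/
theorem summable_coeff (hf : τ.IsSumOf f fp F) (α : Fin m → ℝ≥0) :
    Summable fun p => (F p).coeff α := by
  obtain ⟨C, hC, -, hF⟩ := hf.exists_bound
  obtain ⟨x, hx⟩ := exists_lt_logR τ
  -- Passing from the shifted point to the base point costs e^{|α| shift p} = (2 + p)^ν, a
  -- polynomial in p.
  set ν := (∑ i, (α i : ℝ)) / τ.minLevel with hν
  have hα : 0 ≤ ∑ i, (α i : ℝ) := Finset.sum_nonneg fun i _ => (α i).2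
  obtain ⟨C', hC', h⟩ := exists_exp_mul_exp_log_le (ν := ν) τ.rate_pos (div_nonneg hα minLevel_pos.le)
  have hs : Summable fun p : ℕ => (C * C' / rayMonomial x α 0) * exp (-(τ.rate / 2) * p) :=
    (summable_exp_neg_mul_nat (half_pos τ.rate_pos)).mul_left _
  refine Summable.of_norm_bounded hs fun p => ?_
  have h1 := norm_coeff_mul_le hx hC (hF p) {α}
  rw [Finset.sum_singleton, rayMonomial_eq_mul x α 0] at h1
  have h2 : exp ((0 - τ.shift p) * ∑ i, (α i : ℝ)) = (exp (ν * log (2 + p)))⁻¹ := by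
    rw [← exp_neg]
    congr 1
    rw [hν, shift]; ring
  have hpos := rayMonomial_pos x α 0
  have hpos2 := exp_pos (ν * log (2 + p))
  rw [h2] at h1
  have h3 : ‖(F p).coeff α‖ * rayMonomial x α 0 ≤
      C * (exp (-τ.rate * p) * exp (ν * log (2 + p))) := by
    calc ‖(F p).coeff α‖ * rayMonomial x α 0
        = ‖(F p).coeff α‖ * (rayMonomial x α 0 * (exp (ν * log (2 + p)))⁻¹) *
          exp (ν * log (2 + p)) := by field_simp
      _ ≤ C * exp (-τ.rate * p) * exp (ν * log (2 + p)) := by gcongr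
      _ = _ := by ring
  have h4 := h3.trans (mul_le_mul_of_nonneg_left (h p) hC)
  rw [← le_div_iff₀ hpos] at h4
  refine h4.trans (le_of_eq ?_)
  ring

/-- The error of a truncation of the series of `f_p` on a diagonal ray. -/
theorem norm_sub_sum_le (hf : τ.IsSumOf f fp F) (hC : 0 ≤ C)
    (hfp : ∀ p, ∀ w ∈ τ.Sp p, ‖fp p w‖ ≤ C * exp (-τ.rate * p))
    (hF : ∀ p, (F p).normOn (τ.Dp p) ≤ ENNReal.ofReal (C * exp (-τ.rate * p)))
    {x : Fin m → ℝ} (hx : ∀ i, x i < τ.logR i) {A : Finset (Fin m → ℝ≥0)} {N : ℝ}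
    (hA : ∀ α ∈ A, ∑ i, (α i : ℝ) ≤ N) (hA' : ∀ α ∈ τ.Δ, α ∉ A → N ≤ ∑ i, (α i : ℝ))
    (hN : 0 ≤ N) {p : ℕ} {ζ : ℂ} (hζ : ζ ∈ summDomain τ.levels τ.θ p) :
    ‖fp p (toLog (ray x ζ)) - ∑ α ∈ A, (F p).coeff α * ∏ i, (toLog (ray x ζ) i).expMul (α i)‖ ≤
      2 * (C * exp (-τ.rate * p) * exp ((τ.shift p - ζ.re) * N)) := by
  classical
  have hCp : 0 ≤ C * exp (-τ.rate * p) := by positivity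
  obtain ⟨hs1, hs2⟩ := summable_norm_coeff_mul hx hC (hF p)
  -- Beyond the shift the ray lies in H_p and the error is the tail of the series, each monomial of
  -- which has degree at least N. Before it, the function and its truncation are bounded separately,
  -- since e^{(shift p - Re ζ)N} is at least 1.
  rcases le_or_gt (τ.shift p) ζ.re with h | h
  · have hH : toLog (ray x ζ) ∈ τ.Hp p := ray_mem_Hp hx hζ.1.le
      ((log_lt_minLevel_mul_shift p).trans_le (mul_le_mul_of_nonneg_left h minLevel_pos.le))
    have h1 : HasSum (fun α => (F p).coeff α * ∏ i, (toLog (ray x ζ) i).expMul (α i))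
        (fp p (toLog (ray x ζ))) := hf.hasLogSum p _ hH
    have h2 : HasSum (fun α => if α ∈ A then
        (F p).coeff α * ∏ i, (toLog (ray x ζ) i).expMul (α i) else 0)
        (∑ α ∈ A, (F p).coeff α * ∏ i, (toLog (ray x ζ) i).expMul (α i)) := by
      rw [← Finset.sum_congr rfl fun α (hα : α ∈ A) => if_pos hα]
      exact hasSum_sum_of_ne_finset_zero fun α hα => if_neg hα
    refine ((h1.sub h2).norm_le_of_bounded
      (hs1.hasSum.mul_right (exp ((τ.shift p - ζ.re) * N))) fun α => ?_).trans ?_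
    · split_ifs with hα
      · rw [sub_self, norm_zero]
        exact mul_nonneg (mul_nonneg (norm_nonneg _) (rayMonomial_pos _ _ _).le) (exp_pos _).le
      · rw [sub_zero, norm_mul, norm_prod_expMul_ray, rayMonomial_eq_mul x α (τ.shift p), ← mul_assoc]
        by_cases h0 : (F p).coeff α = 0
        · simp [h0]
        · have h3 := hA' α (hf.support_subset p h0) hα
          refine mul_le_mul_of_nonneg_left (exp_le_exp.2 ?_)
            (mul_nonneg (norm_nonneg _) (rayMonomial_pos _ _ _).le)
          exact mul_le_mul_of_nonpos_left h3 (by linarith)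
    · have h4 := mul_le_mul_of_nonneg_right hs2 (exp_pos ((τ.shift p - ζ.re) * N)).le
      have h5 : 0 ≤ C * exp (-τ.rate * p) * exp ((τ.shift p - ζ.re) * N) := by positivity
      linarith
  · have h1 : ‖fp p (toLog (ray x ζ))‖ ≤ C * exp (-τ.rate * p) * exp ((τ.shift p - ζ.re) * N) := by
      refine (hfp p _ (ray_mem_Sp hx hζ)).trans (le_mul_of_one_le_right hCp (one_le_exp ?_))
      exact mul_nonneg (by linarith) hN
    have h2 : ‖∑ α ∈ A, (F p).coeff α * ∏ i, (toLog (ray x ζ) i).expMul (α i)‖ ≤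
        C * exp (-τ.rate * p) * exp ((τ.shift p - ζ.re) * N) := by
      refine (norm_sum_le _ _).trans (le_trans (Finset.sum_le_sum fun α hα => ?_)
        (le_trans (Finset.sum_mul _ _ _).ge
          (mul_le_mul_of_nonneg_right (norm_coeff_mul_le hx hC (hF p) A) (exp_pos _).le)))
      rw [norm_mul, norm_prod_expMul_ray, rayMonomial_eq_mul x α (τ.shift p), ← mul_assoc]
      refine mul_le_mul_of_nonneg_left (exp_le_exp.2 ?_)
        (mul_nonneg (norm_nonneg _) (rayMonomial_pos _ _ _).le)
      exact mul_le_mul_of_nonneg_left (hA α hα) (by linarith)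
    refine (norm_sub_le _ _).trans ?_
    linarith

/-- The truncation is an exponential polynomial, so no domain is required of ζ. This serves for the
indices whose f_p may be undefined at ζ. The summand 1 covers the ζ beyond the shift. -/
theorem norm_sum_coeff_mul_le (hC : 0 ≤ C)
    (hF : ∀ p, (F p).normOn (τ.Dp p) ≤ ENNReal.ofReal (C * exp (-τ.rate * p)))
    {x : Fin m → ℝ} (hx : ∀ i, x i < τ.logR i) {A : Finset (Fin m → ℝ≥0)} {N : ℝ}
    (hA : ∀ α ∈ A, ∑ i, (α i : ℝ) ≤ N) (p : ℕ) (ζ : ℂ) :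
    ‖∑ α ∈ A, (F p).coeff α * ∏ i, (toLog (ray x ζ) i).expMul (α i)‖ ≤
      C * exp (-τ.rate * p) * (1 + exp ((τ.shift p - ζ.re) * N)) := by
  refine (norm_sum_le _ _).trans (le_trans (Finset.sum_le_sum fun α hα => ?_)
    (le_trans (Finset.sum_mul _ _ _).ge
      (mul_le_mul_of_nonneg_right (norm_coeff_mul_le hx hC (hF p) A) (by positivity))))
  rw [norm_mul, norm_prod_expMul_ray, rayMonomial_eq_mul x α (τ.shift p), ← mul_assoc]
  refine mul_le_mul_of_nonneg_left ?_ (mul_nonneg (norm_nonneg _) (rayMonomial_pos _ _ _).le)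
  have hα0 : 0 ≤ ∑ i, (α i : ℝ) := Finset.sum_nonneg fun i _ => (α i).2
  rcases le_or_gt (τ.shift p) ζ.re with h | h
  · have h1 : exp ((τ.shift p - ζ.re) * ∑ i, (α i : ℝ)) ≤ 1 :=
      exp_le_one_iff.2 (mul_nonpos_of_nonpos_of_nonneg (by linarith) hα0)
    have := exp_pos ((τ.shift p - ζ.re) * N)
    linarith
  · have h1 : exp ((τ.shift p - ζ.re) * ∑ i, (α i : ℝ)) ≤ exp ((τ.shift p - ζ.re) * N) :=
      exp_le_exp.2 (mul_le_mul_of_nonneg_left (hA α hα) (by linarith))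
    linarith

end IsSumOf

end SummParam

/-! ### The coefficients of a representation of 0 -/

namespace SummParam

open Real Filter Topology

variable {m : ℕ} {τ : SummParam m}

/-- Truncation at the degree κ(ℓ/2)y with y = e^{κt}, κ the smallest level: the bound log((2 + p)/y)
≤ (2 + p)/y - 1 makes the error decay in y and leaves half of the decay in p. -/
theorem exp_shift_le {p : ℕ} {t : ℝ} :
    exp (-τ.rate * p) * exp ((τ.shift p - t) *
      (τ.minLevel * (τ.rate / 2 * exp (τ.minLevel * t)))) ≤
      exp τ.rate * exp (-(τ.rate / 2) * p) * exp (-(τ.rate / 2) * exp (τ.minLevel * t)) := by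
  have hℓ := τ.rate_pos
  rw [← exp_add, ← exp_add, ← exp_add]
  apply exp_le_exp.2
  set y := exp (τ.minLevel * t) with hy
  have hypos : 0 < y := exp_pos _
  have h1 : (τ.shift p - t) * (τ.minLevel * (τ.rate / 2 * y)) =
      (log (2 + p) - log y) * (τ.rate / 2 * y) := by
    have : τ.shift p * τ.minLevel = log (2 + p) := div_mul_cancel₀ _ minLevel_pos.ne'
    rw [hy, log_exp, ← this]; ring
  have h2 : log (2 + p) - log y ≤ (2 + p) / y - 1 := by
    rw [← log_div (by positivity) hypos.ne']
    exact log_le_sub_one_of_pos (by positivity)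
  have h3 := mul_le_mul_of_nonneg_right h2 (by positivity : 0 ≤ τ.rate / 2 * y)
  have h4 : ((2 + p) / y - 1) * (τ.rate / 2 * y) = τ.rate / 2 * (2 + p) - τ.rate / 2 * y := by
    field_simp
  rw [h1]
  linarith

theorem real_mem_summDomain {t : ℝ} (ht : 0 < t) (p : ℕ) :
    (t : ℂ) ∈ summDomain τ.levels τ.θ p := by
  refine ⟨by simpa using ht, fun k _ => Or.inl ?_⟩
  have : 0 < τ.θ := lt_trans (by positivity) τ.pi_div_two_lt_θ
  simpa using this

theorem ray_mem_S {x : Fin m → ℝ} (hx : ∀ i, x i < τ.logR i) {t : ℝ} (ht : 0 ≤ t) :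
    toLog (ray x t) ∈ τ.S := by
  refine Set.mem_iInter₂.2 fun k _ => ⟨ray_mem_logDisk hx (by simpa using ht), ?_⟩
  have : 0 < τ.θ := lt_trans (by positivity) τ.pi_div_two_lt_θ
  simpa [toLog, ray, LogPlane.im] using this

/-- The monomials are linearly independent on the set of real points of `S`. -/
theorem eq_zero_of_sum_exp_eq_zero {A : Finset (Fin m → ℝ≥0)} {c : (Fin m → ℝ≥0) → ℂ}
    {ρ : Fin m → ℝ}
    (h : ∀ x : Fin m → ℝ, (∀ i, x i < ρ i) → ∑ α ∈ A, c α * rayMonomial x α 0 = 0) :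
    ∀ α ∈ A, c α = 0 := by
  -- Monomials restricted to an orthant of real points are characters of the monoid [0, ∞)^m, and
  -- distinct characters are linearly independent (Dedekind). The orthant is based at ρ - 1 to stay
  -- strictly below ρ.
  let χ : (Fin m → ℝ≥0) → (Multiplicative (Fin m → ℝ≥0) →* ℂ) := fun α =>
    { toFun := fun y => ((exp (-∑ i, (α i : ℝ) * (y.toAdd i : ℝ)) : ℝ) : ℂ)
      map_one' := by simp
      map_mul' := by
        intro y z
        rw [← Complex.ofReal_mul, ← exp_add, ← neg_add, ← Finset.sum_add_distrib]
        simp [mul_add] }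
  have hχ : ∀ α y, χ α y = ((exp (-∑ i, (α i : ℝ) * (y.toAdd i : ℝ)) : ℝ) : ℂ) := fun _ _ => rfl
  have hinj : Function.Injective χ := by
    intro α β hαβ
    funext i
    have h1 := DFunLike.congr_fun hαβ (Multiplicative.ofAdd (Pi.single i 1))
    rw [hχ, hχ] at h1
    have h2 := exp_injective (Complex.ofReal_injective h1)
    simpa [Pi.single_apply, apply_ite ((↑) : ℝ≥0 → ℝ)] using h2
  have hlin := (linearIndependent_monoidHom (Multiplicative (Fin m → ℝ≥0)) ℂ).comp χ hinj
  have h0 := linearIndependent_iff'.1 hlin A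
    (fun α => c α * (exp (∑ i, (α i : ℝ) * (ρ i - 1)) : ℝ)) ?_
  · intro α hα
    exact (mul_eq_zero.1 (h0 α hα)).resolve_right (Complex.ofReal_ne_zero.2 (exp_pos _).ne')
  · funext y
    have h1 := h (fun i => ρ i - 1 - (y.toAdd i : ℝ)) fun i => by
      have := (y.toAdd i).2
      have h2 : (0 : ℝ) ≤ (y.toAdd i : ℝ) := this
      linarith
    rw [Pi.zero_apply, ← h1, Finset.sum_apply]
    refine Finset.sum_congr rfl fun α _ => ?_
    simp only [Pi.smul_apply, Function.comp_apply, hχ, smul_eq_mul]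
    rw [mul_assoc, ← Complex.ofReal_mul, ← exp_add, rayMonomial, mul_zero, sub_zero]
    congr 3
    rw [← Finset.sum_neg_distrib, ← Finset.sum_add_distrib]
    exact Finset.sum_congr rfl fun i _ => by ring

/-- There is a gap above each total degree of a natural set. -/
theorem exists_gap {Δ : Set (Fin m → ℝ≥0)} (hΔ : IsNaturalSet Δ) (N : ℝ) :
    ∃ N', N < N' ∧ ∀ α ∈ Δ, N < ∑ i, (α i : ℝ) → N' ≤ ∑ i, (α i : ℝ) := by
  classical
  set B := (finite_sum_le_of_isNaturalSet hΔ (N + 1)).toFinset with hB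
  -- The element N + 1 keeps E nonempty and handles all degrees above N + 1, of which there may be
  -- infinitely many.
  set E := insert (N + 1) ((B.image fun α => ∑ i, (α i : ℝ)).filter (N < ·)) with hE
  have hne : E.Nonempty := ⟨_, Finset.mem_insert_self _ _⟩
  refine ⟨E.min' hne, ?_, fun α hα hN => ?_⟩
  · rw [Finset.lt_min'_iff]
    intro y hy
    rcases Finset.mem_insert.1 hy with rfl | hy
    · linarith
    · exact (Finset.mem_filter.1 hy).2
  · rcases le_or_gt (∑ i, (α i : ℝ)) (N + 1) with h | h
    · refine E.min'_le _ (Finset.mem_insert_of_mem (Finset.mem_filter.2 ⟨?_, hN⟩))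
      exact Finset.mem_image_of_mem _ (by rw [hB, Set.Finite.mem_toFinset]; exact ⟨hα, h⟩)
    · exact (E.min'_le _ (Finset.mem_insert_self _ _)).trans h.le

namespace IsSumOf

variable {f : τ.S → ℂ} {fp : ℕ → (Fin m → LogPlane) → ℂ} {F : ℕ → GenPowerSeries m}

theorem hasSum_truncation (hf : τ.IsSumOf f fp F) (A : Finset (Fin m → ℝ≥0)) (x : Fin m → ℝ)
    (ζ : ℂ) : HasSum (fun p => ∑ α ∈ A, (F p).coeff α * ∏ i, (toLog (ray x ζ) i).expMul (α i))
      (∑ α ∈ A, (∑' p, (F p).coeff α) * ∏ i, (toLog (ray x ζ) i).expMul (α i)) :=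
  hasSum_sum fun α _ => (hf.summable_coeff α).hasSum.mul_right _

/-- The coefficients of a representation of `0` sum up to `0`. -/
theorem tsum_coeff_eq_zero (hf : τ.IsSumOf 0 fp F) (α : Fin m → ℝ≥0) :
    ∑' p, (F p).coeff α = 0 := by
  classical
  set c : (Fin m → ℝ≥0) → ℂ := fun α => ∑' p, (F p).coeff α with hc
  by_contra hα
  have hcΔ : ∀ α, c α ≠ 0 → α ∈ τ.Δ := by
    intro β hβ
    by_contra h
    refine hβ ?_
    have : ∀ p, (F p).coeff β = 0 := fun p => by
      by_contra h0
      exact h (hf.support_subset p h0)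
    simp [hc, this]
  obtain ⟨C, hC, hfp, hF⟩ := hf.exists_bound
  -- The bound by the degree of α makes the candidates finite, so that a nonzero coefficient of
  -- least degree exists.
  set B := (finite_sum_le_of_isNaturalSet τ.Δ_natural (∑ i, (α i : ℝ))).toFinset.filter
    (c · ≠ 0) with hB
  have hαB : α ∈ B := by
    rw [hB, Finset.mem_filter, Set.Finite.mem_toFinset]
    exact ⟨⟨hcΔ α hα, le_rfl⟩, hα⟩
  obtain ⟨β, hβ, hmin⟩ := B.exists_min_image (fun α => ∑ i, (α i : ℝ)) ⟨α, hαB⟩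
  have hβc : c β ≠ 0 := (Finset.mem_filter.1 hβ).2
  set N := ∑ i, (β i : ℝ) with hN
  have hlow : ∀ γ, ∑ i, (γ i : ℝ) < N → c γ = 0 := by
    intro γ hγ
    by_contra h0
    have h1 : γ ∈ B := by
      rw [hB, Finset.mem_filter, Set.Finite.mem_toFinset]
      exact ⟨⟨hcΔ γ h0, (hγ.le.trans (hmin α hαB))⟩, h0⟩
    exact absurd (hmin γ h1) (not_le.2 hγ)
  obtain ⟨N', hNN', hgap⟩ := exists_gap τ.Δ_natural N
  set A := (finite_sum_le_of_isNaturalSet τ.Δ_natural N).toFinset with hA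
  have hmemA : ∀ γ, γ ∈ A ↔ γ ∈ τ.Δ ∧ ∑ i, (γ i : ℝ) ≤ N := fun γ => Set.Finite.mem_toFinset _
  have hN0 : 0 ≤ N := Finset.sum_nonneg fun i _ => (β i).2
  obtain ⟨C', hC', hgeom⟩ := exists_exp_mul_exp_log_le (ν := N' / τ.minLevel) τ.rate_pos
    (div_nonneg (hN0.trans hNN'.le) minLevel_pos.le)
  refine hβc (eq_zero_of_sum_exp_eq_zero (ρ := τ.logR) (A := A) (c := c) (fun x hx => ?_) β
    ((hmemA β).2 ⟨hcΔ β hβc, le_rfl⟩))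
  set S := ∑' p : ℕ, exp (-(τ.rate / 2) * p) with hS
  have hbound : ∀ t : ℝ, 0 < t →
      ‖∑ γ ∈ A, c γ * rayMonomial x γ 0‖ ≤ 2 * C * C' * S * exp (-(N' - N) * t) := by
    intro t ht
    have h1 : HasSum (fun p => fp p (toLog (ray x t))) 0 := hf.hasSum ⟨_, ray_mem_S hx ht.le⟩
    have h2 := h1.sub (hf.hasSum_truncation A x t)
    have h3 : HasSum (fun p : ℕ => 2 * C * C' * exp (-N' * t) * exp (-(τ.rate / 2) * p))
        (2 * C * C' * exp (-N' * t) * S) :=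
      (summable_exp_neg_mul_nat (half_pos τ.rate_pos)).hasSum.mul_left _
    have h4 := h2.norm_le_of_bounded h3 fun p => by
      refine (hf.norm_sub_sum_le hC hfp hF hx
        (fun γ hγ => (((hmemA γ).1 hγ).2).trans hNN'.le)
        (fun γ hγ hγA => hgap γ hγ ?_) (hN0.trans hNN'.le) (real_mem_summDomain ht p)).trans ?_
      · by_contra h
        exact hγA ((hmemA γ).2 ⟨hγ, not_lt.1 h⟩)
      · have h5 : exp ((τ.shift p - t) * N') =
            exp (N' / τ.minLevel * log (2 + p)) * exp (-N' * t) := by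
          rw [← exp_add]; congr 1
          rw [shift]; ring
        rw [Complex.ofReal_re, h5]
        calc 2 * (C * exp (-τ.rate * p) * (exp (N' / τ.minLevel * log (2 + p)) * exp (-N' * t)))
            = 2 * C * exp (-N' * t) *
              (exp (-τ.rate * p) * exp (N' / τ.minLevel * log (2 + p))) := by ring
          _ ≤ 2 * C * exp (-N' * t) * (C' * exp (-(τ.rate / 2) * p)) :=
              mul_le_mul_of_nonneg_left (hgeom p) (by positivity)
          _ = _ := by ring
    rw [zero_sub, norm_neg] at h4
    -- Only the coefficients of degree exactly N survive, so the truncated sum is homogeneous along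
    -- the ray.
    have h6 : ∑ γ ∈ A, c γ * ∏ i, (toLog (ray x t) i).expMul (γ i) =
        (exp (-N * t) : ℝ) * ∑ γ ∈ A, c γ * rayMonomial x γ 0 := by
      rw [Finset.mul_sum]
      refine Finset.sum_congr rfl fun γ hγ => ?_
      rcases (((hmemA γ).1 hγ).2).lt_or_eq with hlt | heq
      · rw [hlow γ hlt]; simp
      · rw [prod_expMul_ray, rayMonomial, heq]
        push_cast
        rw [mul_left_comm, ← Complex.exp_add]
        congr 2
        ring
    rw [h6, norm_mul, Complex.norm_real, norm_of_nonneg (exp_pos _).le] at h4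
    have h7 : exp (N * t) * exp (-N * t) = 1 := by rw [← exp_add]; simp
    calc ‖∑ γ ∈ A, c γ * rayMonomial x γ 0‖
        = exp (N * t) * (exp (-N * t) * ‖∑ γ ∈ A, c γ * rayMonomial x γ 0‖) := by
          rw [← mul_assoc, h7, one_mul]
      _ ≤ exp (N * t) * (2 * C * C' * exp (-N' * t) * S) := by gcongr
      _ = 2 * C * C' * S * (exp (N * t) * exp (-N' * t)) := by ring
      _ = _ := by
          rw [← exp_add]; congr 2; ring
  have hlim : Tendsto (fun t : ℝ => 2 * C * C' * S * exp (-(N' - N) * t)) atTop (𝓝 0) := by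
    have h1 : Tendsto (fun t : ℝ => exp (-(N' - N) * t)) atTop (𝓝 0) := by
      refine tendsto_exp_atBot.comp (tendsto_id.const_mul_atTop_of_neg ?_)
      linarith
    simpa using h1.const_mul (2 * C * C' * S)
  rw [← norm_le_zero_iff]
  exact ge_of_tendsto hlim ((eventually_gt_atTop 0).mono hbound)

/-! ### Flatness on diagonal rays and vanishing at real points -/

/-- The functions `f_p` on a diagonal ray. -/
theorem isSummFamily (hf : τ.IsSumOf f fp F) {C : ℝ} (hC : 0 ≤ C)
    (hfp : ∀ p, ∀ w ∈ τ.Sp p, ‖fp p w‖ ≤ C * exp (-τ.rate * p))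
    {x : Fin m → ℝ} (hx : ∀ i, x i < τ.logR i) :
    IsSummFamily τ.levels τ.θ τ.rate C fun p ζ => fp p (toLog (ray x ζ)) where
  level_pos _ h := levels_pos h
  rate_pos := τ.rate_pos
  const_nonneg := hC
  differentiableOn p := by
    refine (hf.logHolomorphic p).2.comp (t := toLog ⁻¹' τ.Sp p) (f := ray x) ?_
      fun ζ hζ => ray_mem_Sp hx hζ
    exact Differentiable.differentiableOn
      (differentiable_pi.2 fun i => (differentiable_const _).sub differentiable_id)
  norm_le p ζ hζ := hfp p _ (ray_mem_Sp hx hζ)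

/-- Each f_p is replaced by its truncation P_p, whose degree depends on ζ. The errors sum to a flat
term, and as ∑_p P_p = 0, the remaining partial sum is minus a tail. The width η is arbitrary
because the truncation error depends on Re ζ only. -/
theorem isFlat (hf : τ.IsSumOf f fp F) (h0 : ∀ α, ∑' p, (F p).coeff α = 0) {C : ℝ} (hC : 0 ≤ C)
    (hfp : ∀ p, ∀ w ∈ τ.Sp p, ‖fp p w‖ ≤ C * exp (-τ.rate * p))
    (hF : ∀ p, (F p).normOn (τ.Dp p) ≤ ENNReal.ofReal (C * exp (-τ.rate * p)))
    {x : Fin m → ℝ} (hx : ∀ i, x i < τ.logR i) (η : ℝ) :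
    IsFlat τ.levels τ.θ (fun p ζ => fp p (toLog (ray x ζ))) η τ.minLevel := by
  have hℓ := τ.rate_pos
  set S := ∑' p : ℕ, exp (-(τ.rate / 2) * p) with hS
  have hsummS := summable_exp_neg_mul_nat (half_pos hℓ)
  have hS0 : 0 ≤ S := tsum_nonneg fun p => (exp_pos _).le
  refine ⟨3 * C * exp τ.rate * S + C * S, τ.rate / 2, by positivity, half_pos hℓ, ?_⟩
  intro ζ hre _ n hn
  set Y := exp (-(τ.rate / 2) * exp (τ.minLevel * ζ.re)) with hY
  -- The degree for which `exp_shift_le` bounds the error.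
  set N := τ.minLevel * (τ.rate / 2 * exp (τ.minLevel * ζ.re)) with hNdef
  have hN : 0 ≤ N := mul_nonneg minLevel_pos.le (by positivity)
  set A := (finite_sum_le_of_isNaturalSet τ.Δ_natural N).toFinset with hA
  have hmemA : ∀ γ, γ ∈ A ↔ γ ∈ τ.Δ ∧ ∑ i, (γ i : ℝ) ≤ N := fun γ => Set.Finite.mem_toFinset _
  have hA1 : ∀ γ ∈ A, ∑ i, (γ i : ℝ) ≤ N := fun γ hγ => ((hmemA γ).1 hγ).2
  have hA2 : ∀ γ ∈ τ.Δ, γ ∉ A → N ≤ ∑ i, (γ i : ℝ) := by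
    intro γ hγ hγA
    by_contra h
    exact hγA ((hmemA γ).2 ⟨hγ, (not_le.1 h).le⟩)
  set P : ℕ → ℂ := fun p => ∑ α ∈ A, (F p).coeff α * ∏ i, (toLog (ray x ζ) i).expMul (α i) with hP
  have hPsum : HasSum P 0 := by
    have := hf.hasSum_truncation A x ζ
    simpa [h0] using this
  have h1 : ‖∑ p ∈ Finset.range n, (fp p (toLog (ray x ζ)) - P p)‖ ≤
      2 * C * exp τ.rate * S * Y := by
    have hterm : ∀ p ∈ Finset.range n, ‖fp p (toLog (ray x ζ)) - P p‖ ≤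
        2 * C * exp τ.rate * Y * exp (-(τ.rate / 2) * p) := by
      intro p hp
      refine (hf.norm_sub_sum_le hC hfp hF hx hA1 hA2 hN (hn p (Finset.mem_range.1 hp))).trans ?_
      have := mul_le_mul_of_nonneg_left (exp_shift_le (τ := τ) (p := p) (t := ζ.re)) hC
      rw [← hY, ← hNdef] at this
      calc 2 * (C * exp (-τ.rate * p) * exp ((τ.shift p - ζ.re) * N))
          = 2 * (C * (exp (-τ.rate * p) * exp ((τ.shift p - ζ.re) * N))) := by ring
        _ ≤ 2 * (C * (exp τ.rate * exp (-(τ.rate / 2) * p) * Y)) := by gcongr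
        _ = _ := by ring
    refine (norm_sum_le_of_le _ hterm).trans ?_
    · rw [← Finset.mul_sum]
      have := sum_exp_neg_mul_nat_le (half_pos hℓ) (Finset.range n)
      calc 2 * C * exp τ.rate * Y * ∑ p ∈ Finset.range n, exp (-(τ.rate / 2) * p)
          ≤ 2 * C * exp τ.rate * Y * S := by
            have hY0 : 0 ≤ 2 * C * exp τ.rate * Y := by positivity
            exact mul_le_mul_of_nonneg_left this hY0
        _ = _ := by ring
  have h2 : ‖∑ p ∈ Finset.range n, P p‖ ≤
      (C * exp (-(τ.rate / 2) * n) + C * exp τ.rate * Y) * S := by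
    -- For p ≥ n the point ζ may lie outside the domain of f_p, but the truncations are defined
    -- everywhere.
    have h3 := (hasSum_nat_add_iff' n).2 hPsum
    rw [zero_sub] at h3
    rw [← norm_neg]
    refine h3.norm_le_of_bounded (hsummS.hasSum.mul_left _) fun p => ?_
    refine (norm_sum_coeff_mul_le hC hF hx hA1 (p + n) ζ).trans ?_
    have h4 := mul_le_mul_of_nonneg_left (exp_shift_le (τ := τ) (p := p + n) (t := ζ.re)) hC
    rw [← hY, ← hNdef] at h4
    have h5 : exp (-τ.rate * ((p + n : ℕ) : ℝ)) ≤
        exp (-(τ.rate / 2) * n) * exp (-(τ.rate / 2) * p) := by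
      rw [← exp_add]
      apply exp_le_exp.2
      push_cast
      have : 0 ≤ τ.rate * p := by positivity
      have : 0 ≤ τ.rate * n := by positivity
      linarith
    have h6 : exp (-(τ.rate / 2) * ((p + n : ℕ) : ℝ)) ≤ exp (-(τ.rate / 2) * p) := by
      apply exp_le_exp.2
      push_cast
      have : 0 ≤ τ.rate * n := by positivity
      linarith
    calc C * exp (-τ.rate * ((p + n : ℕ) : ℝ)) * (1 + exp ((τ.shift (p + n) - ζ.re) * N))
        = C * exp (-τ.rate * ((p + n : ℕ) : ℝ)) + C * (exp (-τ.rate * ((p + n : ℕ) : ℝ)) *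
            exp ((τ.shift (p + n) - ζ.re) * N)) := by ring
      _ ≤ C * (exp (-(τ.rate / 2) * n) * exp (-(τ.rate / 2) * p)) +
          C * (exp τ.rate * exp (-(τ.rate / 2) * ((p + n : ℕ) : ℝ)) * Y) :=
          add_le_add (mul_le_mul_of_nonneg_left h5 hC) h4
      _ ≤ C * (exp (-(τ.rate / 2) * n) * exp (-(τ.rate / 2) * p)) +
          C * (exp τ.rate * exp (-(τ.rate / 2) * p) * Y) := by gcongr
      _ = _ := by ring
  calc ‖∑ p ∈ Finset.range n, fp p (toLog (ray x ζ))‖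
      ≤ ‖∑ p ∈ Finset.range n, (fp p (toLog (ray x ζ)) - P p)‖ + ‖∑ p ∈ Finset.range n, P p‖ := by
        refine (le_of_eq ?_).trans (norm_add_le _ _)
        rw [Finset.sum_sub_distrib, sub_add_cancel]
    _ ≤ 2 * C * exp τ.rate * S * Y + (C * exp (-(τ.rate / 2) * n) + C * exp τ.rate * Y) * S :=
        add_le_add h1 h2
    _ ≤ _ := by
        have e1 : 0 ≤ C * exp τ.rate * S * exp (-(τ.rate / 2) * n) := by positivity
        have e2 : 0 ≤ C * S * Y := by positivity
        linarith

/-- Quasianalyticity on the real points. -/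
theorem tsum_eq_zero_of_real (hf : τ.IsSumOf f fp F) (h0 : ∀ α, ∑' p, (F p).coeff α = 0)
    {x : Fin m → ℝ} (hx : ∀ i, x i < τ.logR i) :
    ∑' p, fp p (toLog fun i => (x i : ℂ)) = 0 := by
  obtain ⟨C, hC, hfp, hF⟩ := hf.exists_bound
  -- Watson's lemma speaks of t > 0 only, so the ray starts at x + ε and x is reached at ζ = ε.
  obtain ⟨ε, hε, hxε⟩ : ∃ ε : ℝ, 0 < ε ∧ ∀ i, x i + ε < τ.logR i := by
    have h1 : ∀ᶠ ε : ℝ in 𝓝[>] 0, ∀ i, x i + ε < τ.logR i := by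
      refine eventually_all.2 fun i => ?_
      have h2 : Tendsto (fun ε : ℝ => x i + ε) (𝓝[>] 0) (𝓝 (x i + 0)) :=
        (tendsto_const_nhds.add tendsto_id).mono_left nhdsWithin_le_nhds
      exact h2.eventually_lt_const (by rw [add_zero]; exact hx i)
    obtain ⟨ε, h3, h4⟩ := (h1.and self_mem_nhdsWithin).exists
    exact ⟨ε, h4, h3⟩
  obtain ⟨η, hη, hηθ⟩ := exists_between τ.pi_div_two_lt_θ
  have h := (hf.isSummFamily hC hfp hxε).tsum_eq_zero τ.levels_nonempty hη hηθ minLevel_pos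
    (fun k hk => minLevel_le hk) (hf.isFlat h0 hC hfp hF hxε η) hε
  have hray : ray (fun i => x i + ε) (ε : ℂ) = fun i => (x i : ℂ) := by
    funext i
    simp [ray]
  simpa only [hray] using h

end IsSumOf

end SummParam

/-! ### From real points to all of `τ.S` -/

theorem LogPlane.tendsto_negInf :
    Filter.Tendsto (fun t : ℝ => LogPlane.ofComplex (-t : ℝ)) Filter.atTop
      (nhds LogPlane.negInf) := by
  intro U hU
  obtain ⟨V, hVU, hVo, hV⟩ := mem_nhds_iff.1 hU
  obtain ⟨r, hr⟩ := hVo.2 hV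
  refine Filter.mem_map.2 ?_
  filter_upwards [Filter.eventually_gt_atTop (-r)] with t ht
  refine hVU (hr ?_)
  change ((((-t : ℝ) : ℂ).re : ℝ) : EReal) < r
  rw [Complex.ofReal_re, EReal.coe_lt_coe_iff]
  linarith

/-- The point with the coordinates `-∞` replaced by `-t`. -/
noncomputable def LogPlane.truncate (t : ℝ) : LogPlane → ℂ
  | LogPlane.negInf => (-t : ℝ)
  | LogPlane.ofComplex z => z

theorem LogPlane.tendsto_truncate (w : LogPlane) :
    Filter.Tendsto (fun t : ℝ => LogPlane.ofComplex (w.truncate t)) Filter.atTop (nhds w) := by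
  cases w with
  | negInf => exact LogPlane.tendsto_negInf
  | ofComplex z => exact tendsto_const_nhds

theorem LogPlane.im_truncate (t : ℝ) (w : LogPlane) : (w.truncate t).im = w.im := by
  cases w <;> simp [LogPlane.truncate, LogPlane.im]

theorem LogPlane.eventually_truncate_re_lt {w : LogPlane} {ρ : ℝ} (h : w.re < ρ) :
    ∀ᶠ t : ℝ in Filter.atTop, (w.truncate t).re < ρ := by
  cases w with
  | negInf =>
    filter_upwards [Filter.eventually_gt_atTop (-ρ)] with t ht
    simp only [LogPlane.truncate, Complex.ofReal_re]
    linarith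
  | ofComplex z => exact Filter.Eventually.of_forall fun t => EReal.coe_lt_coe_iff.1 h

namespace SummParam

open Filter Topology

variable {m : ℕ} {τ : SummParam m}

theorem toLog_mem_S {z : Fin m → ℂ} : toLog z ∈ τ.S ↔
    (∀ i, (z i).re < τ.logR i) ∧ ∀ k ∈ τ.K, ∑ i, (k i : ℝ) * |(z i).im| < τ.θ := by
  have h : toLog z ∈ τ.S ↔
      ∀ k ∈ τ.K, (∀ i, (z i).re < τ.logR i) ∧ ∑ i, (k i : ℝ) * |(z i).im| < τ.θ := by
    simp only [S, Set.mem_iInter, logPolysector, logDisk, toLog, LogPlane.re, LogPlane.im,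
      Set.mem_ofPred_eq, EReal.coe_lt_coe_iff]
  obtain ⟨k₀, hk₀⟩ := τ.K_nonempty
  rw [h]
  exact ⟨fun h => ⟨(h k₀ hk₀).1, fun k hk => (h k hk).2⟩, fun h k hk => ⟨h.1, h.2 k hk⟩⟩

variable {f : τ.S → ℂ} {fp : ℕ → (Fin m → LogPlane) → ℂ} {F : ℕ → GenPowerSeries m}

theorem IsSumOf.summable_bound {C : ℝ} : Summable fun p : ℕ => C * Real.exp (-τ.rate * p) :=
  (summable_exp_neg_mul_nat τ.rate_pos).mul_left C

/-- Quasianalyticity on the finite points. -/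
theorem IsSumOf.tsum_eq_zero_of_finite (hf : τ.IsSumOf f fp F)
    (h0 : ∀ α, ∑' p, (F p).coeff α = 0) {z : Fin m → ℂ} (hz : toLog z ∈ τ.S) :
    ∑' p, fp p (toLog z) = 0 := by
  obtain ⟨C, hC, hfp, -⟩ := hf.exists_bound
  -- A complex line that passes through real points at real s and through z at s = i. The identity
  -- theorem on it transports the vanishing to z.
  let l : ℂ → Fin m → ℂ := fun s i => (z i).re + s * (z i).im
  have hl : Differentiable ℂ l := differentiable_pi.2 fun i => by fun_prop
  have hre : ∀ s i, (l s i).re = (z i).re + s.re * (z i).im := by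
    intro s i; simp [l]
  have him : ∀ s i, (l s i).im = s.im * (z i).im := by
    intro s i; simp [l]
  set V : Set ℂ := {s | toLog (l s) ∈ τ.S} with hV
  have hVmem : ∀ s, s ∈ V ↔ (∀ i, (z i).re + s.re * (z i).im < τ.logR i) ∧
      ∀ k ∈ τ.K, ∑ i, (k i : ℝ) * |s.im * (z i).im| < τ.θ := by
    intro s
    change toLog (l s) ∈ τ.S ↔ _
    rw [toLog_mem_S]
    simp only [hre, him]
  have hz' := toLog_mem_S.1 hz
  have h0V : (0 : ℂ) ∈ V := by
    rw [hVmem]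
    refine ⟨fun i => by simpa using hz'.1 i, fun k _ => ?_⟩
    have : 0 < τ.θ := lt_trans (by positivity) τ.pi_div_two_lt_θ
    simpa using this
  have hIV : Complex.I ∈ V := by
    rw [hVmem]
    simpa using hz'
  have hVo : IsOpen V := by
    have : V = (⋂ i, {s : ℂ | (z i).re + s.re * (z i).im < τ.logR i}) ∩
        ⋂ k ∈ τ.K, {s : ℂ | ∑ i, (k i : ℝ) * |s.im * (z i).im| < τ.θ} := by
      ext s
      rw [hVmem, Set.mem_inter_iff, Set.mem_iInter, Set.mem_iInter₂]
      rfl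
    rw [this]
    refine IsOpen.inter (isOpen_iInter_of_finite fun i => ?_)
      (isOpen_biInter_finset fun k _ => ?_)
    · exact isOpen_lt (by fun_prop) continuous_const
    · exact isOpen_lt (by fun_prop) continuous_const
  have hVc : IsPreconnected V := by
    -- Scaling s by a factor in [0, 1] shrinks imaginary parts and keeps each real part between its
    -- values at 0 and at s.
    refine (StarConvex.isPathConnected (starConvex_zero_iff.2 fun s hs a ha0 ha1 => ?_)
      h0V).isConnected.isPreconnected
    rw [hVmem] at hs ⊢
    simp only [Complex.real_smul, Complex.re_ofReal_mul, Complex.im_ofReal_mul, mul_assoc]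
    refine ⟨fun i => ?_, fun k hk => lt_of_le_of_lt (Finset.sum_le_sum fun i _ => ?_) (hs.2 k hk)⟩
    · rcases le_total (s.re * (z i).im) 0 with h | h
      · exact lt_of_le_of_lt (by linarith [mul_nonpos_of_nonneg_of_nonpos ha0 h]) (hz'.1 i)
      · exact lt_of_le_of_lt (by linarith [mul_le_of_le_one_left h ha1]) (hs.1 i)
    · rw [abs_mul a, abs_of_nonneg ha0]
      exact mul_le_mul_of_nonneg_left (mul_le_of_le_one_left (abs_nonneg _) ha1) (k i).2
  have hdiff : DifferentiableOn ℂ (fun s => ∑' p, fp p (toLog (l s))) V := by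
    refine Complex.differentiableOn_tsum_of_summable_norm (summable_bound (τ := τ) (C := C))
      (fun p => ?_) hVo fun p s hs => hfp p _ (S_subset_Sp p hs)
    exact (hf.logHolomorphic p).2.comp hl.differentiableOn fun s hs => S_subset_Sp p hs
  have hreal : ∀ t : ℝ, (t : ℂ) ∈ V → ∑' p, fp p (toLog (l t)) = 0 := by
    intro t ht
    rw [hVmem] at ht
    have hlt : l t = fun i => (((z i).re + t * (z i).im : ℝ) : ℂ) := by
      funext i
      simp [l]
    rw [hlt]
    exact hf.tsum_eq_zero_of_real h0 fun i => by simpa using ht.1 i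
  have hlim : Tendsto (fun t : ℝ => (t : ℂ)) (𝓝[>] 0) (𝓝[≠] 0) := by
    refine tendsto_nhdsWithin_iff.2 ⟨?_, ?_⟩
    · exact (Complex.continuous_ofReal.tendsto' 0 0 Complex.ofReal_zero).mono_left
        nhdsWithin_le_nhds
    · filter_upwards [self_mem_nhdsWithin] with t ht
      exact Complex.ofReal_ne_zero.2 (ne_of_gt ht)
  have hev : ∀ᶠ t : ℝ in 𝓝[>] 0, ∑' p, fp p (toLog (l t)) = 0 := by
    filter_upwards [hlim (nhdsWithin_le_nhds (hVo.mem_nhds h0V))] with t ht using hreal t ht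
  have hI := (hdiff.analyticOnNhd hVo).eqOn_zero_of_preconnected_of_frequently_eq_zero hVc h0V
    (hlim.frequently hev.frequently) hIV
  have hlI : l Complex.I = z := by
    funext i
    simp only [l]
    rw [mul_comm, Complex.re_add_im]
  simpa only [hlI, Pi.zero_apply] using hI

/-- Quasianalyticity. -/
theorem IsSumOf.eq_zero (hf : τ.IsSumOf f fp F) (h0 : ∀ α, ∑' p, (F p).coeff α = 0) : f = 0 := by
  obtain ⟨C, hC, hfp, -⟩ := hf.exists_bound
  funext w
  obtain ⟨w, hw⟩ := w
  rw [Pi.zero_apply, ← (hf.hasSum ⟨w, hw⟩).tsum_eq]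
  have hcont : ContinuousOn (fun w => ∑' p, fp p w) τ.S :=
    continuousOn_tsum (fun p => (hf.logHolomorphic p).1.mono (S_subset_Sp p))
      (summable_bound (τ := τ) (C := C)) fun p w hw => hfp p w (S_subset_Sp p hw)
  have hlim : Tendsto (fun t : ℝ => toLog fun i => (w i).truncate t) atTop (𝓝 w) :=
    tendsto_pi_nhds.2 fun i => LogPlane.tendsto_truncate (w i)
  have hmem : ∀ᶠ t : ℝ in atTop, toLog (fun i => (w i).truncate t) ∈ τ.S := by
    have hw' : ∀ k ∈ τ.K, w ∈ logPolysector k τ.logR τ.θ := fun k hk => Set.mem_iInter₂.1 hw k hk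
    obtain ⟨k₀, hk₀⟩ := τ.K_nonempty
    filter_upwards [eventually_all.2 fun i =>
      LogPlane.eventually_truncate_re_lt ((hw' k₀ hk₀).1 i)] with t ht
    rw [toLog_mem_S]
    refine ⟨ht, fun k hk => ?_⟩
    simp only [LogPlane.im_truncate]
    exact (hw' k hk).2
  have h1 : Tendsto (fun t : ℝ => ∑' p, fp p (toLog fun i => (w i).truncate t)) atTop
      (𝓝 (∑' p, fp p w)) :=
    (hcont w hw).tendsto.comp (tendsto_nhdsWithin_iff.2 ⟨hlim, hmem⟩)
  refine tendsto_nhds_unique h1 ((tendsto_congr' ?_).2 tendsto_const_nhds)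
  filter_upwards [hmem] with t ht using hf.tsum_eq_zero_of_finite h0 ht

/-! ### The map `T` -/

/-- The difference of two representations of f represents 0. -/
theorem IsSumOf.tsum_coeff_unique {fp' : ℕ → (Fin m → LogPlane) → ℂ} {F' : ℕ → GenPowerSeries m}
    (hf : τ.IsSumOf f fp F) (hf' : τ.IsSumOf f fp' F') (α : Fin m → ℝ≥0) :
    ∑' p, (F p).coeff α = ∑' p, (F' p).coeff α := by
  have h := hf.sub hf'
  rw [sub_self] at h
  have h1 := h.tsum_coeff_eq_zero α
  simp only [HahnSeries.coeff_add, HahnSeries.coeff_smul, smul_eq_mul, neg_one_mul] at h1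
  rw [Summable.tsum_add (hf.summable_coeff α) (hf'.summable_coeff α).neg, tsum_neg] at h1
  exact eq_of_sub_eq_zero (by rw [sub_eq_add_neg]; exact h1)

variable (τ) in
/-- The algebra `𝒢_τ`. -/
def algebra : NonUnitalSubalgebra ℂ (τ.S → ℂ) where
  carrier := τ.G
  add_mem' := by
    rintro f g ⟨fp, F, hf⟩ ⟨gp, G, hg⟩
    exact ⟨_, _, hf.add hg⟩
  zero_mem' := ⟨_, _, IsSumOf.zero⟩
  mul_mem' := by
    rintro f g ⟨fp, F, hf⟩ ⟨gp, G, hg⟩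
    exact ⟨_, _, hf.mul hg⟩
  smul_mem' := by
    rintro c f ⟨fp, F, hf⟩
    exact ⟨_, _, hf.smul c⟩

/-- The series `∑_p F_p`. -/
noncomputable def IsSumOf.series (hf : τ.IsSumOf f fp F) : GenPowerSeries m where
  coeff α := ∑' p, (F p).coeff α
  isPWO_support' := by
    refine (isPWO_of_isNaturalSet τ.Δ_natural).mono fun α hα => ?_
    by_contra h
    refine hα ?_
    have : ∀ p, (F p).coeff α = 0 := fun p => by
      by_contra h0
      exact h (hf.support_subset p h0)
    simp [this]

/-- The series `T f` of `f ∈ 𝒢_τ`. -/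
noncomputable def seriesMap (f : τ.algebra) : GenPowerSeries m :=
  f.2.choose_spec.choose_spec.series

theorem hasSum_coeff_seriesMap {f : τ.algebra} {fp : ℕ → (Fin m → LogPlane) → ℂ}
    {F : ℕ → GenPowerSeries m} (hf : τ.IsSumOf (f : τ.S → ℂ) fp F) (α : Fin m → ℝ≥0) :
    HasSum (fun p => (F p).coeff α) ((seriesMap f).coeff α) := by
  have h := hf.tsum_coeff_unique f.2.choose_spec.choose_spec α
  have h1 := (hf.summable_coeff α).hasSum
  rwa [h] at h1

theorem exists_isSumOf (f : τ.algebra) : ∃ fp F, τ.IsSumOf (f : τ.S → ℂ) fp F := f.2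

variable (τ) in
/-- The map `T` as a homomorphism of algebras. -/
noncomputable def seriesHom : τ.algebra →ₙₐ[ℂ] GenPowerSeries m where
  toFun := seriesMap
  map_smul' := by
    intro c f
    obtain ⟨fp, F, hf⟩ := exists_isSumOf f
    ext α
    have h1 := hasSum_coeff_seriesMap (f := c • f) (hf.smul c) α
    exact h1.unique ((hasSum_coeff_seriesMap hf α).mul_left c)
  map_zero' := by
    ext α
    exact (hasSum_coeff_seriesMap (f := 0) IsSumOf.zero α).unique hasSum_zero
  map_add' := by
    intro f g
    obtain ⟨fp, F, hf⟩ := exists_isSumOf f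
    obtain ⟨gp, G, hg⟩ := exists_isSumOf g
    ext α
    have h1 := hasSum_coeff_seriesMap (f := f + g) (hf.add hg) α
    exact h1.unique ((hasSum_coeff_seriesMap hf α).add (hasSum_coeff_seriesMap hg α))
  map_mul' := by
    intro f g
    obtain ⟨fp, F, hf⟩ := exists_isSumOf f
    obtain ⟨gp, G, hg⟩ := exists_isSumOf g
    have hΔ := isPWO_of_isNaturalSet τ.Δ_natural
    -- With all supports in Δ, the coefficient of every product is a sum over one and the same
    -- finite antidiagonal, and each of its terms is a product of two series in p.
    have hsupp : ∀ f : τ.algebra, (seriesMap f).support ⊆ τ.Δ := by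
      intro f α hα
      obtain ⟨fp, F, hf⟩ := exists_isSumOf f
      by_contra h
      refine hα ((hasSum_coeff_seriesMap hf α).unique ?_)
      have : ∀ p, (F p).coeff α = 0 := fun p => by
        by_contra h0
        exact h (hf.support_subset p h0)
      simp only [this]
      exact hasSum_zero
    ext α
    have h1 := hasSum_coeff_seriesMap (f := f * g) (hf.mul hg) α
    refine h1.unique ?_
    rw [GenPowerSeries.coeff_mul_of_support_subset hΔ (hsupp f) (hsupp g)]
    refine (hasSum_sum fun x _ => hasSum_sum_maxPairs (hasSum_coeff_seriesMap hf x.1)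
      (hasSum_coeff_seriesMap hg x.2)).congr_fun fun n => ?_
    rw [HahnSeries.coeff_sum, Finset.sum_comm]
    refine Finset.sum_congr rfl fun y _ => ?_
    rw [GenPowerSeries.coeff_mul_of_support_subset hΔ (hf.support_subset _) (hg.support_subset _)]

theorem seriesHom_injective : Function.Injective τ.seriesHom := by
  refine (injective_iff_map_eq_zero τ.seriesHom).2 fun f hf0 => ?_
  obtain ⟨fp, F, hf⟩ := exists_isSumOf f
  refine Subtype.ext (hf.eq_zero fun α => ?_)
  have h1 : (seriesMap f).coeff α = 0 := by
    have : seriesMap f = 0 := hf0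
    rw [this, HahnSeries.coeff_zero]
  rw [(hasSum_coeff_seriesMap hf α).tsum_eq, h1]

end SummParam

/-- Independence of the representation lies in the quantifiers: `T f` is fixed before `fp` and `F`,
and limits are unique. `HasSum` in ℂ includes absolute convergence. -/
theorem mainTheorem5 {m : ℕ} (τ : SummParam m) :
    ∃ A : NonUnitalSubalgebra ℂ (τ.S → ℂ), (A : Set (τ.S → ℂ)) = τ.G ∧
      ∃ T : A →ₙₐ[ℂ] GenPowerSeries m,
        (∀ (f : A) (fp : ℕ → (Fin m → LogPlane) → ℂ) (F : ℕ → GenPowerSeries m),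
          τ.IsSumOf (f : τ.S → ℂ) fp F →
            ∀ α, HasSum (fun p => (F p).coeff α) ((T f).coeff α)) ∧
        (0 ∈ τ.Δ → ∃ h : (1 : τ.S → ℂ) ∈ A, T ⟨1, h⟩ = 1) ∧
        Function.Injective T := by
  refine ⟨τ.algebra, rfl, τ.seriesHom, fun f fp F hf α => SummParam.hasSum_coeff_seriesMap hf α,
    fun h => ⟨⟨_, _, SummParam.IsSumOf.one h⟩, ?_⟩, SummParam.seriesHom_injective⟩
  ext α
  refine (SummParam.hasSum_coeff_seriesMap (f := ⟨1, _⟩) (SummParam.IsSumOf.one h) α).unique ?_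
  refine (hasSum_ite_eq 0 ((1 : GenPowerSeries m).coeff α)).congr_fun fun p => ?_
  split_ifs <;> simp
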